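/- **Formulas and nets.** Let $\mathcal A$ be a set of atoms. Formulas are built from $a$, $a^\bot$ ($a\in\mathcal A$), $1$ and $\bot$ by the binary connectives $\otimes$ and $⅋$; negation is defined by $a^{\bot\bot}=a$, $1^\bot=\bot$, $\bot^\bot=1$, $(A\otimes B)^\bot=B^\bot⅋A^\bot$, $(A⅋B)^\bot=B^\bot\otimes A^\bot$. A *cut* is an expression $B⊚B^\bot$. An *ordinary pre-proof net with cuts* is a finite list $A_0,\dots,A_n,B_1⊚B_1^\bot,\dots,B_m⊚B_m^\bot$ of formulas and cuts, viewed as a forest of binary trees, together with a perfect matching (the *axiom links*) of its leaves such that matched leaves carry dual labels ($a$ and $a^\bot$, or $1$ and $\bot$). A *switching* is a graph obtained from the forest with its axiom links by deleting, at every $⅋$-node, one of the two edges to its children. The net is an *ordinary proof net* if all its switchings are connected and acyclic. A *cut elimination step* replaces a cut $(A\otimes B)⊚(B^\bot⅋A^\bot)$ or $(A⅋B)⊚(B^\bot\otimes A^\bot)$ by the two cuts $A⊚A^\bot$, $B⊚B^\bot$, or removes a cut between two leaves and merges the two distinct axiom links attached to them into one. **Equivariant families.** Let $\mathcal C$ be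 a $*$-autonomous category, i.e. a symmetric monoidal category with duals $(-)^\bot$ with respect to a dualizing object $\bot=1^\bot$, and $X⅋Y=(Y^\bot\otimes X^\bot)^\bot$. For objects $X_0,\dots,X_n$ of $\mathcal C$, an *equivariant family* consists of an arrow $\bigotimes_I\{X_i^\bot\mid i\in I\}\to ⅋_{\complement I}\{X_i\mid i\in\complement I\}$ for all bracketings of all subsets $I\subseteq\{0,\dots,n\}$ and of their complements, such that all these arrows are transposes of each other (the empty tensor is $1$ and the empty par is $\bot$). Each member, called a *representative*, determines the family. **Interpretation.** Let $G^\circ:\mathcal A\to\mathrm{Obj}(\mathcal C)$ be a map, and put $G(a)=G^\circ(a)$, $G(a^\bot)=G^\circ(a)^\bot$, $G(1)=1$, $G(\bot)=\bot$, $G(A\otimes B)=G(A)\otimes G(B)$, $G(A⅋B)=G(A)⅋G(B)$; there is a canonical isomorphism $G(A^\bot)\cong G(A)^\bot$, which is the identity if $\mathcal C$ is strict. For an ordinary proof net $\pi$ as above, the interpretation $G^\flat(\pi)$ is constructed as follows. * If $m=0$: a single axiom link $a,a^\bot$ (or $1,\bot$) gives the family of the identity of $G(a)$ (or of $1$). If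 $\pi$ has a root $A⅋B$ and the net with this root removed has the representative $f:\bigotimes\{G(A_i)^\bot\}\to G(A)⅋G(B)$, then $f:\bigotimes\{G(A_i)^\bot\}\to G(A⅋B)$ is a representative for $\pi$. If $\pi$ has a root $A\otimes B$ whose removal splits $\pi$ into two nets with representatives $f:\bigotimes\{G(A_i)^\bot\mid i\in K\}\to G(A)$ and $g:\bigotimes\{G(A_i)^\bot\mid i\in L\}\to G(B)$, then $f\otimes g$ is a representative for $\pi$. * If $m>0$: replace each cut $B_j⊚B_j^\bot$ by the formula $B_j\otimes B_j^\bot$, take a representative $\bigotimes\{G(A_i)^\bot\}\to ⅋\{G(B_j)\otimes G(B_j^\bot)\}$ for the resulting net, and compose it with the par of the evaluations $G(B_j)\otimes G(B_j^\bot)\cong G(B_j)\otimes G(B_j)^\bot\to\bot$, followed by $⅋\{\bot\}\cong\bot$. **Lemma.** Let $\pi$ be an ordinary proof net with conclusions $A_0,\dots,A_n,B_1⊚B_1^\bot,\dots,B_m⊚B_m^\bot$, where the $A_i$ are not cuts, and let $\pi'$ be obtained from $\pi$ by a finite number of cut elimination steps; in particular, $\pi'$ may be the cut-free normal form of $\pi$,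 with conclusions $A_0,\dots,A_n$. Then $\pi$ and $\pi'$ determine the same equivariant family: there is an equivariant family of arrows $$\bigotimes_I\{G(A_i)^\bot\mid i\in I\}\;\longrightarrow\;⅋_{\complement I}\{G(A_i)\mid i\in\complement I\},$$ indexed by the bracketings of the subsets $I\subseteq\{0,\dots,n\}$ and of their complements, that consists exactly of the representatives of $G^\flat(\pi)$, and exactly of the representatives of $G^\flat(\pi')$, whatever order of removing roots is used in the constructions. -/

import Mathlib

open CategoryTheory MonoidalCategory

universe w v u

namespace OrdinaryNets

/-! ### *-autonomous categories -/

/-- A *-autonomous category: a symmetric monoidal category in which every object `A` has a dual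
`A^⊥` representing `X ↦ Hom(X ⊗ A, ⊥)`, where `⊥ = 1^⊥`, and in which the canonical maps
`A ⟶ A^⊥⊥` are isomorphisms (that is, `⊥` is a dualizing object).  The functor `(-)^⊥`, the
bifunctor `⅋` and the bijection `Hom(A ⊗ B, X) ≃ Hom(A, X ⅋ B^⊥)` are derived below.
The category is strict when the canonical maps `A ⟶ A^⊥⊥` are identities; this is not required. -/
class StarAutonomous (C : Type u) [Category.{v} C] [MonoidalCategory C] [SymmetricCategory C] where
  /-- the dual `A^⊥` -/
  dual : C → C
  /-- the evaluation `A^⊥ ⊗ A ⟶ ⊥` -/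
  ev (A : C) : dual A ⊗ A ⟶ dual (𝟙_ C)
  ev_unit : ev (𝟙_ C) = (ρ_ (dual (𝟙_ C))).hom
  /-- transposition `Hom(X ⊗ A, ⊥) → Hom(X, A^⊥)` -/
  transpose {X A : C} : (X ⊗ A ⟶ dual (𝟙_ C)) → (X ⟶ dual A)
  transpose_ev {X A : C} (f : X ⊗ A ⟶ dual (𝟙_ C)) : transpose f ▷ A ≫ ev A = f
  transpose_uniq {X A : C} (g : X ⟶ dual A) : transpose (g ▷ A ≫ ev A) = g
  isIso_bidual (A : C) : IsIso (transpose ((β_ A (dual A)).hom ≫ ev A))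

namespace StarAutonomous

variable {C : Type u} [Category.{v} C] [MonoidalCategory C] [SymmetricCategory C]
  [StarAutonomous C]

/-- The dualizing object `⊥ = 1^⊥`. -/
abbrev bot (C : Type u) [Category.{v} C] [MonoidalCategory C] [SymmetricCategory C]
    [StarAutonomous C] : C := dual (𝟙_ C)

/-- The evaluation `A ⊗ A^⊥ ⟶ ⊥`: the co-name of the identity of `A`. -/
def coname (A : C) : A ⊗ dual A ⟶ bot C := (β_ A (dual A)).hom ≫ ev A

/-- The canonical map `A ⟶ A^⊥⊥`. -/
def bidual (A : C) : A ⟶ dual (dual A) := transpose (coname A)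

/-- The action of `(-)^⊥` on arrows. -/
def dualMap {A B : C} (f : A ⟶ B) : dual B ⟶ dual A := transpose (dual B ◁ f ≫ ev B)

/-- `A ⅋ B = (B^⊥ ⊗ A^⊥)^⊥`. -/
def par (A B : C) : C := dual (dual B ⊗ dual A)

/-- The action of `⅋` on arrows. -/
def parMap {A A' B B' : C} (f : A ⟶ A') (g : B ⟶ B') : par A B ⟶ par A' B' :=
  dualMap (dualMap g ⊗ₘ dualMap f)

/-- The unit isomorphism `⊥ ⅋ ⊥ ⟶ ⊥`: the dual of `1 ≅ 1 ⊗ 1 ≅ ⊥^⊥ ⊗ ⊥^⊥`. -/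
def parBot : par (bot C) (bot C) ⟶ bot C :=
  dualMap ((λ_ (𝟙_ C)).inv ≫ (bidual (𝟙_ C) ⊗ₘ bidual (𝟙_ C)))

theorem transpose_naturality {X Y A : C} (h : Y ⟶ X) (f : X ⊗ A ⟶ bot C) :
    transpose (h ▷ A ≫ f) = h ≫ transpose f := by
  rw [← transpose_uniq (h ≫ transpose f), comp_whiskerRight, Category.assoc, transpose_ev]

theorem dualMap_ev {A B : C} (f : A ⟶ B) : dualMap f ▷ A ≫ ev A = dual B ◁ f ≫ ev B :=
  transpose_ev _

/-- `(-)^⊥` as a contravariant functor. -/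
def dualFunctor (C : Type u) [Category.{v} C] [MonoidalCategory C] [SymmetricCategory C]
    [StarAutonomous C] : Cᵒᵖ ⥤ C where
  obj A := dual A.unop
  map f := dualMap f.unop
  map_id A := by
    change dualMap (𝟙 A.unop) = 𝟙 _
    rw [← transpose_uniq (𝟙 (dual A.unop))]
    simp [dualMap]
  map_comp {A B D} f g := by
    change dualMap (g.unop ≫ f.unop) = dualMap f.unop ≫ dualMap g.unop
    rw [← transpose_uniq (dualMap f.unop ≫ dualMap g.unop), comp_whiskerRight, Category.assoc,
      dualMap_ev, ← whisker_exchange_assoc, dualMap_ev, dualMap]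
    simp

/-- Transposition as a bijection. -/
def transposeEquiv (X A : C) : (X ⊗ A ⟶ bot C) ≃ (X ⟶ dual A) where
  toFun f := transpose f
  invFun g := g ▷ A ≫ ev A
  left_inv f := transpose_ev f
  right_inv g := transpose_uniq g

/-- The canonical isomorphism `A ≅ A^⊥⊥`. -/
noncomputable def bidualIso (A : C) : A ≅ dual (dual A) :=
  haveI : IsIso (bidual A) := isIso_bidual A
  asIso (bidual A)

/-- The bijection `Hom(A ⊗ B, X) ≃ Hom(A, X ⅋ B^⊥)`. -/
noncomputable def curry (A B X : C) : (A ⊗ B ⟶ X) ≃ (A ⟶ par X (dual B)) :=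
  ((bidualIso X).homToEquiv.trans (transposeEquiv (A ⊗ B) (dual X)).symm).trans
    (((α_ A B (dual X) ≪≫ whiskerLeftIso A (whiskerRightIso (bidualIso B) (dual X))).homFromEquiv).trans
      (transposeEquiv A (dual (dual B) ⊗ dual X)))

end StarAutonomous

open StarAutonomous

/-! ### Bracketings and equivariant families -/

/-- Bracketings: (possibly empty) ordered binary trees with leaves in `ι`; `empty` may also be
inserted inside a bracketing. -/
inductive Bracketing (ι : Type u) : Type u
  | empty : Bracketing ι
  | leaf : ι → Bracketing ι
  | node : Bracketing ι → Bracketing ι → Bracketing ι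

namespace Bracketing

/-- The leaves, from left to right. -/
def leaves {ι : Type u} : Bracketing ι → List ι
  | empty => []
  | leaf i => [i]
  | node s t => s.leaves ++ t.leaves

/-- Relabelling the leaves. -/
def map {ι : Type u} {κ : Type v} (φ : ι → κ) : Bracketing ι → Bracketing κ
  | empty => empty
  | leaf i => leaf (φ i)
  | node s t => node (s.map φ) (t.map φ)

end Bracketing

/-- Formal structural isomorphisms between bracketings, as they exist in every symmetric monoidal
category. -/
inductive Structural {ι : Type u} : Bracketing ι → Bracketing ι → Type u
  | refl (s : Bracketing ι) : Structural s s
  | symm {s t : Bracketing ι} : Structural s t → Structural t s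
  | trans {r s t : Bracketing ι} : Structural r s → Structural s t → Structural r t
  | tensor {s s' t t' : Bracketing ι} :
      Structural s s' → Structural t t' → Structural (.node s t) (.node s' t')
  | assoc (r s t : Bracketing ι) : Structural (.node (.node r s) t) (.node r (.node s t))
  | leftUnit (s : Bracketing ι) : Structural (.node .empty s) s
  | rightUnit (s : Bracketing ι) : Structural (.node s .empty) s
  | braid (s t : Bracketing ι) : Structural (.node s t) (.node t s)

section Families

variable {C : Type u} [Category.{v} C] [MonoidalCategory C] {ι : Type w}

/-- `⨂_s { Y i }`; it is `1` for the empty bracketing. -/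
def tensObj (Y : ι → C) : Bracketing ι → C
  | .empty => 𝟙_ C
  | .leaf i => Y i
  | .node s t => tensObj Y s ⊗ tensObj Y t

variable [SymmetricCategory C]

/-- The isomorphism of `C` that a formal structural isomorphism denotes. -/
def Structural.eval (Y : ι → C) : {s t : Bracketing ι} → Structural s t → (tensObj Y s ≅ tensObj Y t)
  | _, _, .refl s => Iso.refl (tensObj Y s)
  | _, _, .symm c => (c.eval Y).symm
  | _, _, .trans c d => c.eval Y ≪≫ d.eval Y
  | _, _, .tensor c d => MonoidalCategory.tensorIso (c.eval Y) (d.eval Y)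
  | _, _, .assoc r s t => α_ (tensObj Y r) (tensObj Y s) (tensObj Y t)
  | _, _, .leftUnit s => λ_ (tensObj Y s)
  | _, _, .rightUnit s => ρ_ (tensObj Y s)
  | _, _, .braid s t => β_ (tensObj Y s) (tensObj Y t)

variable [StarAutonomous C]

/-- `⅋_t { X i }`; it is `⊥` for the empty bracketing. -/
def parObj (X : ι → C) : Bracketing ι → C
  | .empty => bot C
  | .leaf i => X i
  | .node s t => par (parObj X s) (parObj X t)

/-- `⨂_s { (X i)^⊥ }`. -/
abbrev srcObj (X : ι → C) (s : Bracketing ι) : C := tensObj (fun i => dual (X i)) s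

/-- The De Morgan isomorphism `⨂_t { (X i)^⊥ } ⟶ (⅋_t { X i })^⊥`. -/
def deMorgan (X : ι → C) : (t : Bracketing ι) → (srcObj X t ⟶ dual (parObj X t))
  | .empty => bidual (𝟙_ C)
  | .leaf i => 𝟙 (dual (X i))
  | .node s t =>
      (deMorgan X s ⊗ₘ deMorgan X t) ≫
        (β_ (dual (parObj X s)) (dual (parObj X t))).hom ≫
          bidual (dual (parObj X t) ⊗ dual (parObj X s))

/-- The complete de-curryfication `(⨂_s { (X i)^⊥ }) ⊗ (⨂_t { (X i)^⊥ }) ⟶ ⊥` of an arrow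
`⨂_s { (X i)^⊥ } ⟶ ⅋_t { X i }`. -/
def decurry (X : ι → C) {s t : Bracketing ι} (f : srcObj X s ⟶ parObj X t) :
    srcObj X (.node s t) ⟶ bot C :=
  (f ⊗ₘ deMorgan X t) ≫ coname (parObj X t)

/-- Two arrows `⨂_s { (X i)^⊥ } ⟶ ⅋_t { X i }` and `⨂_s' { (X i)^⊥ } ⟶ ⅋_t' { X i }` are
transposes of each other: after complete de-curryfication they differ by the structural
isomorphism between the two bracketings. -/
def Transposes (X : ι → C) {s t s' t' : Bracketing ι}
    (f : srcObj X s ⟶ parObj X t) (f' : srcObj X s' ⟶ parObj X t') : Prop :=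
  ∃ c : Structural (.node s' t') (.node s t),
    decurry X f' = (c.eval (fun i => dual (X i))).hom ≫ decurry X f

/-- `s` and `t` are bracketings of a subset of `Γ` and of its complement (the entries of `Γ` are
pairwise distinct in all uses). -/
def Complementary (Γ : List ι) (s t : Bracketing ι) : Prop :=
  (s.leaves ++ t.leaves).Perm Γ

/-- An equivariant family: for all bracketings `s` and `t` of complementary subsets of `Γ` an arrow
`⨂_s { (X i)^⊥ } ⟶ ⅋_t { X i }`, such that all these arrows are transposes of each other. -/
structure EquivariantFamily (X : ι → C) (Γ : List ι) where
  arrow : ∀ s t : Bracketing ι, Complementary Γ s t → (srcObj X s ⟶ parObj X t)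
  equivariant : ∀ (s t s' t' : Bracketing ι) (h : Complementary Γ s t)
    (h' : Complementary Γ s' t'), Transposes X (arrow s t h) (arrow s' t' h')

end Families

/-! ### Formulas, cuts and ordinary pre-proof nets -/

/-- Labels of leaves: atoms, negated atoms and the two units. -/
inductive Label (𝒜 : Type u) : Type u
  | pos : 𝒜 → Label 𝒜
  | neg : 𝒜 → Label 𝒜
  | one : Label 𝒜
  | bot : Label 𝒜

/-- Duality of labels. -/
def Label.dual {𝒜 : Type u} : Label 𝒜 → Label 𝒜
  | .pos a => .neg a
  | .neg a => .pos a
  | .one => .bot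
  | .bot => .one

/-- Formulas of multiplicative linear logic whose leaves carry indices, which serve to distinguish
different occurrences of the same atom or unit. -/
inductive Formula (𝒜 : Type u) : Type u
  | leaf : Label 𝒜 → ℕ → Formula 𝒜
  | tens : Formula 𝒜 → Formula 𝒜 → Formula 𝒜
  | par : Formula 𝒜 → Formula 𝒜 → Formula 𝒜

namespace Formula

variable {𝒜 : Type u}

/-- The leaves with their indices. -/
def leaves : Formula 𝒜 → List (Label 𝒜 × ℕ)
  | leaf l i => [(l, i)]
  | tens A B => A.leaves ++ B.leaves
  | par A B => A.leaves ++ B.leaves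

/-- The subformulas, i.e. the nodes of the formula tree. -/
def nodes : Formula 𝒜 → List (Formula 𝒜)
  | leaf l i => [leaf l i]
  | tens A B => tens A B :: (A.nodes ++ B.nodes)
  | par A B => par A B :: (A.nodes ++ B.nodes)

end Formula

/-- `DualPair A A'`: up to the indices of the leaves, `A'` is the formula `A^⊥`, where
`(A ⊗ B)^⊥ = B^⊥ ⅋ A^⊥` and `(A ⅋ B)^⊥ = B^⊥ ⊗ A^⊥`. -/
inductive DualPair {𝒜 : Type u} : Formula 𝒜 → Formula 𝒜 → Type u
  | leaf (l : Label 𝒜) (i j : ℕ) : DualPair (.leaf l i) (.leaf l.dual j)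
  | tensPar {A A' B B' : Formula 𝒜} :
      DualPair A A' → DualPair B B' → DualPair (.tens A B) (.par B' A')
  | parTens {A A' B B' : Formula 𝒜} :
      DualPair A A' → DualPair B B' → DualPair (.par A B) (.tens B' A')

/-- A cut between a formula and its dual. -/
structure Cut (𝒜 : Type u) where
  left : Formula 𝒜
  right : Formula 𝒜
  isDual : DualPair left right

/-- The tensor formula that replaces a cut. -/
def Cut.toTens {𝒜 : Type u} (c : Cut 𝒜) : Formula 𝒜 := .tens c.left c.right

/-- The indexed leaves of a sequent. -/
def seqLeaves {𝒜 : Type u} (Γ : List (Formula 𝒜)) : List (Label 𝒜 × ℕ) :=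
  Γ.flatMap Formula.leaves

/-- The data of an ordinary pre-proof net with cuts.  `link` sends the index of a leaf to the index
of the leaf with which it is matched; its values at other numbers are irrelevant. -/
structure PreNet (𝒜 : Type u) where
  /-- the conclusions that are not cuts -/
  concl : List (Formula 𝒜)
  /-- the cuts -/
  cuts : List (Cut 𝒜)
  /-- the axiom linking -/
  link : ℕ → ℕ
  /-- different leaves have different indices -/
  nodup : ((seqLeaves (concl ++ cuts.map Cut.toTens)).map Prod.snd).Nodup
  /-- leaves are matched with leaves that carry the dual label -/
  link_mem : ∀ l i, (l, i) ∈ seqLeaves (concl ++ cuts.map Cut.toTens) →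
    (l.dual, link i) ∈ seqLeaves (concl ++ cuts.map Cut.toTens)
  /-- the matching is symmetric -/
  link_link : ∀ l i, (l, i) ∈ seqLeaves (concl ++ cuts.map Cut.toTens) → link (link i) = i

namespace PreNet

variable {𝒜 : Type u}

/-- All conclusions, with every cut replaced by a tensor. -/
def sequent (π : PreNet 𝒜) : List (Formula 𝒜) := π.concl ++ π.cuts.map Cut.toTens

/-- The nodes of the net: all subformula occurrences.  As the leaves have different indices,
different occurrences are different as indexed formulas.  A cut node is represented by the
corresponding tensor, since it has the same geometric behaviour. -/
def Node (π : PreNet 𝒜) : Type u := {F : Formula 𝒜 // ∃ A ∈ π.sequent, F ∈ A.nodes}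

/-- The edges of a switching: both edges below a tensor (or a cut) node, one of the two edges
at every par node, as `switch` says, and the axiom links. -/
inductive Edge (link : ℕ → ℕ) (switch : Formula 𝒜 → Bool) : Formula 𝒜 → Formula 𝒜 → Prop
  | tensLeft (A B : Formula 𝒜) : Edge link switch (.tens A B) A
  | tensRight (A B : Formula 𝒜) : Edge link switch (.tens A B) B
  | parLeft (A B : Formula 𝒜) : switch (.par A B) = true → Edge link switch (.par A B) A
  | parRight (A B : Formula 𝒜) : switch (.par A B) = false → Edge link switch (.par A B) B
  | linked (l l' : Label 𝒜) (i : ℕ) : Edge link switch (.leaf l i) (.leaf l' (link i))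

/-- The graph of a switching. -/
def switching (π : PreNet 𝒜) (switch : Formula 𝒜 → Bool) : SimpleGraph π.Node :=
  SimpleGraph.fromRel fun F F' => Edge π.link switch F.1 F'.1

/-- A net is correct if all its switchings are connected and acyclic.  A correct ordinary pre-proof
net is an ordinary proof net. -/
def Correct (π : PreNet 𝒜) : Prop := ∀ switch : Formula 𝒜 → Bool, (π.switching switch).IsTree

/-- One step of cut elimination. -/
inductive Step : PreNet 𝒜 → PreNet 𝒜 → Prop
  /-- `(A ⊗ B) ⊚ (B^⊥ ⅋ A^⊥)` is replaced by `A ⊚ A^⊥` and `B ⊚ B^⊥`. -/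
  | tensPar {π π' : PreNet 𝒜} {A A' B B' : Formula 𝒜} (dA : DualPair A A') (dB : DualPair B B')
      (Φ Ψ : List (Cut 𝒜)) :
      π.cuts = Φ ++ ⟨.tens A B, .par B' A', .tensPar dA dB⟩ :: Ψ →
      π'.cuts = Φ ++ ⟨A, A', dA⟩ :: ⟨B, B', dB⟩ :: Ψ →
      π'.concl = π.concl →
      (∀ l i, (l, i) ∈ seqLeaves π'.sequent → π'.link i = π.link i) →
      Step π π'
  /-- `(A ⅋ B) ⊚ (B^⊥ ⊗ A^⊥)` is replaced by `A ⊚ A^⊥` and `B ⊚ B^⊥`. -/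
  | parTens {π π' : PreNet 𝒜} {A A' B B' : Formula 𝒜} (dA : DualPair A A') (dB : DualPair B B')
      (Φ Ψ : List (Cut 𝒜)) :
      π.cuts = Φ ++ ⟨.par A B, .tens B' A', .parTens dA dB⟩ :: Ψ →
      π'.cuts = Φ ++ ⟨A, A', dA⟩ :: ⟨B, B', dB⟩ :: Ψ →
      π'.concl = π.concl →
      (∀ l i, (l, i) ∈ seqLeaves π'.sequent → π'.link i = π.link i) →
      Step π π'
  /-- A cut between the leaves `i` and `j` is removed, and the two different axiom links attached to
  them are melted into a single one. -/
  | atomic {π π' : PreNet 𝒜} (l : Label 𝒜) (i j : ℕ) (Φ Ψ : List (Cut 𝒜)) :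
      π.cuts = Φ ++ ⟨.leaf l i, .leaf l.dual j, .leaf l i j⟩ :: Ψ →
      π.link i ≠ j →
      π'.cuts = Φ ++ Ψ →
      π'.concl = π.concl →
      π'.link (π.link i) = π.link j →
      π'.link (π.link j) = π.link i →
      (∀ m k, (m, k) ∈ seqLeaves π'.sequent → k ≠ π.link i → k ≠ π.link j →
        π'.link k = π.link k) →
      Step π π'

end PreNet

/-! ### The interpretation -/

section Interpretation

variable {𝒜 : Type w} {C : Type u} [Category.{v} C] [MonoidalCategory C] [SymmetricCategory C]
  [StarAutonomous C] (G₀ : 𝒜 → C)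

/-- The object that interprets a label. -/
def labelObj : Label 𝒜 → C
  | .pos a => G₀ a
  | .neg a => dual (G₀ a)
  | .one => 𝟙_ C
  | .bot => bot C

/-- The object `G(A)` that interprets a formula. -/
def obj : Formula 𝒜 → C
  | .leaf l _ => labelObj G₀ l
  | .tens A B => obj A ⊗ obj B
  | .par A B => par (obj A) (obj B)

/-- The canonical isomorphism `G(l^⊥) ⟶ G(l)^⊥` for labels. -/
def labelDual : (l : Label 𝒜) → (labelObj G₀ l.dual ⟶ dual (labelObj G₀ l))
  | .pos a => 𝟙 (dual (G₀ a))
  | .neg a => bidual (G₀ a)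
  | .one => 𝟙 (bot C)
  | .bot => bidual (𝟙_ C)

/-- The canonical isomorphism `G(A^⊥) ⟶ G(A)^⊥`, composed of the maps `X ⟶ X^⊥⊥` and their duals;
it is an identity if the category is strict. -/
def dualComparison : {A A' : Formula 𝒜} → DualPair A A' → (obj G₀ A' ⟶ dual (obj G₀ A))
  | _, _, .leaf l _ _ => labelDual G₀ l
  | _, _, .tensPar (A := A) (B := B) dA dB =>
      parMap (dualComparison dB) (dualComparison dA) ≫
        dualMap (bidual (obj G₀ A) ⊗ₘ bidual (obj G₀ B))
  | _, _, .parTens (A := A) (B := B) dA dB =>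
      (dualComparison dB ⊗ₘ dualComparison dA) ≫ bidual (dual (obj G₀ B) ⊗ dual (obj G₀ A))

/-- The co-name of the identity, `G(B) ⊗ G(B^⊥) ⟶ ⊥`, for a cut `B ⊚ B^⊥`. -/
def cutMap (c : Cut 𝒜) : obj G₀ c.toTens ⟶ bot C :=
  obj G₀ c.left ◁ dualComparison G₀ c.isDual ≫ coname (obj G₀ c.left)

/-- The arrow `ζ : ⅋ { G(B) ⊗ G(B^⊥) } ⟶ ⅋ { ⊥ } ≅ ⊥`, for a bracketing of the cuts. -/
def zeta : (t : Bracketing (Cut 𝒜)) → (parObj (obj G₀) (t.map Cut.toTens) ⟶ bot C)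
  | .empty => 𝟙 (bot C)
  | .leaf c => cutMap G₀ c
  | .node s t => parMap (zeta s) (zeta t) ≫ parBot

/-- `CutFreeRep G₀ link Γ s t f`: the arrow `f : ⨂_s { G(A)^⊥ } ⟶ ⅋_t { G(A) }` is a representative
of an equivariant family constructed from the cut-free net with conclusions `Γ` and axiom linking
`link`, by removing par roots and splitting tensor roots in some order. -/
inductive CutFreeRep (link : ℕ → ℕ) : (Γ : List (Formula 𝒜)) → (s t : Bracketing (Formula 𝒜)) →
    (srcObj (obj G₀) s ⟶ parObj (obj G₀) t) → Prop
  /-- A single axiom link between an atom and its negation is interpreted by the identity. -/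
  | atom (a : 𝒜) (i j : ℕ) : link i = j →
      CutFreeRep link [.leaf (.pos a) i, .leaf (.neg a) j]
        (.leaf (.leaf (.pos a) i)) (.leaf (.leaf (.neg a) j)) (𝟙 (dual (G₀ a)))
  /-- A single axiom link between the two units is interpreted by the identity. -/
  | unit (i j : ℕ) : link i = j →
      CutFreeRep link [.leaf .one i, .leaf .bot j]
        (.leaf (.leaf .one i)) (.leaf (.leaf .bot j)) (𝟙 (dual (𝟙_ C)))
  | par (A B : Formula 𝒜) (Γ : List (Formula 𝒜)) (s : Bracketing (Formula 𝒜))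
      (f : srcObj (obj G₀) s ⟶ par (obj G₀ A) (obj G₀ B)) :
      CutFreeRep link (A :: B :: Γ) s (.node (.leaf A) (.leaf B)) f →
      CutFreeRep link (.par A B :: Γ) s (.leaf (.par A B)) f
  | tens (A B : Formula 𝒜) (Γ Δ : List (Formula 𝒜)) (s t : Bracketing (Formula 𝒜))
      (f : srcObj (obj G₀) s ⟶ obj G₀ A) (g : srcObj (obj G₀) t ⟶ obj G₀ B) :
      CutFreeRep link (A :: Γ) s (.leaf A) f →
      CutFreeRep link (B :: Δ) t (.leaf B) g →
      CutFreeRep link (.tens A B :: (Γ ++ Δ)) (.node s t) (.leaf (.tens A B)) (f ⊗ₘ g)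
  /-- The order of the conclusions does not matter. -/
  | exchange {Γ Γ' : List (Formula 𝒜)} {s t : Bracketing (Formula 𝒜)}
      (f : srcObj (obj G₀) s ⟶ parObj (obj G₀) t) : Γ.Perm Γ' →
      CutFreeRep link Γ s t f → CutFreeRep link Γ' s t f
  /-- All transposes of a representative are representatives. -/
  | transpose {Γ : List (Formula 𝒜)} {s t s' t' : Bracketing (Formula 𝒜)}
      (f : srcObj (obj G₀) s ⟶ parObj (obj G₀) t) (f' : srcObj (obj G₀) s' ⟶ parObj (obj G₀) t') :
      Transposes (obj G₀) f f' →
      CutFreeRep link Γ s t f → CutFreeRep link Γ s' t' f'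

/-- `GFlat G₀ π s t f`: the arrow `f : ⨂_s { G(A)^⊥ } ⟶ ⅋_t { G(A) }` is a representative of the
interpretation `G♭(π)` of the net `π`.  It is a transpose of `ζ ∘ f₀`, where
`f₀ : ⨂ { G(A_i)^⊥ } ⟶ ⅋ { G(B_j) ⊗ G(B_j^⊥) }` is a representative for the cut-free net in which
each cut `B_j ⊚ B_j^⊥` is replaced by `B_j ⊗ B_j^⊥`. -/
def GFlat (π : PreNet 𝒜) (s t : Bracketing (Formula 𝒜))
    (f : srcObj (obj G₀) s ⟶ parObj (obj G₀) t) : Prop :=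
  ∃ (r : Bracketing (Formula 𝒜)) (q : Bracketing (Cut 𝒜))
    (f₀ : srcObj (obj G₀) r ⟶ parObj (obj G₀) (q.map Cut.toTens)),
    r.leaves.Perm π.concl ∧ q.leaves.Perm π.cuts ∧
    CutFreeRep G₀ π.link π.sequent r (q.map Cut.toTens) f₀ ∧
    Transposes (obj G₀) (s := r) (t := .empty) (f₀ ≫ zeta G₀ q) f

/-- `G♭(π)` is the equivariant family `F`: the representatives of `G♭(π)` are exactly the members
of `F`. -/
def Determines {Γ : List (Formula 𝒜)} (π : PreNet 𝒜) (F : EquivariantFamily (obj G₀) Γ) : Prop :=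
  ∀ (s t : Bracketing (Formula 𝒜)) (h : Complementary Γ s t)
    (f : srcObj (obj G₀) s ⟶ parObj (obj G₀) t), GFlat G₀ π s t f ↔ f = F.arrow s t h

end Interpretation

end OrdinaryNets

/-! An arrow from a tensor of duals to a par is completely de-curried to a form, that is, an arrow
from the tensor of the `G(A)^⊥` over all conclusions to `⊥`. Forms are identified when a structural
isomorphism relates them. The leaves of a net have distinct indices, so no formula is repeated among
its conclusions, and by coherence (`Structural.eval_hom_eq`) a class of forms contains exactly one
form on each bracketing of the conclusions. An equivariant family is thus given by a single class of
forms.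

The rules that build representatives become substitutions into one block of arguments of a form
(`Plug`). The par rule substitutes a De Morgan isomorphism. The tensor rule, with one premise kept
fixed, substitutes an arrow into the other premise (`absorbRight`, `absorbLeft`). Substitutions into
different arguments commute, so whatever is done to a formula can be done where that formula is
introduced and then carried through the later rules (`Der.focus`, `Extends.subst`). Three results
rest on this.

Uniqueness (`Der.unique`): a derivable form is determined by its conclusions and axiom links. Par
rules are invertible. A tensor rule splits its context in the only way possible, because each
premise is connected by its axiom links.

Invariance (`Val.step`): a cut on `B` is closed by substituting an element of `(B ⊗ B^⊥)^⊥`. For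
compound cuts, the two new elements compose with `splitPair` to the old one, and substituting
`splitPair` turns one tensor and one par rule into two tensor rules (`Der.split`). For leaves,
cutting against an axiom link is composition with an identity (`name_linkArr`).

Existence (`Sound.provable`): a correct net has a derivation. After contraction of the axiom links,
the switchings become the choices of a hypergraph that has fewer hyperedges than vertices and cannot
be disconnected. Such a hypergraph has a splitting vertex, which is an axiom link, a root par or a
splitting root tensor.

`gFlat_iff` identifies the representatives of a net with its value in terms of forms. Correctness is
needed for `π` alone: `π'` inherits its value through the steps, and values are unique for every
pre-proof net. -/

namespace OrdinaryNets

open StarAutonomous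

/-! ### Coherence for symmetric monoidal categories -/

attribute [simp] Bracketing.leaves

section Coherence

set_option linter.unusedSectionVars false

variable {C : Type u} [Category.{v} C] [MonoidalCategory C] [SymmetricCategory C] {ι : Type w}

/-- A pointwise decomposition `Y i ≅ P i ⊗ Q i` decomposes all tensor products. -/
def splitIso {Y P Q : ι → C} (δ : ∀ i, Y i ≅ P i ⊗ Q i) :
    (s : Bracketing ι) → (tensObj Y s ≅ tensObj P s ⊗ tensObj Q s)
  | .empty => (λ_ (𝟙_ C)).symm
  | .leaf i => δ i
  | .node s t => MonoidalCategory.tensorIso (splitIso δ s) (splitIso δ t) ≪≫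
      ⟨tensorμ _ _ _ _, tensorδ _ _ _ _, tensorμ_tensorδ _ _ _ _, tensorδ_tensorμ _ _ _ _⟩

/-- Symmetry is essential here: the interchange undoes the crossing of `X₁` and `Y₂` that the
braiding has made. This is the braiding case of `eval_splitIso`. -/
theorem braiding_tensorμ (X₁ X₂ Y₁ Y₂ : C) :
    (β_ (X₁ ⊗ X₂) (Y₁ ⊗ Y₂)).hom ≫ tensorμ Y₁ Y₂ X₁ X₂ =
      tensorμ X₁ X₂ Y₁ Y₂ ≫ ((β_ X₁ Y₁).hom ⊗ₘ (β_ X₂ Y₂).hom) := by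
  simp [tensorμ, SymmetricCategory.braiding_swap_eq_inv_braiding Y₂ X₁,
    MonoidalCategory.tensorHom_def]

/-- It suffices to check the generators, where the claim is the coherence of the interchange
`tensorμ` with associators, unitors and braidings. The lemma reduces coherence for `Y` to coherence
for `P` and `Q`. -/
theorem eval_splitIso {Y P Q : ι → C} (δ : ∀ i, Y i ≅ P i ⊗ Q i) {s t : Bracketing ι}
    (c : Structural s t) :
    (c.eval Y).hom ≫ (splitIso δ t).hom =
      (splitIso δ s).hom ≫ ((c.eval P).hom ⊗ₘ (c.eval Q).hom) := by
  induction c with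
  | refl s => simp [Structural.eval]
  | symm c ih =>
    simp only [Structural.eval, Iso.symm_hom]
    rw [Iso.inv_comp_eq, ← Category.assoc, ih]
    simp
  | trans c d ihc ihd =>
    simp only [Structural.eval, Iso.trans_hom, Category.assoc]
    rw [ihd, reassoc_of% ihc, tensorHom_comp_tensorHom]
  | tensor c d ihc ihd =>
    simp only [Structural.eval, splitIso, Iso.trans_hom, tensorIso_hom, tensObj]
    rw [tensorHom_comp_tensorHom_assoc, ihc, ihd, Category.assoc, ← tensorμ_natural,
      tensorHom_comp_tensorHom_assoc]
  | assoc r s t =>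
    simp only [Structural.eval, splitIso, Iso.trans_hom, tensorIso_hom, tensObj]
    rw [MonoidalCategory.tensorHom_def, MonoidalCategory.tensorHom_def (_ ≫ _)]
    simp only [Category.assoc, comp_whiskerRight, MonoidalCategory.whiskerLeft_comp]
    have h := tensor_associativity (tensObj P r) (tensObj Q r) (tensObj P s) (tensObj Q s)
      (tensObj P t) (tensObj Q t)
    rw [← whisker_exchange_assoc (tensorμ _ _ _ _) (splitIso δ t).hom, h, MonoidalCategory.tensorHom_def (splitIso δ r).hom,
      MonoidalCategory.tensorHom_def (splitIso δ s).hom]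
    simp
  | leftUnit s =>
    simp only [Structural.eval, splitIso, Iso.trans_hom, tensorIso_hom, tensObj, Iso.symm_hom]
    rw [tensorHom_def', Category.assoc, Category.assoc, ← tensor_left_unitality]
    simp
  | rightUnit s =>
    simp only [Structural.eval, splitIso, Iso.trans_hom, tensorIso_hom, tensObj, Iso.symm_hom]
    rw [MonoidalCategory.tensorHom_def, Category.assoc, Category.assoc, ← tensor_right_unitality]
    simp
  | braid s t =>
    simp only [Structural.eval, splitIso, Iso.trans_hom, tensorIso_hom, tensObj]
    rw [← BraidedCategory.braiding_naturality_assoc, Category.assoc, braiding_tensorμ]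

/-- `X` or the unit. -/
def unitOr (X : C) : Bool → C
  | true => X
  | false => 𝟙_ C

/-- The canonical map to `X` (or to the unit) from a tensor product in which at most one factor,
a copy of `X`, is not a unit. -/
inductive CanMap (X : C) (P : ι → C) (a : ι → Prop) (x : ∀ j, a j → (P j ≅ X))
    (g : ι → Prop) (e : ∀ j, g j ∧ ¬ a j → (P j ≅ 𝟙_ C)) :
    (b : Bool) → (s : Bracketing ι) → (tensObj P s ⟶ unitOr X b) → Prop
  | empty : CanMap X P a x g e false .empty (𝟙 (𝟙_ C))
  | leaf (j : ι) (h : a j) : CanMap X P a x g e true (.leaf j) (x j h).hom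
  | unit (j : ι) (h : g j ∧ ¬ a j) : CanMap X P a x g e false (.leaf j) (e j h).hom
  | left (b : Bool) {s t : Bracketing ι} (f : tensObj P s ⟶ unitOr X b) (f' : tensObj P t ⟶ 𝟙_ C) :
      CanMap X P a x g e b s f → CanMap X P a x g e false t f' →
      CanMap X P a x g e b (.node s t) ((f ⊗ₘ f') ≫ (ρ_ (unitOr X b)).hom)
  | right (b : Bool) {s t : Bracketing ι} (f : tensObj P s ⟶ 𝟙_ C) (f' : tensObj P t ⟶ unitOr X b) :
      CanMap X P a x g e false s f → CanMap X P a x g e b t f' →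
      CanMap X P a x g e b (.node s t) ((f ⊗ₘ f') ≫ (λ_ (unitOr X b)).hom)

namespace CanMap

variable {X : C} {P : ι → C} {a : ι → Prop} {x : ∀ j, a j → (P j ≅ X)}
  {g : ι → Prop} {e : ∀ j, g j ∧ ¬ a j → (P j ≅ 𝟙_ C)}

theorem cast {b : Bool} {s : Bracketing ι} {f f' : tensObj P s ⟶ unitOr X b}
    (h : CanMap X P a x g e b s f) (hfg : f = f') : CanMap X P a x g e b s f' := hfg ▸ h

theorem bool_unique {b : Bool} {s : Bracketing ι} {f : tensObj P s ⟶ unitOr X b}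
    (h : CanMap X P a x g e b s f) : (b = true ↔ ∃ j ∈ s.leaves, a j) := by
  induction h with
  | empty => simp [Bracketing.leaves]
  | leaf j h => simpa [Bracketing.leaves] using h
  | unit j h => simpa [Bracketing.leaves] using h.2
  | left b f g _ _ ihf ihg => 
    simp only [Bracketing.leaves, List.mem_append, or_and_right, exists_or, ← ihf, ← ihg]; simp
  | right b f g _ _ ihf ihg => 
    simp only [Bracketing.leaves, List.mem_append, or_and_right, exists_or, ← ihf, ← ihg]; simp

theorem unique (s : Bracketing ι) : ∀ {b : Bool} {f f' : tensObj P s ⟶ unitOr X b}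
    (_ : CanMap X P a x g e b s f) (_ : CanMap X P a x g e b s f'), f = f' := by
  induction s with
  | empty => rintro b f g ⟨⟩ ⟨⟩; rfl
  | leaf j =>
    intro b f g hf hg
    cases hf with
    | leaf _ h => cases hg with
      | leaf => rfl
    | unit _ h => cases hg with
      | unit => rfl
  | node s t ihs iht =>
    intro b f g hf hg
    cases hf with
    | left _ f1 f2 h1 h2 => cases hg with
      | left _ g1 g2 k1 k2 => rw [ihs h1 k1, iht (b := false) h2 k2]
      | right _ g1 g2 k1 k2 =>
        -- The node is read both by `left` and by `right`. Then neither side contains the marked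
        -- leaf, the target is the unit, and the two unitors agree.
        have hb : b = false := by
          have e1 := h1.bool_unique
          have e2 := k1.bool_unique
          rw [← e1] at e2
          simpa using e2
        subst hb
        rw [ihs h1 k1, iht h2 k2]
        simp [unitors_equal, unitOr]
    | right _ f1 f2 h1 h2 => cases hg with
      | right _ g1 g2 k1 k2 => rw [ihs (b := false) h1 k1, iht h2 k2]
      | left _ g1 g2 k1 k2 =>
        have hb : b = false := by
          have e1 := h1.bool_unique
          have e2 := k1.bool_unique
          rw [← e1] at e2
          simpa using e2
        subst hb
        rw [ihs h1 k1, iht h2 k2]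
        simp [unitors_equal, unitOr]

theorem isIso {b : Bool} {s : Bracketing ι} {f : tensObj P s ⟶ unitOr X b}
    (h : CanMap X P a x g e b s f) : IsIso f := by
  induction h with
  | empty => exact IsIso.id (𝟙_ C)
  | leaf j h => exact (x j h).isIso_hom
  | unit j h => exact (e j h).isIso_hom
  | left b f g _ _ ihf ihg => 
    have : IsIso g := ihg
    exact IsIso.comp_isIso' (tensor_isIso f g) inferInstance
  | right b f g _ _ ihf ihg => 
    have : IsIso f := ihf
    exact IsIso.comp_isIso' (tensor_isIso f g) inferInstance

theorem exists_false (s : Bracketing ι) (hs : ∀ j ∈ s.leaves, g j ∧ ¬ a j) :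
    ∃ f, CanMap X P a x g e false s f := by
  induction s with
  | empty => exact ⟨_, .empty⟩
  | leaf j => exact ⟨_, .unit j (hs j (by simp [Bracketing.leaves]))⟩
  | node s t ihs iht =>
    simp only [Bracketing.leaves, List.mem_append] at hs
    obtain ⟨f, hf⟩ := ihs fun j hj => hs j (Or.inl hj)
    obtain ⟨g, hg⟩ := iht fun j hj => hs j (Or.inr hj)
    exact ⟨_, .left _ f g hf hg⟩

theorem exists_of_nodup (s : Bracketing ι) (hs : s.leaves.Nodup)
    (hg : ∀ j ∈ s.leaves, g j) (ha : ∀ j k, a j → a k → j = k) :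
    ∃ b f, CanMap X P a x g e b s f := by
  induction s with
  | empty => exact ⟨_, _, .empty⟩
  | leaf j =>
    by_cases h : a j
    · exact ⟨_, _, .leaf j h⟩
    · exact ⟨_, _, .unit j ⟨hg j (by simp [Bracketing.leaves]), h⟩⟩
  | node s t ihs iht =>
    simp only [Bracketing.leaves, List.nodup_append] at hs
    simp only [Bracketing.leaves, List.mem_append] at hg
    by_cases h : ∃ j ∈ s.leaves, a j
    · obtain ⟨j, hj, haj⟩ := h
      obtain ⟨b, f, hf⟩ := ihs hs.1 fun j hj => hg j (Or.inl hj)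
      obtain ⟨g, hg⟩ := exists_false (X := X) (P := P) (x := x) (e := e) t fun k hk =>
        ⟨hg k (Or.inr hk), fun hak => hs.2.2 j hj k hk (ha j k haj hak)⟩
      exact ⟨_, _, .left _ f g hf hg⟩
    · push Not at h
      obtain ⟨f, hf⟩ := exists_false (X := X) (P := P) (x := x) (e := e) s
        fun j hj => ⟨hg j (Or.inl hj), h j hj⟩
      obtain ⟨b, g, hg⟩ := iht hs.2.1 fun j hj => hg j (Or.inr hj)
      exact ⟨_, _, .right _ f g hf hg⟩

section

variable {R S T Z : C}

theorem assoc_left (f : R ⟶ Z) (g : S ⟶ 𝟙_ C) (h : T ⟶ 𝟙_ C) :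
    ((f ⊗ₘ g) ≫ (ρ_ Z).hom ⊗ₘ h) ≫ (ρ_ Z).hom =
      (α_ R S T).hom ≫ (f ⊗ₘ (g ⊗ₘ h) ≫ (ρ_ (𝟙_ C)).hom) ≫ (ρ_ Z).hom := by
  monoidal

theorem assoc_middle (f : R ⟶ 𝟙_ C) (g : S ⟶ Z) (h : T ⟶ 𝟙_ C) :
    ((f ⊗ₘ g) ≫ (λ_ Z).hom ⊗ₘ h) ≫ (ρ_ Z).hom =
      (α_ R S T).hom ≫ (f ⊗ₘ (g ⊗ₘ h) ≫ (ρ_ Z).hom) ≫ (λ_ Z).hom := by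
  monoidal

theorem assoc_right (f : R ⟶ 𝟙_ C) (g : S ⟶ 𝟙_ C) (h : T ⟶ Z) :
    ((f ⊗ₘ g) ≫ (ρ_ (𝟙_ C)).hom ⊗ₘ h) ≫ (λ_ Z).hom =
      (α_ R S T).hom ≫ (f ⊗ₘ (g ⊗ₘ h) ≫ (λ_ Z).hom) ≫ (λ_ Z).hom := by
  monoidal

theorem assoc_right' (f : R ⟶ 𝟙_ C) (g : S ⟶ 𝟙_ C) (h : T ⟶ Z) :
    ((f ⊗ₘ g) ≫ (λ_ (𝟙_ C)).hom ⊗ₘ h) ≫ (λ_ Z).hom =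
      (α_ R S T).hom ≫ (f ⊗ₘ (g ⊗ₘ h) ≫ (λ_ Z).hom) ≫ (λ_ Z).hom := by
  monoidal

theorem assoc_left' (f : R ⟶ Z) (g : S ⟶ 𝟙_ C) (h : T ⟶ 𝟙_ C) :
    ((f ⊗ₘ g) ≫ (ρ_ Z).hom ⊗ₘ h) ≫ (ρ_ Z).hom =
      (α_ R S T).hom ≫ (f ⊗ₘ (g ⊗ₘ h) ≫ (λ_ (𝟙_ C)).hom) ≫ (ρ_ Z).hom := by
  monoidal

theorem unit_left (g : R ⟶ Z) :
    (𝟙 (𝟙_ C) ⊗ₘ g) ≫ (λ_ Z).hom = (λ_ R).hom ≫ g := by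
  simp

theorem unit_left' (g : R ⟶ 𝟙_ C) :
    (𝟙 (𝟙_ C) ⊗ₘ g) ≫ (ρ_ (𝟙_ C)).hom = (λ_ R).hom ≫ g := by
  rw [← unitors_equal, unit_left]

theorem unit_right (g : R ⟶ Z) :
    (g ⊗ₘ 𝟙 (𝟙_ C)) ≫ (ρ_ Z).hom = (ρ_ R).hom ≫ g := by
  simp

theorem unit_right' (g : R ⟶ 𝟙_ C) :
    (g ⊗ₘ 𝟙 (𝟙_ C)) ≫ (λ_ (𝟙_ C)).hom = (ρ_ R).hom ≫ g := by
  rw [unitors_equal, unit_right]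

theorem braid_left (f : R ⟶ Z) (g : S ⟶ 𝟙_ C) :
    (f ⊗ₘ g) ≫ (ρ_ Z).hom = (β_ R S).hom ≫ (g ⊗ₘ f) ≫ (λ_ Z).hom := by
  rw [← BraidedCategory.braiding_naturality_assoc]; simp

theorem braid_right (f : R ⟶ 𝟙_ C) (g : S ⟶ Z) :
    (f ⊗ₘ g) ≫ (λ_ Z).hom = (β_ R S).hom ≫ (g ⊗ₘ f) ≫ (ρ_ Z).hom := by
  rw [← BraidedCategory.braiding_naturality_assoc]; simp

end

/-- Each generator of the structural isomorphisms preserves canonical maps. Both directions are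
proved together because `symm` exchanges them. -/
theorem transport {s t : Bracketing ι} (c : Structural s t) :
    (∀ (b : Bool) (f : tensObj P s ⟶ unitOr X b), CanMap X P a x g e b s f →
      CanMap X P a x g e b t ((c.eval P).inv ≫ f)) ∧
    (∀ (b : Bool) (f : tensObj P t ⟶ unitOr X b), CanMap X P a x g e b t f →
      CanMap X P a x g e b s ((c.eval P).hom ≫ f)) := by
  induction c with
  | refl s =>
    exact ⟨fun b f h => h.cast (by simp [Structural.eval]),
      fun b f h => h.cast (by simp [Structural.eval])⟩
  | symm c ih => exact ⟨ih.2, ih.1⟩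
  | trans c d ihc ihd =>
    exact ⟨fun b f h => (ihd.1 _ _ (ihc.1 _ _ h)).cast (by simp [Structural.eval]),
      fun b f h => (ihc.2 _ _ (ihd.2 _ _ h)).cast (by simp [Structural.eval])⟩
  | tensor c d ihc ihd =>
    constructor
    · intro b f h
      cases h with
      | left _ f g h1 h2 =>
        exact (left _ _ _ (ihc.1 _ _ h1) (ihd.1 _ _ h2)).cast
          (tensorHom_comp_tensorHom_assoc _ _ _ _ _).symm
      | right _ f g h1 h2 =>
        exact (right _ _ _ (ihc.1 _ _ h1) (ihd.1 _ _ h2)).cast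
          (tensorHom_comp_tensorHom_assoc _ _ _ _ _).symm
    · intro b f h
      cases h with
      | left _ f g h1 h2 =>
        exact (left _ _ _ (ihc.2 _ _ h1) (ihd.2 _ _ h2)).cast
          (tensorHom_comp_tensorHom_assoc _ _ _ _ _).symm
      | right _ f g h1 h2 =>
        exact (right _ _ _ (ihc.2 _ _ h1) (ihd.2 _ _ h2)).cast
          (tensorHom_comp_tensorHom_assoc _ _ _ _ _).symm
  | assoc r s t =>
    constructor
    · intro b f h
      cases h with
      | left _ f g h1 h2 =>
        cases h1 with
        | left _ f1 f2 h1 h3 =>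
          exact (left _ _ _ h1 (left _ _ _ h3 h2)).cast ((Iso.eq_inv_comp _).2 (assoc_left ..).symm)
        | right _ f1 f2 h1 h3 =>
          exact (right _ _ _ h1 (left _ _ _ h3 h2)).cast
            ((Iso.eq_inv_comp _).2 (assoc_middle ..).symm)
      | right _ f g h1 h2 =>
        cases h1 with
        | left _ f1 f2 h1 h3 =>
          exact (right _ _ _ h1 (right _ _ _ h3 h2)).cast
            ((Iso.eq_inv_comp _).2 (assoc_right ..).symm)
        | right _ f1 f2 h1 h3 =>
          exact (right _ _ _ h1 (right _ _ _ h3 h2)).cast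
            ((Iso.eq_inv_comp _).2 (assoc_right' ..).symm)
    · intro b f h
      cases h with
      | left _ f g h1 h2 =>
        cases h2 with
        | left _ f1 f2 h2 h3 =>
          exact (left _ _ _ (left _ _ _ h1 h2) h3).cast (assoc_left ..)
        | right _ f1 f2 h2 h3 =>
          exact (left _ _ _ (left _ _ _ h1 h2) h3).cast (assoc_left' ..)
      | right _ f g h1 h2 =>
        cases h2 with
        | left _ f1 f2 h2 h3 =>
          exact (left _ _ _ (right _ _ _ h1 h2) h3).cast (assoc_middle ..)
        | right _ f1 f2 h2 h3 =>
          exact (right _ _ _ (left false _ _ h1 h2) h3).cast (assoc_right ..)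
  | leftUnit s =>
    constructor
    · intro b f h
      cases h with
      | left _ f g h1 h2 =>
        cases h1
        exact h2.cast ((Iso.eq_inv_comp _).2 (unit_left' _).symm)
      | right _ f g h1 h2 =>
        cases h1
        exact h2.cast ((Iso.eq_inv_comp _).2 (unit_left _).symm)
    · intro b f h
      exact (right _ _ _ .empty h).cast (unit_left _)
  | rightUnit s =>
    constructor
    · intro b f h
      cases h with
      | left _ f g h1 h2 =>
        cases h2
        exact h1.cast ((Iso.eq_inv_comp _).2 (unit_right _).symm)
      | right _ f g h1 h2 =>
        cases h2
        exact h1.cast ((Iso.eq_inv_comp _).2 (unit_right' _).symm)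
    · intro b f h
      exact (left _ _ _ h .empty).cast (unit_right _)
  | braid s t =>
    constructor
    · intro b f h
      cases h with
      | left _ f g h1 h2 =>
        exact (right _ _ _ h2 h1).cast ((Iso.eq_inv_comp _).2 (braid_left ..).symm)
      | right _ f g h1 h2 =>
        exact (left _ _ _ h2 h1).cast ((Iso.eq_inv_comp _).2 (braid_right ..).symm)
    · intro b f h
      cases h with
      | left _ f g h1 h2 => exact (right _ _ _ h2 h1).cast (braid_right ..)
      | right _ f g h1 h2 => exact (left _ _ _ h2 h1).cast (braid_left ..)

/-- A canonical map `f` out of `s` is carried by `c` and by `d` to canonical maps out of `t`, which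
agree by `unique`. As `f` is invertible, it cancels. -/
theorem eval_eq {s t : Bracketing ι} (hs : s.leaves.Nodup)
    (hg : ∀ j ∈ s.leaves, g j) (ha : ∀ j k, a j → a k → j = k)
    (x : ∀ j, a j → (P j ≅ X)) (e : ∀ j, g j ∧ ¬ a j → (P j ≅ 𝟙_ C)) (c d : Structural s t) :
    (c.eval P).hom = (d.eval P).hom := by
  obtain ⟨b, f, hf⟩ := exists_of_nodup (X := X) (P := P) (x := x) (e := e) s hs hg ha
  have h1 := (transport c).1 _ _ hf
  have h2 := (transport d).1 _ _ hf
  have h := unique _ h1 h2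
  have := hf.isIso
  rw [Iso.inv_comp_eq, ← Category.assoc, ← cancel_mono (inv f)] at h
  simp only [Category.assoc, IsIso.hom_inv_id, Category.comp_id] at h
  exact ((Iso.comp_inv_eq_id _).1 h.symm)

end CanMap

open Classical in
/-- Coherence under the assumption that the labels outside a list are interpreted by units. -/
theorem Structural.eval_hom_eq_of_support {s t : Bracketing ι} (hs : s.leaves.Nodup)
    (c d : Structural s t) (l : List ι) :
    ∀ (Y : ι → C), (∀ j ∈ s.leaves, j ∉ l → Nonempty (Y j ≅ 𝟙_ C)) → (c.eval Y).hom = (d.eval Y).hom := by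
  induction l with
  | nil =>
    intro Y hY
    exact CanMap.eval_eq (X := 𝟙_ C) (a := fun _ => False) hs (fun _ h => h) (by simp)
      (fun _ h => h.elim) (fun j h => (hY j h.1 (by simp)).some) c d
  | cons i l ih =>
    intro Y hY
    -- `P` keeps only the factor with index `i` and `Q` keeps the others. As `i` occurs at most
    -- once, `CanMap.eval_eq` covers `P`, and `Q` has the smaller support `l`.
    let P : ι → C := fun j => if j = i then Y j else 𝟙_ C
    let Q : ι → C := fun j => if j = i then 𝟙_ C else Y j
    have hδ : ∀ j, Nonempty (Y j ≅ P j ⊗ Q j) := by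
      intro j
      by_cases h : j = i
      · simp only [P, Q, if_pos h]; exact ⟨(ρ_ _).symm⟩
      · simp only [P, Q, if_neg h]; exact ⟨(λ_ _).symm⟩
    let δ := fun j => (hδ j).some
    have hP : (c.eval P).hom = (d.eval P).hom := by
      refine CanMap.eval_eq (X := Y i) (a := fun j => j = i) hs (fun _ h => h) (by rintro j k rfl rfl; rfl)
        (fun j h => ?_) (fun j h => ?_) c d
      · subst h; exact eqToIso (if_pos rfl)
      · exact eqToIso (if_neg h.2)
    have hQ : (c.eval Q).hom = (d.eval Q).hom := by
      refine ih Q fun j hs hj => ?_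
      by_cases h : j = i
      · exact ⟨eqToIso (if_pos h)⟩
      · simp only [Q, if_neg h]; exact hY j hs (by simp [h, hj])
    rw [← cancel_mono (splitIso δ t).hom, eval_splitIso, eval_splitIso, hP, hQ]

/-- Coherence: a formal structural isomorphism between bracketings without repetitions is
determined by its source and target. -/
theorem Structural.eval_hom_eq {s t : Bracketing ι} (hs : s.leaves.Nodup)
    (c d : Structural s t) (Y : ι → C) : (c.eval Y).hom = (d.eval Y).hom :=
  eval_hom_eq_of_support hs c d s.leaves Y fun _ h h' => (h' h).elim


/-- The right-nested bracketing of a list. -/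
def Bracketing.ofList : List ι → Bracketing ι
  | [] => .empty
  | i :: l => .node (.leaf i) (ofList l)

@[simp]
theorem Bracketing.leaves_ofList (l : List ι) : (Bracketing.ofList l).leaves = l := by
  induction l with
  | nil => rfl
  | cons i l ih => simp [ofList, leaves, ih]

theorem Structural.exists_append (l m : List ι) :
    Nonempty (Structural (.node (.ofList l) (.ofList m)) (.ofList (l ++ m))) := by
  induction l with
  | nil => exact ⟨.leftUnit _⟩
  | cons i l ih => exact ⟨(assoc _ _ _).trans (tensor (refl _) ih.some)⟩

theorem Structural.exists_ofList (s : Bracketing ι) :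
    Nonempty (Structural s (.ofList s.leaves)) := by
  induction s with
  | empty => exact ⟨.refl _⟩
  | leaf i => exact ⟨(rightUnit _).symm⟩
  | node s t ihs iht => exact ⟨(tensor ihs.some iht.some).trans (exists_append _ _).some⟩

theorem Structural.exists_of_perm_list {l m : List ι} (h : l.Perm m) :
    Nonempty (Structural (Bracketing.ofList l) (.ofList m)) := by
  induction h with
  | nil => exact ⟨.refl _⟩
  | cons i _ ih => exact ⟨tensor (refl _) ih.some⟩
  | swap i j l =>
    exact ⟨((assoc _ _ _).symm.trans (tensor (braid _ _) (refl _))).trans (assoc _ _ _)⟩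
  | trans _ _ ih ih' => exact ⟨ih.some.trans ih'.some⟩

/-- Bracketings of the same list of leaves, up to permutation, are structurally isomorphic. -/
theorem Structural.exists_of_perm {s t : Bracketing ι} (h : s.leaves.Perm t.leaves) :
    Nonempty (Structural s t) :=
  ⟨((exists_ofList s).some.trans (exists_of_perm_list h).some).trans (exists_ofList t).some.symm⟩

theorem Structural.perm {s t : Bracketing ι} (c : Structural s t) : s.leaves.Perm t.leaves := by
  induction c with
  | refl s => exact .refl _
  | symm _ ih => exact ih.symm
  | trans _ _ ih ih' => exact ih.trans ih'
  | tensor _ _ ih ih' => exact ih.append ih'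
  | assoc r s t => simp [Bracketing.leaves]
  | leftUnit s => simp [Bracketing.leaves]
  | rightUnit s => simp [Bracketing.leaves]
  | braid s t => exact List.perm_append_comm

end Coherence

/-! ### Transposition in *-autonomous categories -/

namespace StarAutonomous

variable {C : Type u} [Category.{v} C] [MonoidalCategory C] [SymmetricCategory C]
  [StarAutonomous C]

instance (A : C) : IsIso (bidual A) := isIso_bidual A

/-- Most identities between arrows into duals are checked below after evaluation. -/
theorem ev_injective {X A : C} {f g : X ⟶ dual A} (h : f ▷ A ≫ ev A = g ▷ A ≫ ev A) : f = g :=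
  (transposeEquiv X A).symm.injective h

theorem bidual_ev (A : C) : bidual A ▷ dual A ≫ ev (dual A) = coname A := transpose_ev _

/-- The form `A^⊥ ⊗ W ⟶ ⊥` that belongs to an arrow `W ⟶ A`. -/
def unhat {A W : C} (g : W ⟶ A) : dual A ⊗ W ⟶ bot C := dual A ◁ g ≫ ev A

theorem unhat_eq {A W : C} (g : W ⟶ A) : unhat g = (β_ (dual A) W).hom ≫ g ▷ dual A ≫ coname A := by
  rw [unhat, coname, BraidedCategory.braiding_naturality_left_assoc,
    SymmetricCategory.symmetry_assoc]

/-- The bijection between forms `A^⊥ ⊗ W ⟶ ⊥` and arrows `W ⟶ A`. -/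
noncomputable def hatEquiv (A W : C) : (dual A ⊗ W ⟶ bot C) ≃ (W ⟶ A) where
  toFun m := transpose ((β_ W (dual A)).hom ≫ m) ≫ inv (bidual A)
  invFun g := unhat g
  left_inv m := by
    dsimp only
    rw [unhat_eq, ← bidual_ev, ← comp_whiskerRight_assoc, Category.assoc, IsIso.inv_hom_id,
      Category.comp_id, transpose_ev, SymmetricCategory.symmetry_assoc]
  right_inv g := by
    dsimp only
    rw [unhat_eq, SymmetricCategory.symmetry_assoc, IsIso.comp_inv_eq, ← bidual_ev,
      ← comp_whiskerRight_assoc, transpose_uniq]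

/-- The arrow `W ⟶ A` that belongs to a form `A^⊥ ⊗ W ⟶ ⊥`. -/
noncomputable def hat {A W : C} (m : dual A ⊗ W ⟶ bot C) : W ⟶ A := hatEquiv A W m

@[simp]
theorem unhat_hat {A W : C} (m : dual A ⊗ W ⟶ bot C) : unhat (hat m) = m :=
  (hatEquiv A W).left_inv m

@[simp]
theorem hat_unhat {A W : C} (g : W ⟶ A) : hat (unhat g) = g :=
  (hatEquiv A W).right_inv g

theorem unhat_comp {A V W : C} (h : V ⟶ W) (g : W ⟶ A) :
    unhat (h ≫ g) = dual A ◁ h ≫ unhat g := by simp [unhat]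

/-- The De Morgan isomorphism `A^⊥ ⊗ B^⊥ ≅ (A ⅋ B)^⊥`. -/
noncomputable def parIso (A B : C) : dual A ⊗ dual B ≅ dual (par A B) :=
  β_ (dual A) (dual B) ≪≫ bidualIso (dual B ⊗ dual A)

/-- Absorbing an arrow `V ⟶ B` into `(A ⊗ B)^⊥` from the right. -/
def absorbRight (A : C) {B V : C} (k : V ⟶ B) : dual (A ⊗ B) ⊗ V ⟶ dual A :=
  transpose ((α_ _ _ _).hom ≫ dual (A ⊗ B) ◁ ((β_ V A).hom ≫ A ◁ k) ≫ ev (A ⊗ B))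

/-- Absorbing an arrow `W ⟶ A` into `(A ⊗ B)^⊥` from the left. -/
def absorbLeft (B : C) {A W : C} (h : W ⟶ A) : dual (A ⊗ B) ⊗ W ⟶ dual B :=
  transpose ((α_ _ _ _).hom ≫ dual (A ⊗ B) ◁ (h ▷ B) ≫ ev (A ⊗ B))

/-- This turns the tensor rule into a substitution: with the right premise `k` fixed, the form of `h
⊗ k` is the form of `h` with an arrow plugged in for `A^⊥`. -/
theorem absorbRight_unhat {A B S V : C} (h : S ⟶ A) (k : V ⟶ B) :
    absorbRight A k ▷ S ≫ unhat h =
      (α_ _ _ _).hom ≫ dual (A ⊗ B) ◁ (β_ V S).hom ≫ unhat (h ⊗ₘ k) := by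
  rw [unhat, ← whisker_exchange_assoc, absorbRight, transpose_ev, unhat,
    MonoidalCategory.tensorHom_def]
  have := BraidedCategory.braiding_naturality_right V h
  simp only [MonoidalCategory.whiskerLeft_comp, Category.assoc, associator_naturality_right_assoc]
  rw [← whiskerLeft_comp_assoc, this]
  simp

theorem absorbLeft_unhat {A B S V : C} (h : S ⟶ A) (k : V ⟶ B) :
    absorbLeft B h ▷ V ≫ unhat k = (α_ _ _ _).hom ≫ unhat (h ⊗ₘ k) := by
  rw [unhat, ← whisker_exchange_assoc, absorbLeft, transpose_ev, unhat,
    tensorHom_def']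
  simp

theorem absorbLeft_comp {A B S V : C} (j : S ⟶ V) (h : V ⟶ A) :
    absorbLeft B (j ≫ h) = dual (A ⊗ B) ◁ j ≫ absorbLeft B h := by
  apply ev_injective
  simp [absorbLeft, transpose_ev]

/-- The arrow `1 ⟶ A^⊥` that belongs to `A ⟶ ⊥`. -/
def name {A : C} (p : A ⟶ bot C) : 𝟙_ C ⟶ dual A := transpose ((λ_ A).hom ≫ p)

theorem name_ev {A : C} (p : A ⟶ bot C) : name p ▷ A ≫ ev A = (λ_ A).hom ≫ p := transpose_ev _

/-- Feeding the element of `p` into the form of `g` composes `g` with `p`. This is how closing a cut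
becomes a substitution. -/
theorem name_unhat {A W : C} (p : A ⟶ bot C) (g : W ⟶ A) :
    name p ▷ W ≫ unhat g = (λ_ W).hom ≫ g ≫ p := by
  rw [unhat, ← whisker_exchange_assoc, name_ev]
  simp

instance deMorgan_isIso {ι : Type w} (X : ι → C) (t : Bracketing ι) : IsIso (deMorgan X t) := by
  induction t with
  | empty => exact isIso_bidual _
  | leaf i => exact IsIso.id _
  | node s t ihs iht =>
    exact IsIso.comp_isIso' (tensor_isIso _ _) (IsIso.comp_isIso' inferInstance (isIso_bidual _))

theorem tensor_coname_eq {P S T : C} (D : T ⟶ dual P) (f : S ⟶ P) :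
    (f ⊗ₘ D) ≫ coname P = (β_ S T).hom ≫ D ▷ S ≫ unhat f := by
  rw [unhat_eq, BraidedCategory.braiding_naturality_left_assoc,
    SymmetricCategory.symmetry_assoc, tensorHom_def', Category.assoc]

/-- The bijection between arrows `S ⟶ P` and forms `S ⊗ T ⟶ ⊥`, for `T ≅ P^⊥`. -/
noncomputable def conameEquiv {P S T : C} (D : T ⟶ dual P) [IsIso D] :
    (S ⟶ P) ≃ (S ⊗ T ⟶ bot C) where
  toFun f := (f ⊗ₘ D) ≫ coname P
  invFun m := hat (inv D ▷ S ≫ (β_ T S).hom ≫ m)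
  left_inv f := by
    dsimp only
    rw [tensor_coname_eq, SymmetricCategory.symmetry_assoc, ← comp_whiskerRight_assoc,
      IsIso.inv_hom_id, id_whiskerRight, Category.id_comp, hat_unhat]
  right_inv m := by
    dsimp only
    rw [tensor_coname_eq, unhat_hat, ← comp_whiskerRight_assoc, IsIso.hom_inv_id,
      id_whiskerRight, Category.id_comp, SymmetricCategory.symmetry_assoc]

/-- Complete de-curryfication is a bijection. -/
noncomputable def decurryEquiv {ι : Type w} (X : ι → C) (s t : Bracketing ι) :
    (srcObj X s ⟶ parObj X t) ≃ (srcObj X (.node s t) ⟶ bot C) :=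
  conameEquiv (deMorgan X t)

theorem decurry_injective {ι : Type w} (X : ι → C) {s t : Bracketing ι}
    {f g : srcObj X s ⟶ parObj X t} (h : decurry X f = decurry X g) : f = g :=
  (decurryEquiv X s t).injective h

end StarAutonomous

/-! ### Forms and substitution -/

section Forms

set_option linter.unusedSectionVars false

variable {C : Type u} [Category.{v} C] [MonoidalCategory C] [SymmetricCategory C] {ι : Type w}

/-- An arrow `⨂_s { Y i } ⟶ Z`, for some bracketing `s`. -/
structure Form (Y : ι → C) (Z : C) where
  br : Bracketing ι
  arr : tensObj Y br ⟶ Z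

namespace Form

variable {Y : ι → C} {Z : C}

/-- Two forms are equivalent if they differ by a structural isomorphism. -/
def Equivalent (φ ψ : Form Y Z) : Prop :=
  ∃ c : Structural φ.br ψ.br, φ.arr = (c.eval Y).hom ≫ ψ.arr

end Form

infix:50 "≋" => Form.Equivalent

namespace Form

variable {Y : ι → C} {Z : C}

theorem Equivalent.refl (φ : Form Y Z) : φ ≋ φ := ⟨.refl _, by simp [Structural.eval]⟩

theorem Equivalent.symm {φ ψ : Form Y Z} (h : φ ≋ ψ) : ψ ≋ φ := by
  obtain ⟨c, hc⟩ := h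
  exact ⟨c.symm, by simp [Structural.eval, hc]⟩

theorem Equivalent.trans {φ ψ χ : Form Y Z} (h : φ ≋ ψ) (h' : ψ ≋ χ) : φ ≋ χ := by
  obtain ⟨c, hc⟩ := h
  obtain ⟨d, hd⟩ := h'
  exact ⟨c.trans d, by simp [Structural.eval, hc, hd]⟩

theorem equiv_of {s t : Bracketing ι} (c : Structural s t) (m : tensObj Y t ⟶ Z) :
    (⟨s, (c.eval Y).hom ≫ m⟩ : Form Y Z) ≋ ⟨t, m⟩ := ⟨c, rfl⟩

theorem equiv_mk {s t : Bracketing ι} (c : Structural s t) {m : tensObj Y s ⟶ Z}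
    {n : tensObj Y t ⟶ Z} (h : m = (c.eval Y).hom ≫ n) :
    (⟨s, m⟩ : Form Y Z) ≋ ⟨t, n⟩ := ⟨c, h⟩

theorem equiv_of_eq {s : Bracketing ι} {m n : tensObj Y s ⟶ Z} (h : m = n) :
    (⟨s, m⟩ : Form Y Z) ≋ ⟨s, n⟩ := h ▸ .refl _

/-- The leaves of a form. -/
def leaves (φ : Form Y Z) : List ι := φ.br.leaves

@[simp]
theorem leaves_mk (s : Bracketing ι) (m : tensObj Y s ⟶ Z) :
    (⟨s, m⟩ : Form Y Z).leaves = s.leaves := rfl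

theorem perm_of_equiv {φ ψ : Form Y Z} (h : φ ≋ ψ) : φ.leaves.Perm ψ.leaves := by
  obtain ⟨c, -⟩ := h
  exact c.perm

theorem exists_equiv (φ : Form Y Z) {t : Bracketing ι} (h : φ.leaves.Perm t.leaves) :
    ∃ m : tensObj Y t ⟶ Z, φ ≋ ⟨t, m⟩ := by
  obtain ⟨c⟩ := Structural.exists_of_perm h
  exact ⟨(c.eval Y).inv ≫ φ.arr, c, by simp⟩

/-- By coherence the automorphism of `s` that relates the two denotes the identity. With repeated
leaves it could be a nontrivial symmetry. -/
theorem eq_of_equiv {s : Bracketing ι} (hs : s.leaves.Nodup) {m n : tensObj Y s ⟶ Z}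
    (h : (⟨s, m⟩ : Form Y Z) ≋ ⟨s, n⟩) : m = n := by
  obtain ⟨c, hc⟩ := h
  have := Structural.eval_hom_eq hs c (.refl s) Y
  simp only [this] at hc
  simpa [Structural.eval] using hc

/-- Cancelling `v` from the permutation of leaves gives some isomorphism from `s` to `s'`. By
coherence it may replace the given isomorphism, which need not respect the block `v`. -/
theorem node_equiv {v s s' : Bracketing ι} (hs : (Bracketing.node v s).leaves.Nodup)
    {m : tensObj Y (.node v s) ⟶ Z} {n : tensObj Y (.node v s') ⟶ Z}
    (h : (⟨_, m⟩ : Form Y Z) ≋ ⟨_, n⟩) :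
    ∃ d : Structural s s', m = tensObj Y v ◁ (d.eval Y).hom ≫ n := by
  obtain ⟨c, hc⟩ := h
  have hp := c.perm
  simp only [Bracketing.leaves, List.perm_append_left_iff] at hp
  obtain ⟨d⟩ := Structural.exists_of_perm hp
  have := Structural.eval_hom_eq hs c (.tensor (.refl v) d) Y
  refine ⟨d, ?_⟩
  exact hc.trans (by rw [this]; exact congrArg (· ≫ n) (id_tensorHom _ _))

end Form

open Form

variable {Y : ι → C} {Z : C}

/-! ### Naturality identities behind substitution. -/

section Calculus

variable {A B A' B' G H W : C}

theorem whiskerRight_swap (k : A ⟶ A') (d : G ⟶ H) (p : A' ⊗ H ⟶ W) :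
    k ▷ G ≫ A' ◁ d ≫ p = (𝟙 A ⊗ₘ d) ≫ k ▷ H ≫ p := by
  rw [id_tensorHom, whisker_exchange_assoc]

theorem swap_natural_right (k : B ⟶ B') (p : A ⊗ B' ⊗ G ⟶ W) :
    k ▷ (A ⊗ G) ≫ (((α_ B' A G).inv ≫ ((β_ B' A).hom ⊗ₘ 𝟙 G)) ≫ (α_ A B' G).hom) ≫ p =
      (((α_ B A G).inv ≫ ((β_ B A).hom ⊗ₘ 𝟙 G)) ≫ (α_ A B G).hom) ≫ A ◁ (k ▷ G) ≫ p := by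
  simp only [tensorHom_id, Category.assoc, associator_inv_naturality_left_assoc]
  rw [← comp_whiskerRight_assoc, BraidedCategory.braiding_naturality_left]
  simp

theorem swap_natural (k₁ : A ⟶ A') (k₂ : B ⟶ B') (p : A' ⊗ B' ⊗ G ⟶ W) :
    k₁ ▷ (B ⊗ G) ≫ A' ◁ (k₂ ▷ G) ≫ p =
      (((α_ A B G).inv ≫ ((β_ A B).hom ⊗ₘ 𝟙 G)) ≫ (α_ B A G).hom) ≫ k₂ ▷ (A ⊗ G) ≫
        (((α_ B' A G).inv ≫ ((β_ B' A).hom ⊗ₘ 𝟙 G)) ≫ (α_ A B' G).hom) ≫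
          k₁ ▷ (B' ⊗ G) ≫ p := by
  rw [swap_natural_right]
  have h : (β_ A B).hom ▷ G ≫ (β_ B A).hom ▷ G = 𝟙 _ := by
    rw [← comp_whiskerRight, SymmetricCategory.symmetry, id_whiskerRight]
  simp only [tensorHom_id, Category.assoc, Iso.hom_inv_id_assoc, reassoc_of% h,
    Iso.inv_hom_id_assoc]
  rw [whisker_exchange_assoc]

theorem assoc_substitute (j : A ⟶ A') (k : A' ⊗ B ⟶ B') (p : B' ⊗ G ⟶ W) :
    j ▷ (B ⊗ G) ≫ (α_ A' B G).inv ≫ k ▷ G ≫ p =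
      (α_ A B G).inv ≫ (j ▷ B ≫ k) ▷ G ≫ p := by
  simp

theorem braid_substitute (j : B ⟶ B') (k : A ⊗ B' ⟶ A') (p : A' ⊗ G ⟶ W) :
    j ▷ (A ⊗ G) ≫ ((α_ B' A G).inv ≫ ((β_ B' A).hom ⊗ₘ 𝟙 G)) ≫ k ▷ G ≫ p =
      ((α_ B A G).inv ≫ ((β_ B A).hom ⊗ₘ 𝟙 G)) ≫ (A ◁ j ≫ k) ▷ G ≫ p := by
  simp only [tensorHom_id, Category.assoc, associator_inv_naturality_left_assoc]
  rw [← comp_whiskerRight_assoc, BraidedCategory.braiding_naturality_left]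
  simp

theorem comp_substitute (j : A ⟶ B) (k : B ⟶ B') (p : B' ⊗ G ⟶ W) :
    j ▷ G ≫ k ▷ G ≫ p = (j ≫ k) ▷ G ≫ p := by
  simp

theorem comp_substitute_id (j : A ⟶ B) (k : B ⟶ B') (p : B' ⊗ G ⟶ W) :
    (j ≫ k) ▷ G ≫ p = (j ⊗ₘ 𝟙 G) ≫ k ▷ G ≫ p := by
  simp

theorem inv_substitute {k : A ⟶ B} {j : B ⟶ A} (h : j ≫ k = 𝟙 B) (p : B ⊗ G ⟶ W) :
    p = j ▷ G ≫ k ▷ G ≫ p := by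
  rw [← comp_whiskerRight_assoc, h, id_whiskerRight, Category.id_comp]

end Calculus

/-- `Plug k φ χ`: the form `χ` is obtained from `φ` by substituting the arrow `k` for some of the
arguments. -/
def Plug {v v' : Bracketing ι} (k : tensObj Y v ⟶ tensObj Y v') (φ χ : Form Y Z) : Prop :=
  ∃ (s : Bracketing ι) (p : tensObj Y v' ⊗ tensObj Y s ⟶ Z),
    φ ≋ ⟨.node v' s, p⟩ ∧ χ ≋ ⟨.node v s, k ▷ tensObj Y s ≫ p⟩

namespace Plug

variable {v v' : Bracketing ι} {k : tensObj Y v ⟶ tensObj Y v'} {φ φ' χ χ' ω : Form Y Z}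

theorem congr (h : Plug k φ χ) (h₁ : φ ≋ φ') (h₂ : χ ≋ χ') : Plug k φ' χ' := by
  obtain ⟨s, p, hφ, hχ⟩ := h
  exact ⟨s, p, (Form.Equivalent.symm h₁).trans hφ, (Form.Equivalent.symm h₂).trans hχ⟩

theorem perm (h : Plug k φ χ) :
    ∃ Γ, φ.leaves.Perm (v'.leaves ++ Γ) ∧ χ.leaves.Perm (v.leaves ++ Γ) := by
  obtain ⟨s, p, hφ, hχ⟩ := h
  exact ⟨s.leaves, perm_of_equiv hφ, perm_of_equiv hχ⟩

theorem perm_of (h : Plug k φ χ) {Γ : List ι} (hφ : φ.leaves.Perm (v'.leaves ++ Γ)) :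
    χ.leaves.Perm (v.leaves ++ Γ) := by
  obtain ⟨Δ, h₁, h₂⟩ := h.perm
  have := (List.perm_append_left_iff _).1 (hφ.symm.trans h₁)
  exact h₂.trans (this.symm.append_left _)

theorem mk {s : Bracketing ι} (p : tensObj Y v' ⊗ tensObj Y s ⟶ Z) :
    Plug k (⟨.node v' s, p⟩ : Form Y Z) ⟨.node v s, k ▷ tensObj Y s ≫ p⟩ :=
  ⟨s, p, Form.Equivalent.refl _, Form.Equivalent.refl _⟩

theorem exists_of_perm (k : tensObj Y v ⟶ tensObj Y v') {Γ : List ι}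
    (hφ : φ.leaves.Perm (v'.leaves ++ Γ)) :
    ∃ χ, Plug k φ χ ∧ χ.leaves.Perm (v.leaves ++ Γ) := by
  obtain ⟨p, hp⟩ := φ.exists_equiv (t := .node v' (.ofList Γ)) (by simpa [Bracketing.leaves] using hφ)
  exact ⟨_, ⟨_, p, hp, Form.Equivalent.refl _⟩, by simp [Form.leaves, Bracketing.leaves]⟩

/-- Two presentations of `φ` with the block `v'` in front differ by an isomorphism of the context
alone (`node_equiv`), and this commutes with `k`. So a substitution can be computed at any such
presentation. -/
theorem equiv_at (h : Plug k φ χ) (hn : φ.leaves.Nodup) {s : Bracketing ι}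
    {p : tensObj Y v' ⊗ tensObj Y s ⟶ Z} (hp : φ ≋ ⟨.node v' s, p⟩) :
    χ ≋ ⟨.node v s, k ▷ tensObj Y s ≫ p⟩ := by
  obtain ⟨s', p', hφ, hχ⟩ := h
  have hn' : (Bracketing.node v' s').leaves.Nodup := (perm_of_equiv hφ).nodup_iff.1 hn
  obtain ⟨d, hd⟩ := node_equiv hn' ((Form.Equivalent.symm hφ).trans hp)
  refine hχ.trans ⟨.tensor (.refl v) d, ?_⟩
  rw [hd]
  exact whiskerRight_swap _ _ _

theorem unique (h : Plug k φ χ) (h' : Plug k φ' χ') (hφ : φ ≋ φ') (hn : φ.leaves.Nodup) :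
    χ ≋ χ' := by
  obtain ⟨s, p, h₁, h₂⟩ := h'
  exact (h.equiv_at hn (hφ.trans h₁)).trans (Form.Equivalent.symm h₂)

/-- Substitutions for different arguments commute. -/
theorem comm {v₁ v₁' v₂ v₂' : Bracketing ι} {k₁ : tensObj Y v₁ ⟶ tensObj Y v₁'}
    {k₂ : tensObj Y v₂ ⟶ tensObj Y v₂'} {φ₁ φ₂ : Form Y Z} (h₁ : Plug k₁ φ φ₁)
    (h₂ : Plug k₂ φ φ₂) (hn : φ.leaves.Nodup) {Γ : List ι}
    (hφ : φ.leaves.Perm (v₁'.leaves ++ (v₂'.leaves ++ Γ))) :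
    ∃ χ, Plug k₂ φ₁ χ ∧ Plug k₁ φ₂ χ := by
  obtain ⟨p, hp⟩ := φ.exists_equiv (t := .node v₁' (.node v₂' (.ofList Γ)))
    (by simpa [Bracketing.leaves] using hφ)
  -- These isomorphisms exchange the first two blocks, so that both substitutions are computed from
  -- the same arrow `p`.
  let c (a b : Bracketing ι) : Structural (.node a (.node b (.ofList Γ)))
      (.node b (.node a (.ofList Γ))) :=
    ((Structural.assoc _ _ _).symm.trans (.tensor (.braid _ _) (.refl _))).trans (.assoc _ _ _)
  have e₁ := h₁.equiv_at hn hp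
  have e₂ := h₂.equiv_at hn (hp.trans (Form.Equivalent.symm (equiv_of (c v₂' v₁') p)))
  refine ⟨⟨.node v₁ (.node v₂ (.ofList Γ)),
    k₁ ▷ (tensObj Y (.node v₂ (.ofList Γ))) ≫ tensObj Y v₁' ◁ (k₂ ▷ tensObj Y (.ofList Γ)) ≫ p⟩,
    ⟨_, _, e₁.trans (Form.Equivalent.symm (equiv_of (c v₂' v₁) _)), ?_⟩, ⟨_, _, e₂.trans ?_, Form.Equivalent.refl _⟩⟩
  · refine Form.equiv_mk (c v₁ v₂) ?_
    exact swap_natural _ _ _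
  · refine Form.equiv_mk (c v₂ v₁') ?_
    exact swap_natural_right _ _

/-- Substituting first `k` and then `j` substitutes `j ≫ k`, so a one-sided inverse is enough to
undo a substitution. -/
theorem symm (h : Plug k φ χ) {j : tensObj Y v' ⟶ tensObj Y v} (hj : j ≫ k = 𝟙 _) :
    Plug j χ φ := by
  obtain ⟨s, p, h₁, h₂⟩ := h
  exact ⟨s, _, h₂, h₁.trans (Form.equiv_of_eq (inv_substitute hj p))⟩

theorem comp {v₀ : Bracketing ι} {j : tensObj Y v₀ ⟶ tensObj Y v} (h : Plug k φ χ)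
    (h' : Plug j χ ω) (hn : χ.leaves.Nodup) : Plug (j ≫ k) φ ω := by
  obtain ⟨s, p, h₁, h₂⟩ := h
  exact ⟨s, p, h₁, (h'.equiv_at hn h₂).trans (Form.equiv_of_eq (comp_substitute j k p))⟩

theorem comp_left {a b a' : Bracketing ι} {k : tensObj Y (.node a b) ⟶ tensObj Y v'}
    {j : tensObj Y a' ⟶ tensObj Y a} (h : Plug k φ χ)
    (h' : Plug j χ ω) (hn : χ.leaves.Nodup) :
    Plug (v := .node a' b) (j ▷ tensObj Y b ≫ k) φ ω := by
  obtain ⟨s, p, h₁, h₂⟩ := h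
  refine ⟨s, p, h₁, ?_⟩
  have := h'.equiv_at hn (h₂.trans (Form.Equivalent.symm (equiv_of (.symm (.assoc a b s)) _)))
  refine this.trans (Form.equiv_mk (.symm (.assoc a' b s)) ?_)
  exact assoc_substitute _ _ _

theorem comp_right {a b b' : Bracketing ι} {k : tensObj Y (.node a b) ⟶ tensObj Y v'}
    {j : tensObj Y b' ⟶ tensObj Y b} (h : Plug k φ χ)
    (h' : Plug j χ ω) (hn : χ.leaves.Nodup) :
    Plug (v := .node a b') (tensObj Y a ◁ j ≫ k) φ ω := by
  obtain ⟨s, p, h₁, h₂⟩ := h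
  refine ⟨s, p, h₁, ?_⟩
  let c (b : Bracketing ι) : Structural (.node b (.node a s)) (.node (.node a b) s) :=
    (Structural.assoc _ _ _).symm.trans (.tensor (.braid _ _) (.refl _))
  have := h'.equiv_at hn (h₂.trans (Form.Equivalent.symm (equiv_of (c b) _)))
  refine this.trans (Form.equiv_mk (c b') ?_)
  exact braid_substitute _ _ _

theorem structural_comp {v₀ : Bracketing ι} (c : Structural v₀ v) (h : Plug k φ χ) :
    Plug ((c.eval Y).hom ≫ k) φ χ := by
  obtain ⟨s, p, h₁, h₂⟩ := h
  refine ⟨s, p, h₁, h₂.trans (Form.Equivalent.symm (Form.equiv_mk (.tensor c (.refl s)) ?_))⟩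
  exact comp_substitute_id _ _ _

end Plug

end Forms

/-! ### Indices of leaves -/

section Indices

variable {𝒜 : Type w}

/-- The indices of the leaves of a formula. -/
def Formula.idx : Formula 𝒜 → List ℕ
  | .leaf _ i => [i]
  | .tens A B => A.idx ++ B.idx
  | .par A B => A.idx ++ B.idx

attribute [simp] Formula.idx

theorem Formula.idx_eq (A : Formula 𝒜) : A.idx = A.leaves.map Prod.snd := by
  induction A with
  | leaf l i => rfl
  | tens A B ihA ihB => simp [Formula.leaves, ihA, ihB]
  | par A B ihA ihB => simp [Formula.leaves, ihA, ihB]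

/-- The indices of the leaves of a sequent. -/
def idx (Γ : List (Formula 𝒜)) : List ℕ := Γ.flatMap Formula.idx

theorem idx_eq (Γ : List (Formula 𝒜)) : idx Γ = (seqLeaves Γ).map Prod.snd := by
  simp only [idx, seqLeaves, List.map_flatMap]
  exact congrArg (fun f => Γ.flatMap f) (funext fun A => A.idx_eq)

/-- All leaves of the sequent have different indices. -/
def Distinct (Γ : List (Formula 𝒜)) : Prop := (idx Γ).Nodup

@[simp] theorem idx_nil : idx ([] : List (Formula 𝒜)) = [] := rfl

@[simp] theorem idx_cons (A : Formula 𝒜) (Γ : List (Formula 𝒜)) :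
    idx (A :: Γ) = A.idx ++ idx Γ := by
  simp [idx]

@[simp] theorem idx_append (Γ Δ : List (Formula 𝒜)) : idx (Γ ++ Δ) = idx Γ ++ idx Δ := by
  simp [idx]

theorem idx_perm {Γ Δ : List (Formula 𝒜)} (h : Γ.Perm Δ) : (idx Γ).Perm (idx Δ) :=
  h.flatMap_right _

theorem Distinct.perm {Γ Δ : List (Formula 𝒜)} (hΓ : Distinct Γ) (h : Γ.Perm Δ) : Distinct Δ :=
  (idx_perm h).nodup_iff.1 hΓ

theorem Distinct.of_idx {Γ Δ : List (Formula 𝒜)} {l : List ℕ} (hΓ : Distinct Γ)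
    (h : (idx Γ).Perm (idx Δ ++ l)) : Distinct Δ :=
  (List.nodup_append.1 (h.nodup_iff.1 hΓ)).1

theorem exists_mem_idx (A : Formula 𝒜) : ∃ i, i ∈ A.idx := by
  induction A with
  | leaf l i => exact ⟨i, by simp⟩
  | tens A B ih _ => exact ih.imp fun i h => by simp [h]
  | par A B ih _ => exact ih.imp fun i h => by simp [h]

theorem mem_idx {Γ : List (Formula 𝒜)} {i : ℕ} : i ∈ idx Γ ↔ ∃ A ∈ Γ, i ∈ A.idx := by
  simp [idx]

/-- Every formula has a leaf, so two equal formulas would share an index. -/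
theorem Distinct.nodup {Γ : List (Formula 𝒜)} (h : Distinct Γ) : Γ.Nodup := by
  induction Γ with
  | nil => exact List.nodup_nil
  | cons A Γ ih =>
    rw [Distinct, idx_cons, List.nodup_append] at h
    refine List.nodup_cons.2 ⟨fun hA => ?_, ih h.2.1⟩
    obtain ⟨i, hi⟩ := exists_mem_idx A
    exact h.2.2 i hi i (mem_idx.2 ⟨A, hA, hi⟩) rfl

end Indices

/-! ### Derivations in terms of forms -/

section Derivations

variable {𝒜 : Type w} {C : Type u} [Category.{v} C] [MonoidalCategory C] [SymmetricCategory C]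
  [StarAutonomous C] (G₀ : 𝒜 → C)

/-- Forms on the dual objects `G(A)^⊥`. -/
abbrev NetForm := Form (fun A : Formula 𝒜 => dual (obj G₀ A)) (bot C)

variable {G₀}

/-- The forms of single axiom links. -/
inductive AxLink (link : ℕ → ℕ) : NetForm G₀ → Prop
  | atom (a : 𝒜) (i j : ℕ) : link i = j →
      AxLink link ⟨.node (.leaf (.leaf (.pos a) i)) (.leaf (.leaf (.neg a) j)), coname (dual (G₀ a))⟩
  | unit (i j : ℕ) : link i = j →
      AxLink link ⟨.node (.leaf (.leaf .one i)) (.leaf (.leaf .bot j)), coname (dual (𝟙_ C))⟩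

/-- The forms that belong to representatives of cut-free nets. -/
inductive Der (link : ℕ → ℕ) : NetForm G₀ → Prop
  | ax (φ : NetForm G₀) : AxLink link φ → Der link φ
  | par (A B : Formula 𝒜) (s : Bracketing (Formula 𝒜))
      (m : (dual (obj G₀ A) ⊗ dual (obj G₀ B)) ⊗ srcObj (obj G₀) s ⟶ bot C) :
      Der link ⟨.node (.node (.leaf A) (.leaf B)) s, m⟩ →
      Der link ⟨.node (.leaf (.par A B)) s, (parIso (obj G₀ A) (obj G₀ B)).inv ▷ _ ≫ m⟩
  | tens (A B : Formula 𝒜) (s t : Bracketing (Formula 𝒜))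
      (m : dual (obj G₀ A) ⊗ srcObj (obj G₀) s ⟶ bot C)
      (n : dual (obj G₀ B) ⊗ srcObj (obj G₀) t ⟶ bot C) :
      Der link ⟨.node (.leaf A) s, m⟩ → Der link ⟨.node (.leaf B) t, n⟩ →
      Der link ⟨.node (.leaf (.tens A B)) (.node s t), unhat (hat m ⊗ₘ hat n)⟩
  | conv (φ ψ : NetForm G₀) : φ ≋ ψ → Der link φ → Der link ψ

/-- The substitutions that correspond to the rules. -/
inductive Rule (link : ℕ → ℕ) : (v v' : Bracketing (Formula 𝒜)) →
    (srcObj (obj G₀) v ⟶ srcObj (obj G₀) v') → Prop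
  | par (A B : Formula 𝒜) :
      Rule link (.leaf (.par A B)) (.node (.leaf A) (.leaf B)) (parIso (obj G₀ A) (obj G₀ B)).inv
  | tensLeft (A B : Formula 𝒜) (t : Bracketing (Formula 𝒜))
      (n : dual (obj G₀ B) ⊗ srcObj (obj G₀) t ⟶ bot C) : Der link ⟨.node (.leaf B) t, n⟩ →
      Rule link (.node (.leaf (.tens A B)) t) (.leaf A) (absorbRight (obj G₀ A) (hat n))
  | tensRight (A B : Formula 𝒜) (s : Bracketing (Formula 𝒜))
      (m : dual (obj G₀ A) ⊗ srcObj (obj G₀) s ⟶ bot C) : Der link ⟨.node (.leaf A) s, m⟩ →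
      Rule link (.node (.leaf (.tens A B)) s) (.leaf B) (absorbLeft (obj G₀ B) (hat m))

variable {link : ℕ → ℕ}

theorem plug_par {A B : Formula 𝒜} {s : Bracketing (Formula 𝒜)}
    (m : (dual (obj G₀ A) ⊗ dual (obj G₀ B)) ⊗ srcObj (obj G₀) s ⟶ bot C) :
    Plug (Y := fun A => dual (obj G₀ A)) (v := .leaf (.par A B))
      (v' := .node (.leaf A) (.leaf B)) (parIso (obj G₀ A) (obj G₀ B)).inv
      (⟨.node (.node (.leaf A) (.leaf B)) s, m⟩ : NetForm G₀)
      ⟨.node (.leaf (.par A B)) s, (parIso (obj G₀ A) (obj G₀ B)).inv ▷ _ ≫ m⟩ :=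
  ⟨s, m, .refl _, .refl _⟩

theorem tensLeft_equiv {A B : Formula 𝒜} {s t : Bracketing (Formula 𝒜)}
    (m : dual (obj G₀ A) ⊗ srcObj (obj G₀) s ⟶ bot C)
    (n : dual (obj G₀ B) ⊗ srcObj (obj G₀) t ⟶ bot C) :
    (⟨.node (.node (.leaf (.tens A B)) t) s, absorbRight (obj G₀ A) (hat n) ▷ _ ≫ m⟩ : NetForm G₀) ≋
      ⟨.node (.leaf (.tens A B)) (.node s t), unhat (hat m ⊗ₘ hat n)⟩ := by
  refine Form.equiv_mk ((Structural.assoc _ _ _).trans (.tensor (.refl _) (.braid _ _))) ?_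
  have h := absorbRight_unhat (hat m) (hat n)
  rw [unhat_hat] at h
  exact h.trans (by rw [← Category.assoc, ← id_tensorHom]; rfl)

theorem tensRight_equiv {A B : Formula 𝒜} {s t : Bracketing (Formula 𝒜)}
    (m : dual (obj G₀ A) ⊗ srcObj (obj G₀) s ⟶ bot C)
    (n : dual (obj G₀ B) ⊗ srcObj (obj G₀) t ⟶ bot C) :
    (⟨.node (.node (.leaf (.tens A B)) s) t, absorbLeft (obj G₀ B) (hat m) ▷ _ ≫ n⟩ : NetForm G₀) ≋
      ⟨.node (.leaf (.tens A B)) (.node s t), unhat (hat m ⊗ₘ hat n)⟩ := by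
  refine Form.equiv_mk (Structural.assoc _ _ _) ?_
  have h := absorbLeft_unhat (hat m) (hat n)
  rw [unhat_hat] at h
  exact h

theorem plug_tensLeft {A B : Formula 𝒜} {s t : Bracketing (Formula 𝒜)}
    (m : dual (obj G₀ A) ⊗ srcObj (obj G₀) s ⟶ bot C)
    (n : dual (obj G₀ B) ⊗ srcObj (obj G₀) t ⟶ bot C) :
    Plug (Y := fun A => dual (obj G₀ A)) (v := .node (.leaf (.tens A B)) t) (v' := .leaf A)
      (absorbRight (obj G₀ A) (hat n))
      (⟨.node (.leaf A) s, m⟩ : NetForm G₀)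
      ⟨.node (.leaf (.tens A B)) (.node s t), unhat (hat m ⊗ₘ hat n)⟩ :=
  ⟨s, m, .refl _, (tensLeft_equiv m n).symm⟩

theorem plug_tensRight {A B : Formula 𝒜} {s t : Bracketing (Formula 𝒜)}
    (m : dual (obj G₀ A) ⊗ srcObj (obj G₀) s ⟶ bot C)
    (n : dual (obj G₀ B) ⊗ srcObj (obj G₀) t ⟶ bot C) :
    Plug (Y := fun A => dual (obj G₀ A)) (v := .node (.leaf (.tens A B)) s) (v' := .leaf B)
      (absorbLeft (obj G₀ B) (hat m))
      (⟨.node (.leaf B) t, n⟩ : NetForm G₀)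
      ⟨.node (.leaf (.tens A B)) (.node s t), unhat (hat m ⊗ₘ hat n)⟩ :=
  ⟨t, n, .refl _, (tensRight_equiv m n).symm⟩

theorem Der.congr {φ ψ : NetForm G₀} (h : Der link φ) (e : φ ≋ ψ) : Der link ψ := .conv _ _ e h

/-- Every substitution of the arrow of a rule is an inference. A tensor rule is recovered from the
premise that is stored inside `Rule`. -/
theorem Der.rule {φ χ : NetForm G₀} {v v' : Bracketing (Formula 𝒜)}
    {k : srcObj (obj G₀) v ⟶ srcObj (obj G₀) v'} (h : Der link φ) (hk : Rule link v v' k)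
    (hp : Plug k φ χ) : Der link χ := by
  obtain ⟨s, p, h₁, h₂⟩ := hp
  cases hk with
  | par A B => exact (Der.par A B s p (h.congr h₁)).congr h₂.symm
  | tensLeft A B t n hn =>
    exact (Der.tens A B s t p n (h.congr h₁) hn).congr ((tensLeft_equiv p n).symm.trans h₂.symm)
  | tensRight A B t m hm =>
    exact (Der.tens A B t s m p hm (h.congr h₁)).congr ((tensRight_equiv m p).symm.trans h₂.symm)

/-- Rules never lose an index; hence distinctness passes from a conclusion back to its premise. -/
theorem Rule.idx_perm {v v' : Bracketing (Formula 𝒜)}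
    {k : srcObj (obj G₀) v ⟶ srcObj (obj G₀) v'} (hk : Rule link v v' k) :
    ∃ l, (idx v.leaves).Perm (idx v'.leaves ++ l) := by
  cases hk with
  | par A B => exact ⟨[], by simp⟩
  | tensLeft A B t n hn =>
    exact ⟨B.idx ++ idx t.leaves, by simp⟩
  | tensRight A B t n hn =>
    refine ⟨A.idx ++ idx t.leaves, ?_⟩
    simp only [Bracketing.leaves, idx_append, idx_cons, idx_nil, List.append_nil, Formula.idx,
      ← List.append_assoc]
    exact List.perm_append_comm.append_right _

theorem Rule.distinct {φ χ : NetForm G₀} {v v' : Bracketing (Formula 𝒜)}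
    {k : srcObj (obj G₀) v ⟶ srcObj (obj G₀) v'} (hk : Rule link v v' k)
    (hp : Plug k φ χ) (h : Distinct χ.leaves) : Distinct φ.leaves := by
  obtain ⟨Γ, h₁, h₂⟩ := hp.perm
  obtain ⟨l, hl⟩ := hk.idx_perm
  refine Distinct.perm (Distinct.of_idx (l := l) (h.perm h₂) ?_) h₁.symm
  simp only [idx_append]
  exact (hl.append_right _).trans (by
    rw [List.append_assoc, List.append_assoc]; exact List.perm_append_comm.append_left _)

/-- `Extends link F φ χ`: the form `χ` is obtained from `φ` by rules that do not act on the
formula `F`. -/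
inductive Extends (link : ℕ → ℕ) (F : Formula 𝒜) : NetForm G₀ → NetForm G₀ → Prop
  | refl (φ χ : NetForm G₀) : φ ≋ χ → Extends link F φ χ
  | step (φ χ ω : NetForm G₀) (v v' : Bracketing (Formula 𝒜))
      (k : srcObj (obj G₀) v ⟶ srcObj (obj G₀) v') :
      Extends link F φ χ → Rule link v v' k → F ∉ v'.leaves → Plug k χ ω → Extends link F φ ω

theorem Extends.congr {F : Formula 𝒜} {φ χ χ' : NetForm G₀} (h : Extends link F φ χ)
    (e : χ ≋ χ') : Extends link F φ χ' := by
  cases h with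
  | refl _ h => exact .refl _ _ (h.trans e)
  | step χ _ v v' k h₁ h₂ h₃ h₄ => exact .step _ _ _ v v' k h₁ h₂ h₃ (h₄.congr (.refl _) e)

theorem Extends.distinct {F : Formula 𝒜} {φ χ : NetForm G₀} (h : Extends link F φ χ)
    (hχ : Distinct χ.leaves) : Distinct φ.leaves := by
  induction h with
  | refl χ e => exact hχ.perm (Form.perm_of_equiv e).symm
  | step _ _ v v' k _ hk _ hp ih => exact ih (hk.distinct hp hχ)

/-- A substitution for the formula `F` can be moved through an extension. -/
theorem Extends.subst {F : Formula 𝒜} {φ χ φ' : NetForm G₀} (h : Extends link F φ χ)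
    (hχ : Distinct χ.leaves) {v : Bracketing (Formula 𝒜)}
    {j : srcObj (obj G₀) v ⟶ srcObj (obj G₀) (.leaf F)} (hj : Plug j φ φ') (hφ' : Der link φ') :
    ∃ χ', Plug j χ χ' ∧ Der link χ' := by
  induction h with
  | refl χ e => exact ⟨φ', hj.congr e (.refl _), hφ'⟩
  | step χ ω v₁ v₁' k _ hk hF hp ih =>
    obtain ⟨χ', h₁, h₂⟩ := ih (hk.distinct hp hχ)
    obtain ⟨Γ, hΓ, -⟩ := hp.perm
    have hFχ : F ∈ χ.leaves := by
      obtain ⟨Δ, hΔ, -⟩ := h₁.perm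
      exact hΔ.mem_iff.2 (by simp [Bracketing.leaves])
    -- The rule does not consume `F`, so `F` lies in the context and the two substitutions act on
    -- different arguments.
    have hFΓ : F ∈ Γ := by
      have := hΓ.mem_iff.1 hFχ
      simpa [hF] using this
    obtain ⟨Γ', hΓ'⟩ := List.mem_iff_append.1 hFΓ
    obtain ⟨Γ'', hΓ''⟩ := hΓ'
    have hperm : χ.leaves.Perm (v₁'.leaves ++ ((Bracketing.leaf F).leaves ++ (Γ' ++ Γ''))) := by
      refine hΓ.trans (List.Perm.append_left _ ?_)
      rw [hΓ'']
      simp [Bracketing.leaves]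
    obtain ⟨ω', h₃, h₄⟩ := hp.comm h₁ (hk.distinct hp hχ).nodup hperm
    exact ⟨ω', h₃, h₂.rule hk h₄⟩

/-- The forms in which the last rule introduces the formula `F`. -/
inductive Intro (link : ℕ → ℕ) : Formula 𝒜 → NetForm G₀ → Prop
  | ax (F : Formula 𝒜) (φ : NetForm G₀) : F ∈ φ.leaves → AxLink link φ → Intro link F φ
  | par (A B : Formula 𝒜) (s : Bracketing (Formula 𝒜))
      (m : (dual (obj G₀ A) ⊗ dual (obj G₀ B)) ⊗ srcObj (obj G₀) s ⟶ bot C) :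
      Der link ⟨.node (.node (.leaf A) (.leaf B)) s, m⟩ →
      Intro link (.par A B) ⟨.node (.leaf (.par A B)) s,
        (parIso (obj G₀ A) (obj G₀ B)).inv ▷ _ ≫ m⟩
  | tens (A B : Formula 𝒜) (s t : Bracketing (Formula 𝒜))
      (m : dual (obj G₀ A) ⊗ srcObj (obj G₀) s ⟶ bot C)
      (n : dual (obj G₀ B) ⊗ srcObj (obj G₀) t ⟶ bot C) :
      Der link ⟨.node (.leaf A) s, m⟩ → Der link ⟨.node (.leaf B) t, n⟩ →
      Intro link (.tens A B) ⟨.node (.leaf (.tens A B)) (.node s t), unhat (hat m ⊗ₘ hat n)⟩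

/-- Every formula in a derivable form has been introduced by some rule. -/
theorem Der.focus {φ : NetForm G₀} (h : Der link φ) (hφ : Distinct φ.leaves) {F : Formula 𝒜}
    (hF : F ∈ φ.leaves) : ∃ core, Intro link F core ∧ Extends link F core φ := by
  induction h with
  | ax φ hax => exact ⟨φ, .ax F φ hF hax, .refl _ _ (.refl _)⟩
  | par A B s m hm ih =>
    by_cases hA : F = .par A B
    · subst hA
      exact ⟨_, .par A B s m hm, .refl _ _ (.refl _)⟩
    · have hk := Rule.par (G₀ := G₀) (link := link) A B
      have hp := plug_par m
      have hd := hk.distinct hp hφ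
      have hFs : F ∈ s.leaves := by simpa [Form.leaves, Bracketing.leaves, hA] using hF
      obtain ⟨core, h₁, h₂⟩ := ih hd (by simp [Form.leaves, Bracketing.leaves, hFs])
      refine ⟨core, h₁, .step _ _ _ _ _ _ h₂ hk ?_ hp⟩
      -- `F` lies in the context `s`; by distinctness it is neither of the two formulas that the par
      -- rule consumes.
      have := hd.nodup
      simp only [Form.leaves, Bracketing.leaves, List.cons_append, List.nil_append,
        List.nodup_cons, List.mem_cons] at this ⊢
      grind
  | tens A B s t m n hm hn ihm ihn =>
    by_cases hA : F = .tens A B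
    · subst hA
      exact ⟨_, .tens A B s t m n hm hn, .refl _ _ (.refl _)⟩
    -- The tensor rule is read as a substitution into whichever premise contains `F`, with the other
    -- premise as a parameter of the rule.
    · have hl := Rule.tensLeft A B t n hn
      have hr := Rule.tensRight A B s m hm
      have pl := plug_tensLeft m n
      have pr := plug_tensRight m n
      have hF' : F ∈ s.leaves ∨ F ∈ t.leaves := by
        simpa [Form.leaves, Bracketing.leaves, hA] using hF
      rcases hF' with hF' | hF'
      · have hd := hl.distinct pl hφ
        obtain ⟨core, h₁, h₂⟩ := ihm hd (by simp [Form.leaves, Bracketing.leaves, hF'])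
        refine ⟨core, h₁, .step _ _ _ _ _ _ h₂ hl ?_ pl⟩
        have := hd.nodup
        simp only [Form.leaves, Bracketing.leaves, List.cons_append, List.nil_append,
          List.nodup_cons] at this
        simp only [Bracketing.leaves, List.mem_singleton]
        grind
      · have hd := hr.distinct pr hφ
        obtain ⟨core, h₁, h₂⟩ := ihn hd (by simp [Form.leaves, Bracketing.leaves, hF'])
        refine ⟨core, h₁, .step _ _ _ _ _ _ h₂ hr ?_ pr⟩
        have := hd.nodup
        simp only [Form.leaves, Bracketing.leaves, List.cons_append, List.nil_append,
          List.nodup_cons] at this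
        simp only [Bracketing.leaves, List.mem_singleton]
        grind
  | conv φ ψ e h ih =>
    have hp := Form.perm_of_equiv e
    obtain ⟨core, h₁, h₂⟩ := ih (hφ.perm hp.symm) (hp.mem_iff.2 hF)
    exact ⟨core, h₁, h₂.congr e⟩

end Derivations

/-! ### Independence of the order of the rules -/

section Uniqueness

variable {𝒜 : Type w} {C : Type u} [Category.{v} C] [MonoidalCategory C] [SymmetricCategory C]
  [StarAutonomous C] {G₀ : 𝒜 → C} {link : ℕ → ℕ}

theorem AxLink.leaf_of_mem {φ : NetForm G₀} (h : AxLink link φ) {F : Formula 𝒜}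
    (hF : F ∈ φ.leaves) : ∃ l i, F = .leaf l i := by
  cases h with
  | atom a i j h => 
    simp only [Form.leaves, Bracketing.leaves, List.cons_append, List.nil_append, List.mem_cons,
      List.not_mem_nil, or_false] at hF
    rcases hF with rfl | rfl <;> exact ⟨_, _, rfl⟩
  | unit i j h => 
    simp only [Form.leaves, Bracketing.leaves, List.cons_append, List.nil_append, List.mem_cons,
      List.not_mem_nil, or_false] at hF
    rcases hF with rfl | rfl <;> exact ⟨_, _, rfl⟩

/-- Par rules are invertible. -/
theorem Der.par_inv {χ : NetForm G₀} (h : Der link χ) (hχ : Distinct χ.leaves) {A B : Formula 𝒜}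
    (hF : .par A B ∈ χ.leaves) : ∃ χ₀, Der link χ₀ ∧
      Plug (v := .leaf (.par A B)) (v' := .node (.leaf A) (.leaf B))
        (parIso (obj G₀ A) (obj G₀ B)).inv χ₀ χ := by
  obtain ⟨core, hi, he⟩ := h.focus hχ hF
  cases hi with
  | ax F φ hmem hax => 
    obtain ⟨l, i, h⟩ := hax.leaf_of_mem hmem
    cases h
  | par A B s m hm =>
    -- Undoing the par rule is itself a substitution for `A ⅋ B`, so it can be moved from the core
    -- through the extension.
    have hp := (plug_par m).symm (parIso (obj G₀ A) (obj G₀ B)).hom_inv_id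
    obtain ⟨χ₀, h₁, h₂⟩ := he.subst hχ hp hm
    refine ⟨χ₀, h₂, ?_⟩
    exact h₁.symm (parIso (obj G₀ A) (obj G₀ B)).inv_hom_id

/-- Each premise changes only by an isomorphism of its context, and `hat` is natural in the context.
So the tensor rule is well defined on classes of forms. -/
theorem tens_congr {A B : Formula 𝒜} {s t s' t' : Bracketing (Formula 𝒜)}
    {m : dual (obj G₀ A) ⊗ srcObj (obj G₀) s ⟶ bot C}
    {n : dual (obj G₀ B) ⊗ srcObj (obj G₀) t ⟶ bot C}
    {m' : dual (obj G₀ A) ⊗ srcObj (obj G₀) s' ⟶ bot C}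
    {n' : dual (obj G₀ B) ⊗ srcObj (obj G₀) t' ⟶ bot C}
    (hs : (A :: s.leaves).Nodup) (ht : (B :: t.leaves).Nodup)
    (hm : (⟨.node (.leaf A) s, m⟩ : NetForm G₀) ≋ ⟨.node (.leaf A) s', m'⟩)
    (hn : (⟨.node (.leaf B) t, n⟩ : NetForm G₀) ≋ ⟨.node (.leaf B) t', n'⟩) :
    (⟨.node (.leaf (.tens A B)) (.node s t), unhat (hat m ⊗ₘ hat n)⟩ : NetForm G₀) ≋
      ⟨.node (.leaf (.tens A B)) (.node s' t'), unhat (hat m' ⊗ₘ hat n')⟩ := by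
  obtain ⟨d, hd⟩ := Form.node_equiv (v := .leaf A) (by simpa using hs) hm
  obtain ⟨e, he⟩ := Form.node_equiv (v := .leaf B) (by simpa using ht) hn
  have h₁ : hat m = (d.eval _).hom ≫ hat m' := by
    have : m = unhat ((d.eval _).hom ≫ hat m') := by rw [unhat_comp, unhat_hat]; exact hd
    conv_lhs => rw [this]
    exact hat_unhat _
  have h₂ : hat n = (e.eval _).hom ≫ hat n' := by
    have : n = unhat ((e.eval _).hom ≫ hat n') := by rw [unhat_comp, unhat_hat]; exact he
    conv_lhs => rw [this]
    exact hat_unhat _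
  refine Form.equiv_mk (.tensor (.refl _) (.tensor d e)) ?_
  rw [h₁, h₂, ← tensorHom_comp_tensorHom]
  exact (unhat_comp _ _).trans (congrArg (· ≫ unhat (hat m' ⊗ₘ hat n')) (id_tensorHom _ _).symm)

/-- The indices in `l` all satisfy `P`, or none does. -/
def Pure (P : ℕ → Prop) (l : List ℕ) : Prop := (∀ i ∈ l, P i) ∨ (∀ i ∈ l, ¬ P i)

theorem Pure.mono {P : ℕ → Prop} {l l' : List ℕ} (h : Pure P l) (hl : ∀ i ∈ l', i ∈ l) :
    Pure P l' :=
  h.imp (fun h i hi => h i (hl i hi)) (fun h i hi => h i (hl i hi))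

theorem Pure.append {P : ℕ → Prop} {l l' : List ℕ} (h : Pure P l) (h' : Pure P l') {i : ℕ}
    (hi : i ∈ l) (hi' : i ∈ l') : Pure P (l ++ l') := by
  rcases h with h | h <;> rcases h' with h' | h'
  · exact .inl (by simp only [List.mem_append]; grind)
  · exact (h' i hi' (h i hi)).elim
  · exact (h i hi (h' i hi')).elim
  · exact .inr (by simp only [List.mem_append]; grind)

theorem mem_idx_of_perm {Γ Δ : List (Formula 𝒜)} (h : Γ.Perm Δ) {i : ℕ} :
    i ∈ idx Γ ↔ i ∈ idx Δ := (idx_perm h).mem_iff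

theorem Pure.of_link {P : ℕ → Prop} {i j : ℕ} (h : P j ↔ P i) : Pure P [i, j] := by
  by_cases hi : P i
  · exact .inl (by simp [h, hi])
  · exact .inr (by simp [h, hi])

/-- Derivable sequents are connected by the axiom links. -/
theorem Der.pure {φ : NetForm G₀} (h : Der link φ) (P : ℕ → Prop)
    (hP : ∀ i ∈ idx φ.leaves, (P (link i) ↔ P i))
    (hu : ∀ F ∈ φ.leaves, Pure P F.idx) : Pure P (idx φ.leaves) := by
  induction h with
  | ax φ h =>
    cases h with
    | atom a i j h => exact .of_link (h ▸ hP i (by simp [Form.leaves]))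
    | unit i j h => exact .of_link (h ▸ hP i (by simp [Form.leaves]))
  | par A B s m hm ih =>
    simp only [Form.leaves, Bracketing.leaves, List.cons_append, List.nil_append, idx_cons,
      Formula.idx, List.mem_cons, forall_eq_or_imp, List.mem_append] at hP hu ih ⊢
    refine (ih (by grind) ⟨hu.1.mono (by simp +contextual), hu.1.mono (by simp +contextual),
      hu.2⟩).mono (by simp)
  | tens A B s t m n hm hn ihm ihn =>
    simp only [Form.leaves, Bracketing.leaves, List.cons_append, List.nil_append, idx_cons,
      Formula.idx, List.mem_cons, forall_eq_or_imp, List.mem_append, idx_append]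
      at hP hu ihm ihn ⊢
    have h₁ := ihm (by grind) ⟨hu.1.mono (by simp +contextual), fun F hF => hu.2 F (.inl hF)⟩
    have h₂ := ihn (by grind) ⟨hu.1.mono (by simp +contextual), fun F hF => hu.2 F (.inr hF)⟩
    -- Two pure lists with a common index have a pure union. The indices `a` and `b` glue the two
    -- premises to the pure formula `A ⊗ B`.
    obtain ⟨a, ha⟩ := exists_mem_idx A
    obtain ⟨b, hb⟩ := exists_mem_idx B
    have h₃ := h₁.append hu.1 (i := a) (by simp [ha]) (by simp [ha])
    refine (h₃.append h₂ (i := b) (by simp [hb]) (by simp [hb])).mono ?_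
    simp only [List.mem_append]
    tauto
  | conv φ ψ e h ih =>
    have hp := Form.perm_of_equiv e
    exact (ih (fun i hi => hP i ((mem_idx_of_perm hp).1 hi))
      (fun F hF => hu F (hp.mem_iff.1 hF))).mono fun i hi => (mem_idx_of_perm hp).2 hi

/-- A rule is connected by its main formula and by the links of its fixed premise. It therefore lies
entirely on one side of any predicate that the links and the formulas respect. -/
theorem Rule.pure {v v' : Bracketing (Formula 𝒜)} {k : srcObj (obj G₀) v ⟶ srcObj (obj G₀) v'}
    (hk : Rule link v v' k) (P : ℕ → Prop) (hP : ∀ i ∈ idx v.leaves, (P (link i) ↔ P i))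
    (hu : ∀ F ∈ v.leaves, Pure P F.idx) : Pure P (idx v.leaves) := by
  cases hk with
  | par A B => exact (hu (.par A B) (by simp)).mono (by simp)
  | tensLeft A B t n hn =>
    have h := hn.pure P
    simp only [Form.leaves, Bracketing.leaves, List.cons_append, List.nil_append, idx_cons,
      Formula.idx, List.mem_cons, forall_eq_or_imp, List.mem_append] at hP hu h ⊢
    obtain ⟨b, hb⟩ := exists_mem_idx B
    refine (hu.1.append (h (by grind) ⟨hu.1.mono (by simp +contextual), hu.2⟩) (i := b)
      (by simp [hb]) (by simp [hb])).mono ?_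
    simp only [List.mem_append]
    tauto
  | tensRight A B t n hn =>
    have h := hn.pure P
    simp only [Form.leaves, Bracketing.leaves, List.cons_append, List.nil_append, idx_cons,
      Formula.idx, List.mem_cons, forall_eq_or_imp, List.mem_append] at hP hu h ⊢
    obtain ⟨a, ha⟩ := exists_mem_idx A
    refine (hu.1.append (h (by grind) ⟨hu.1.mono (by simp +contextual), hu.2⟩) (i := a)
      (by simp [ha]) (by simp [ha])).mono ?_
    simp only [List.mem_append]
    tauto


end Uniqueness

/-! ### The tensor rule on classes of forms, and uniqueness of derivable forms. -/

section TensorForms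

variable {𝒜 : Type w} {C : Type u} [Category.{v} C] [MonoidalCategory C] [SymmetricCategory C]
  [StarAutonomous C] {G₀ : 𝒜 → C} {link : ℕ → ℕ}

/-- `TensOf A B φ ψ χ`: the form `χ` is obtained from `φ` and `ψ` by the tensor rule for `A ⊗ B`. -/
def TensOf (A B : Formula 𝒜) (φ ψ χ : NetForm G₀) : Prop :=
  ∃ (s t : Bracketing (Formula 𝒜)) (m : dual (obj G₀ A) ⊗ srcObj (obj G₀) s ⟶ bot C)
    (n : dual (obj G₀ B) ⊗ srcObj (obj G₀) t ⟶ bot C),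
    φ ≋ ⟨.node (.leaf A) s, m⟩ ∧ ψ ≋ ⟨.node (.leaf B) t, n⟩ ∧
      χ ≋ ⟨.node (.leaf (.tens A B)) (.node s t), unhat (hat m ⊗ₘ hat n)⟩

namespace TensOf

variable {A B : Formula 𝒜} {φ φ' ψ ψ' χ χ' : NetForm G₀}

theorem congr (h : TensOf A B φ ψ χ) (h₁ : φ ≋ φ') (h₂ : ψ ≋ ψ') (h₃ : χ ≋ χ') :
    TensOf A B φ' ψ' χ' := by
  obtain ⟨s, t, m, n, e₁, e₂, e₃⟩ := h
  exact ⟨s, t, m, n, h₁.symm.trans e₁, h₂.symm.trans e₂, h₃.symm.trans e₃⟩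

theorem perm (h : TensOf A B φ ψ χ) : ∃ Γ Δ : List (Formula 𝒜), φ.leaves.Perm (A :: Γ) ∧
    ψ.leaves.Perm (B :: Δ) ∧ χ.leaves.Perm (.tens A B :: (Γ ++ Δ)) := by
  obtain ⟨s, t, m, n, e₁, e₂, e₃⟩ := h
  exact ⟨s.leaves, t.leaves, Form.perm_of_equiv e₁, Form.perm_of_equiv e₂, Form.perm_of_equiv e₃⟩

theorem der (h : TensOf A B φ ψ χ) (hφ : Der link φ) (hψ : Der link ψ) : Der link χ := by
  obtain ⟨s, t, m, n, e₁, e₂, e₃⟩ := h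
  exact (Der.tens A B s t m n (hφ.congr e₁) (hψ.congr e₂)).congr e₃.symm

theorem unique (h : TensOf A B φ ψ χ) (h' : TensOf A B φ' ψ' χ') (hφ : φ.leaves.Nodup)
    (hψ : ψ.leaves.Nodup) (e : φ ≋ φ') (e' : ψ ≋ ψ') : χ ≋ χ' := by
  obtain ⟨s, t, m, n, e₁, e₂, e₃⟩ := h
  obtain ⟨s', t', m', n', e₁', e₂', e₃'⟩ := h'
  exact e₃.trans ((tens_congr ((Form.perm_of_equiv e₁).nodup_iff.1 hφ)
    ((Form.perm_of_equiv e₂).nodup_iff.1 hψ) (e₁.symm.trans (e.trans e₁'))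
    (e₂.symm.trans (e'.trans e₂'))).trans e₃'.symm)

theorem exists_of_perm {Γ Δ : List (Formula 𝒜)} (hφ : φ.leaves.Perm (A :: Γ))
    (hψ : ψ.leaves.Perm (B :: Δ)) : ∃ χ, TensOf A B φ ψ χ := by
  obtain ⟨m, hm⟩ := φ.exists_equiv (t := .node (.leaf A) (.ofList Γ)) (by simpa using hφ)
  obtain ⟨n, hn⟩ := ψ.exists_equiv (t := .node (.leaf B) (.ofList Δ)) (by simpa using hψ)
  exact ⟨_, _, _, m, n, hm, hn, .refl _⟩

theorem of_plug_left {t : Bracketing (Formula 𝒜)}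
    {n : dual (obj G₀ B) ⊗ srcObj (obj G₀) t ⟶ bot C} (e : ψ ≋ ⟨.node (.leaf B) t, n⟩)
    (h : Plug (v := .node (.leaf (.tens A B)) t) (v' := .leaf A)
      (absorbRight (obj G₀ A) (hat n)) φ χ) : TensOf A B φ ψ χ := by
  obtain ⟨s, p, e₁, e₂⟩ := h
  exact ⟨s, t, p, n, e₁, e, e₂.trans (tensLeft_equiv p n)⟩

theorem of_plug_right {s : Bracketing (Formula 𝒜)}
    {m : dual (obj G₀ A) ⊗ srcObj (obj G₀) s ⟶ bot C} (e : φ ≋ ⟨.node (.leaf A) s, m⟩)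
    (h : Plug (v := .node (.leaf (.tens A B)) s) (v' := .leaf B)
      (absorbLeft (obj G₀ B) (hat m)) ψ χ) : TensOf A B φ ψ χ := by
  obtain ⟨t, p, e₁, e₂⟩ := h
  exact ⟨s, t, m, p, e, e₁, e₂.trans (tensRight_equiv m p)⟩

theorem plug_left (h : TensOf A B φ ψ χ) : ∃ (t : Bracketing (Formula 𝒜))
    (n : dual (obj G₀ B) ⊗ srcObj (obj G₀) t ⟶ bot C), ψ ≋ ⟨.node (.leaf B) t, n⟩ ∧
    Plug (v := .node (.leaf (.tens A B)) t) (v' := .leaf A)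
      (absorbRight (obj G₀ A) (hat n)) φ χ := by
  obtain ⟨s, t, m, n, e₁, e₂, e₃⟩ := h
  exact ⟨t, n, e₂, (plug_tensLeft m n).congr e₁.symm e₃.symm⟩

theorem plug_right (h : TensOf A B φ ψ χ) : ∃ (s : Bracketing (Formula 𝒜))
    (m : dual (obj G₀ A) ⊗ srcObj (obj G₀) s ⟶ bot C), φ ≋ ⟨.node (.leaf A) s, m⟩ ∧
    Plug (v := .node (.leaf (.tens A B)) s) (v' := .leaf B)
      (absorbLeft (obj G₀ B) (hat m)) ψ χ := by
  obtain ⟨s, t, m, n, e₁, e₂, e₃⟩ := h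
  exact ⟨s, m, e₁, (plug_tensRight m n).congr e₂.symm e₃.symm⟩

variable {v v' : Bracketing (Formula 𝒜)} {k : srcObj (obj G₀) v ⟶ srcObj (obj G₀) v'}
  {Γ : List (Formula 𝒜)}

/-- Substitutions in the left premise of a tensor rule. -/
theorem subst_left (h : TensOf A B φ ψ χ) (hk : Plug k φ φ') (hn : φ.leaves.Nodup)
    (hp : φ.leaves.Perm (A :: (v'.leaves ++ Γ))) : ∃ χ', Plug k χ χ' ∧ TensOf A B φ' ψ χ' := by
  obtain ⟨t, n, e, hl⟩ := h.plug_left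
  obtain ⟨χ', h₁, h₂⟩ := hl.comm hk hn (by simpa using hp)
  exact ⟨χ', h₁, of_plug_left e h₂⟩

/-- Substitutions in the right premise of a tensor rule. -/
theorem subst_right (h : TensOf A B φ ψ χ) (hk : Plug k ψ ψ') (hn : ψ.leaves.Nodup)
    (hp : ψ.leaves.Perm (B :: (v'.leaves ++ Γ))) : ∃ χ', Plug k χ χ' ∧ TensOf A B φ ψ' χ' := by
  obtain ⟨s, m, e, hl⟩ := h.plug_right
  obtain ⟨χ', h₁, h₂⟩ := hl.comm hk hn (by simpa using hp)
  exact ⟨χ', h₁, of_plug_right e h₂⟩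

theorem distinct_left (h : TensOf A B φ ψ χ) (hχ : Distinct χ.leaves) : Distinct φ.leaves := by
  obtain ⟨Γ, Δ, h₁, -, h₃⟩ := h.perm
  refine Distinct.perm (Distinct.of_idx (l := B.idx ++ idx Δ) (hχ.perm h₃) ?_) h₁.symm
  rw [List.perm_iff_count]; intro a; simp; omega

theorem distinct_right (h : TensOf A B φ ψ χ) (hχ : Distinct χ.leaves) : Distinct ψ.leaves := by
  obtain ⟨Γ, Δ, -, h₁, h₃⟩ := h.perm
  refine Distinct.perm (Distinct.of_idx (l := A.idx ++ idx Γ) (hχ.perm h₃) ?_) h₁.symm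
  rw [List.perm_iff_count]; intro a; simp; omega

end TensOf

theorem Rule.idx_subset {v v' : Bracketing (Formula 𝒜)}
    {k : srcObj (obj G₀) v ⟶ srcObj (obj G₀) v'} (hk : Rule link v v' k) {i : ℕ}
    (hi : i ∈ idx v'.leaves) : i ∈ idx v.leaves := by
  obtain ⟨l, hl⟩ := hk.idx_perm
  exact hl.mem_iff.2 (by simp [hi])

theorem exists_perm_of_subset {ι : Type*} {l l' : List ι} (hl : l.Nodup)
    (h : ∀ i ∈ l, i ∈ l') : ∃ r, l'.Perm (l ++ r) := by
  obtain ⟨l₀, h₁, h₂⟩ := List.subperm_of_subset hl h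
  obtain ⟨r, hr⟩ := h₂.exists_perm_append
  exact ⟨r, hr.trans (h₁.append_right r)⟩

theorem mem_idx_of_mem {Γ : List (Formula 𝒜)} {F : Formula 𝒜} (h : F ∈ Γ) {i : ℕ}
    (hi : i ∈ F.idx) : i ∈ idx Γ := mem_idx.2 ⟨F, h, hi⟩

theorem Extends.mem {F : Formula 𝒜} {φ χ : NetForm G₀} (h : Extends link F φ χ)
    (hF : F ∈ φ.leaves) : F ∈ χ.leaves := by
  induction h with
  | refl χ e => exact (Form.perm_of_equiv e).mem_iff.1 hF
  | step χ ω v v' k _ hk hF' hp ih =>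
    obtain ⟨Γ, p₁, p₂⟩ := hp.perm
    have := p₁.mem_iff.1 ih
    simp only [List.mem_append, hF', false_or] at this
    exact p₂.mem_iff.2 (by simp [this])

/-- A tensor rule can be moved to the end if the remaining formulas do not connect its two sides. -/
theorem Extends.tens_split {A B : Formula 𝒜} {φ₀ ψ₀ core χ : NetForm G₀}
    (h : Extends link (.tens A B) core χ) (h₀ : TensOf A B φ₀ ψ₀ core) (hφ₀ : Der link φ₀)
    (hψ₀ : Der link ψ₀) (hχ : Distinct χ.leaves) (P : ℕ → Prop)
    (hP : ∀ i ∈ idx χ.leaves, (P (link i) ↔ P i))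
    (hu : ∀ F ∈ χ.leaves, F ≠ .tens A B → Pure P F.idx)
    (hA : ∀ i ∈ A.idx, P i) (hB : ∀ i ∈ B.idx, ¬ P i) :
    ∃ φ ψ, Der link φ ∧ Der link ψ ∧ TensOf A B φ ψ χ ∧ (∀ i ∈ idx φ.leaves, P i) ∧
      ∀ i ∈ idx ψ.leaves, ¬ P i := by
  induction h with
  | refl χ e =>
    have h₁ := h₀.congr (.refl _) (.refl _) e
    refine ⟨φ₀, ψ₀, hφ₀, hψ₀, h₁, ?_⟩
    obtain ⟨Γ, Δ, pφ, pψ, pχ⟩ := h₁.perm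
    have hn := (hχ.perm pχ).nodup
    have pi := fun i => mem_idx_of_perm pχ (i := i)
    have pi₁ := fun i => mem_idx_of_perm pφ (i := i)
    have pi₂ := fun i => mem_idx_of_perm pψ (i := i)
    have pm := fun F => pχ.mem_iff (a := F)
    have pm₁ := fun F => pφ.mem_iff (a := F)
    have pm₂ := fun F => pψ.mem_iff (a := F)
    simp only [idx_cons, idx_append, Formula.idx, List.mem_append, List.mem_cons,
      List.nodup_cons] at pi pi₁ pi₂ pm pm₁ pm₂ hn
    obtain ⟨a, ha⟩ := exists_mem_idx A
    obtain ⟨b, hb⟩ := exists_mem_idx B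
    -- Each premise is connected by its links. The left one contains an index of `A`, where `P`
    -- holds, and the right one an index of `B`, where `P` fails.
    have q₁ := hφ₀.pure P (fun i hi => hP i ((pi i).2 (by rcases (pi₁ i).1 hi with h | h <;> tauto)))
      (fun F hF => by
        rcases (pm₁ F).1 hF with rfl | h
        · exact .inl hA
        · exact hu F ((pm F).2 (by tauto)) (by rintro rfl; tauto))
    have q₂ := hψ₀.pure P (fun i hi => hP i ((pi i).2 (by rcases (pi₂ i).1 hi with h | h <;> tauto)))
      (fun F hF => by
        rcases (pm₂ F).1 hF with rfl | h
        · exact .inr hB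
        · exact hu F ((pm F).2 (by tauto)) (by rintro rfl; tauto))
    exact ⟨q₁.resolve_right fun h => h a ((pi₁ a).2 (.inl ha)) (hA a ha),
      q₂.resolve_left fun h => hB b hb (h b ((pi₂ b).2 (.inl hb)))⟩
  | step χ ω v v' k hext hk hF hp ih =>
    obtain ⟨Γ, p₁, p₂⟩ := hp.perm
    have hχd := hk.distinct hp hχ
    have hω := (hχ.perm p₂).nodup
    have pm := fun F => p₂.mem_iff (a := F)
    have pm₁ := fun F => p₁.mem_iff (a := F)
    have pi := fun i => mem_idx_of_perm p₂ (i := i)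
    have pi₁ := fun i => mem_idx_of_perm p₁ (i := i)
    simp only [idx_append, List.mem_append] at pm pm₁ pi pi₁
    have hT : .tens A B ∈ χ.leaves := hext.mem (by
      obtain ⟨_, _, _, _, h⟩ := h₀.perm
      exact h.mem_iff.2 (by simp))
    have hTv : .tens A B ∉ v.leaves := by
      have : .tens A B ∈ Γ := ((pm₁ _).1 hT).resolve_left hF
      have := (List.nodup_append.1 hω).2.2
      grind
    -- The last rule lies on one side of `P`, so it can be performed before the tensor rule, in the
    -- premise on that side.
    have hv := hk.pure P (fun i hi => hP i ((pi i).2 (.inl hi)))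
      (fun F hF' => hu F ((pm F).2 (.inl hF')) (by rintro rfl; exact hTv hF'))
    have hv' : Pure P (idx v'.leaves) := hv.mono fun i hi => hk.idx_subset hi
    obtain ⟨φ, ψ, dφ, dψ, hT', hφP, hψP⟩ := ih hχd
      (fun i hi => hP i ((pi i).2 (((pi₁ i).1 hi).imp (fun h => hk.idx_subset h) id)))
      (fun F hF hne => by
        rcases (pm₁ F).1 hF with h | h
        · exact hv'.mono fun i hi => mem_idx_of_mem h hi
        · exact hu F ((pm F).2 (.inr h)) hne)
    obtain ⟨Γ', Δ', q₁, q₂, q₃⟩ := hT'.perm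
    have hv'n : v'.leaves.Nodup := (List.nodup_append.1 ((hχd.perm p₁).nodup)).1
    have hv's : ∀ F ∈ v'.leaves, F ∈ Γ' ∨ F ∈ Δ' := fun F h => by
      have := q₃.mem_iff.1 ((pm₁ F).2 (.inl h))
      simp only [List.mem_cons, List.mem_append] at this
      exact this.resolve_left (by rintro rfl; exact hF h)
    have hΓ' : ∀ F ∈ Γ', ∀ i ∈ F.idx, P i := fun F h i hi =>
      hφP i (mem_idx_of_mem (q₁.mem_iff.2 (by simp [h])) hi)
    have hΔ' : ∀ F ∈ Δ', ∀ i ∈ F.idx, ¬ P i := fun F h i hi =>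
      hψP i (mem_idx_of_mem (q₂.mem_iff.2 (by simp [h])) hi)
    rcases hv with hv | hv
    · have hs : ∀ F ∈ v'.leaves, F ∈ Γ' := fun F h => (hv's F h).resolve_right fun h' => by
        obtain ⟨i, hi⟩ := exists_mem_idx F
        exact hΔ' F h' i hi (hv i (hk.idx_subset (mem_idx_of_mem h hi)))
      obtain ⟨r, hr⟩ := exists_perm_of_subset hv'n hs
      have q₁' := q₁.trans (hr.cons A)
      obtain ⟨φ', hφ', -⟩ := Plug.exists_of_perm k (φ := φ) (Γ := A :: r)
        (q₁'.trans List.perm_middle.symm)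
      have hd := (hT'.distinct_left hχd).nodup
      obtain ⟨χ', e₁, e₂⟩ := hT'.subst_left hφ' hd q₁'
      refine ⟨φ', ψ, dφ.rule hk hφ', dψ, e₂.congr (.refl _) (.refl _)
        (e₁.unique hp (.refl _) hχd.nodup), fun i hi => ?_, hψP⟩
      have := (mem_idx_of_perm (hφ'.perm_of (q₁'.trans List.perm_middle.symm))).1 hi
      simp only [idx_append, List.mem_append] at this
      rcases this with h | h
      · exact hv i h
      · refine hφP i ((mem_idx_of_perm q₁').2 ?_)
        simp only [idx_append, idx_cons, List.mem_append] at h ⊢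
        tauto
    · have hs : ∀ F ∈ v'.leaves, F ∈ Δ' := fun F h => (hv's F h).resolve_left fun h' => by
        obtain ⟨i, hi⟩ := exists_mem_idx F
        exact hv i (hk.idx_subset (mem_idx_of_mem h hi)) (hΓ' F h' i hi)
      obtain ⟨r, hr⟩ := exists_perm_of_subset hv'n hs
      have q₁' := q₂.trans (hr.cons B)
      obtain ⟨ψ', hψ', -⟩ := Plug.exists_of_perm k (φ := ψ) (Γ := B :: r)
        (q₁'.trans List.perm_middle.symm)
      have hd := (hT'.distinct_right hχd).nodup
      obtain ⟨χ', e₁, e₂⟩ := hT'.subst_right hψ' hd q₁'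
      refine ⟨φ, ψ', dφ, dψ.rule hk hψ', e₂.congr (.refl _) (.refl _)
        (e₁.unique hp (.refl _) hχd.nodup), hφP, fun i hi => ?_⟩
      have := (mem_idx_of_perm (hψ'.perm_of (q₁'.trans List.perm_middle.symm))).1 hi
      simp only [idx_append, List.mem_append] at this
      rcases this with h | h
      · exact hv i h
      · refine hψP i ((mem_idx_of_perm q₁').2 ?_)
        simp only [idx_append, idx_cons, List.mem_append] at h ⊢
        tauto

theorem AxLink.equiv {φ ψ : NetForm G₀} (hφ : AxLink link φ) (hψ : AxLink link ψ)
    (h : φ.leaves.Perm ψ.leaves) : φ ≋ ψ := by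
  have hm := fun F => h.mem_iff (a := F)
  cases hφ with
  | atom a i j h₁ =>
    have m₁ := hm (.leaf (.pos a) i)
    have m₂ := hm (.leaf (.neg a) j)
    cases hψ with
    | atom b i' j' h₂ =>
      obtain ⟨rfl, rfl⟩ : a = b ∧ i = i' := by simpa [Form.leaves] using m₁
      obtain rfl : j = j' := by simpa [Form.leaves] using m₂
      exact Form.Equivalent.refl _
    | unit i' j' h₂ => simp [Form.leaves] at m₁
  | unit i j h₁ =>
    have m₁ := hm (.leaf .one i)
    have m₂ := hm (.leaf .bot j)
    cases hψ with
    | atom b i' j' h₂ => simp [Form.leaves] at m₁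
    | unit i' j' h₂ =>
      obtain rfl : i = i' := by simpa [Form.leaves] using m₁
      obtain rfl : j = j' := by simpa [Form.leaves] using m₂
      exact Form.Equivalent.refl _

/-- The axiom links of a derivable sequent stay within the sequent. -/
theorem Der.link_mem {φ : NetForm G₀} (h : Der link φ)
    (hl : ∀ i ∈ idx φ.leaves, link (link i) = i) : ∀ i ∈ idx φ.leaves, link i ∈ idx φ.leaves := by
  induction h with
  | ax φ h =>
    cases h with
    | atom a i j h =>
      have := hl i (by simp [Form.leaves])
      simp only [Form.leaves, Bracketing.leaves, List.cons_append, List.nil_append, idx_cons,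
        Formula.idx, idx_nil, List.mem_cons, List.not_mem_nil, or_false]
      grind
    | unit i j h =>
      have := hl i (by simp [Form.leaves])
      simp only [Form.leaves, Bracketing.leaves, List.cons_append, List.nil_append, idx_cons,
        Formula.idx, idx_nil, List.mem_cons, List.not_mem_nil, or_false]
      grind
  | par A B s m hm ih =>
    simpa [Form.leaves] using ih (by simpa [Form.leaves] using hl)
  | tens A B s t m n hm hn ihm ihn =>
    simp only [Form.leaves, Bracketing.leaves, List.cons_append, List.nil_append, idx_cons,
      Formula.idx, List.mem_append, idx_append] at hl ihm ihn ⊢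
    intro i hi
    have h₁ := fun h => ihm h i
    have h₂ := fun h => ihn h i
    grind
  | conv φ ψ e h ih =>
    have hp := Form.perm_of_equiv e
    intro i hi
    exact (mem_idx_of_perm hp).1 (ih (fun i hi => hl i ((mem_idx_of_perm hp).1 hi)) i
      ((mem_idx_of_perm hp).2 hi))

theorem Rule.exists_mem {v v' : Bracketing (Formula 𝒜)}
    {k : srcObj (obj G₀) v ⟶ srcObj (obj G₀) v'} (hk : Rule link v v' k) :
    ∃ F ∈ v.leaves, ∀ l i, F ≠ .leaf l i := by
  cases hk with
  | par A B => exact ⟨.par A B, by simp, by simp⟩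
  | tensLeft A B t n hn => exact ⟨.tens A B, by simp, by simp⟩
  | tensRight A B t n hn => exact ⟨.tens A B, by simp, by simp⟩

/-- The form of a derivable sequent depends only on the axiom links. -/
theorem Der.unique {φ : NetForm G₀} (h : Der link φ) : ∀ {ψ : NetForm G₀}, Der link ψ →
    Distinct φ.leaves → φ.leaves.Perm ψ.leaves → (∀ i ∈ idx φ.leaves, link (link i) = i) →
    φ ≋ ψ := by
  induction h with
  | ax φ hax =>
    intro ψ hψ hd hp hl
    have hleaf : ∀ F ∈ ψ.leaves, ∃ l i, F = .leaf l i :=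
      fun F hF => hax.leaf_of_mem (hp.mem_iff.2 hF)
    obtain ⟨F, hF⟩ : ∃ F, F ∈ φ.leaves := by cases hax <;> exact ⟨_, by simp [Form.leaves]; left; rfl⟩
    obtain ⟨l, i, rfl⟩ := hax.leaf_of_mem hF
    obtain ⟨core, hi, he⟩ := hψ.focus (hd.perm hp) (hp.mem_iff.1 hF)
    cases hi with
    | ax _ _ _ hax' =>
      cases he with
      | refl _ e => exact (hax.equiv hax' (hp.trans (Form.perm_of_equiv e).symm)).trans e
      | step χ _ v v' k _ hk _ hk' =>
        -- A further rule would leave a compound formula among the conclusions, but all of them are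
        -- leaves.
        obtain ⟨F, hF, hne⟩ := hk.exists_mem
        obtain ⟨Γ, _, q⟩ := hk'.perm
        obtain ⟨l, i, h⟩ := hleaf F (q.mem_iff.2 (by simp [hF]))
        exact (hne l i h).elim
  | par A B s m hm ih =>
    intro ψ hψ hd hp hl
    have hk := Rule.par (G₀ := G₀) (link := link) A B
    have hm' := plug_par m
    have hd' := hk.distinct hm' hd
    -- As par rules are invertible, the other derivation may be taken to end with the same par rule.
    obtain ⟨ψ₀, h₁, h₂⟩ := hψ.par_inv (A := A) (B := B) (hd.perm hp)
      (hp.mem_iff.1 (by simp [Form.leaves]))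
    obtain ⟨Γ, q₁, q₂⟩ := h₂.perm
    have hp' := hp.trans q₂
    simp only [Form.leaves, Bracketing.leaves, List.cons_append, List.nil_append,
      List.perm_cons] at hp' q₁
    refine hm'.unique h₂ (ih h₁ hd' ?_ ?_) hd'.nodup
    · exact ((hp'.cons B).cons A).trans q₁.symm
    · simpa [Form.leaves] using hl
  | tens A B s t m n hm hn ihm ihn =>
    intro ψ hψ hd hp hl
    have hT : TensOf A B (⟨.node (.leaf A) s, m⟩ : NetForm G₀) ⟨.node (.leaf B) t, n⟩ _ :=
      ⟨s, t, m, n, .refl _, .refl _, .refl _⟩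
    have hdm := hT.distinct_left hd
    have hdn := hT.distinct_right hd
    obtain ⟨core, hi, he⟩ := hψ.focus (hd.perm hp) (F := .tens A B)
      (hp.mem_iff.1 (by simp [Form.leaves]))
    have hlm := hm.link_mem (fun i hi => hl i (by
      simp only [Form.leaves, Bracketing.leaves, List.cons_append, List.nil_append, idx_cons,
        Formula.idx, List.mem_append, idx_append] at hi ⊢; tauto))
    have hln := hn.link_mem (fun i hi => hl i (by
      simp only [Form.leaves, Bracketing.leaves, List.cons_append, List.nil_append, idx_cons,
        Formula.idx, List.mem_append, idx_append] at hi ⊢; tauto))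
    have hl' := hl
    have hdisj : ∀ i ∈ idx (A :: s.leaves), i ∉ idx (B :: t.leaves) := by
      have : (idx (A :: s.leaves) ++ idx (B :: t.leaves)).Nodup := by
        refine (List.Perm.nodup_iff ?_).1 hd
        rw [List.perm_iff_count]; intro a; simp [Form.leaves]; omega
      exact fun i hi hi' => (List.nodup_append.1 this).2.2 i hi i hi' rfl
    have hmem : ∀ i, i ∈ idx ψ.leaves ↔ i ∈ idx (A :: s.leaves) ∨ i ∈ idx (B :: t.leaves) := by
      intro i
      rw [← mem_idx_of_perm hp]
      simp [Form.leaves]; tauto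
    replace hlm : ∀ i ∈ idx (A :: s.leaves), link i ∈ idx (A :: s.leaves) := hlm
    replace hln : ∀ i ∈ idx (B :: t.leaves), link i ∈ idx (B :: t.leaves) := hln
    have hs : ∀ F ∈ s.leaves, ∀ i ∈ F.idx, i ∈ idx (A :: s.leaves) := fun F hF i hi =>
      mem_idx_of_mem (by simp [hF]) hi
    have ht : ∀ F ∈ t.leaves, ∀ i ∈ F.idx, i ∉ idx (A :: s.leaves) := fun F hF i hi h =>
      hdisj i h (mem_idx_of_mem (by simp [hF]) hi)
    cases hi with
    | ax _ _ hmem hax =>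
      obtain ⟨l, i, h⟩ := hax.leaf_of_mem hmem
      cases h
    | tens _ _ s' t' m' n' hm' hn' =>
      -- The predicate is membership in the left premise of the given derivation, which the axiom
      -- links respect by `Der.link_mem`. Hence the other derivation can be rearranged to end with
      -- the same tensor rule and the same splitting of the context.
      obtain ⟨φ₁, ψ₁, d₁, d₂, hT', hP₁, hP₂⟩ := he.tens_split
        ⟨s', t', m', n', .refl _, .refl _, .refl _⟩ hm' hn' (hd.perm hp)
        (fun i => i ∈ idx (A :: s.leaves)) (fun i hi => by grind)
        (fun F hF hne => by
          have := hp.mem_iff.2 hF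
          simp only [Form.leaves, Bracketing.leaves, List.cons_append, List.nil_append,
            List.mem_cons, List.mem_append, hne, false_or] at this
          exact this.imp (hs F) (ht F))
        (fun i hi => by simp [hi]) (fun i hi h => hdisj i h (by simp [hi]))
      obtain ⟨Γ, Δ, q₁, q₂, q₃⟩ := hT'.perm
      have q := hp.trans q₃
      simp only [Form.leaves, Bracketing.leaves, List.cons_append, List.nil_append,
        List.perm_cons] at q
      have hN : (s.leaves ++ t.leaves).Nodup := (List.nodup_cons.1 hd.nodup).2
      have hN' := q.nodup_iff.1 hN
      have hΓ : ∀ F ∈ Γ, ∀ i ∈ F.idx, i ∈ idx (A :: s.leaves) := fun F h i hi =>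
        hP₁ i (mem_idx_of_mem (q₁.mem_iff.2 (by simp [h])) hi)
      have hΔ : ∀ F ∈ Δ, ∀ i ∈ F.idx, i ∉ idx (A :: s.leaves) := fun F h i hi =>
        hP₂ i (mem_idx_of_mem (q₂.mem_iff.2 (by simp [h])) hi)
      have hmq := fun F => q.mem_iff (a := F)
      simp only [List.mem_append] at hmq
      have e₁ : s.leaves.Perm Γ := (List.perm_ext_iff_of_nodup (List.nodup_append.1 hN).1
        (List.nodup_append.1 hN').1).2 fun F => by
          obtain ⟨i, hi⟩ := exists_mem_idx F
          exact ⟨fun h => ((hmq F).1 (.inl h)).resolve_right fun h' => hΔ F h' i hi (hs F h i hi),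
            fun h => ((hmq F).2 (.inl h)).resolve_right fun h' => ht F h' i hi (hΓ F h i hi)⟩
      have e₂ : t.leaves.Perm Δ := (List.perm_ext_iff_of_nodup (List.nodup_append.1 hN).2.1
        (List.nodup_append.1 hN').2.1).2 fun F => by
          obtain ⟨i, hi⟩ := exists_mem_idx F
          exact ⟨fun h => ((hmq F).1 (.inr h)).resolve_left fun h' => ht F h i hi (hΓ F h' i hi),
            fun h => ((hmq F).2 (.inr h)).resolve_left fun h' => hΔ F h i hi (hs F h' i hi)⟩
      refine hT.unique hT' hdm.nodup hdn.nodup (ihm d₁ hdm ((e₁.cons A).trans q₁.symm) ?_)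
        (ihn d₂ hdn ((e₂.cons B).trans q₂.symm) ?_)
      · intro i hi
        exact hl i ((mem_idx_of_perm hp).2 ((hmem i).2 (.inl hi)))
      · intro i hi
        exact hl i ((mem_idx_of_perm hp).2 ((hmem i).2 (.inr hi)))
  | conv φ φ' e h ih =>
    intro ψ hψ hd hp hl
    have q := Form.perm_of_equiv e
    exact e.symm.trans (ih hψ (hd.perm q.symm) (q.trans hp)
      fun i hi => hl i ((mem_idx_of_perm q).1 hi))

end TensorForms

/-! ### Pairings -/

namespace StarAutonomous

variable {C : Type u} [Category.{v} C] [MonoidalCategory C] [SymmetricCategory C]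
  [StarAutonomous C]

/-- The arrow that decomposes a form on `(A ⊗ B) ⊗ (B' ⅋ A')` into forms on `A ⊗ A'` and
`B ⊗ B'`. -/
def splitPair (A A' B B' : C) :
    dual (A ⊗ A') ⊗ dual (B ⊗ B') ⟶ dual ((A ⊗ B) ⊗ dual (dual A' ⊗ dual B')) :=
  transpose ((α_ _ _ _).inv ≫
    (tensorμ _ _ _ _ ≫ (absorbLeft A' (𝟙 A) ⊗ₘ absorbLeft B' (𝟙 B))) ▷ dual (dual A' ⊗ dual B') ≫
      coname (dual A' ⊗ dual B'))

theorem absorbLeft_eq {A B S : C} (h : S ⟶ A) :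
    absorbLeft B h = dual (A ⊗ B) ◁ h ≫ absorbLeft B (𝟙 A) := by
  conv_lhs => rw [← Category.comp_id h, absorbLeft_comp]

/-- The forms on `A ⊗ A'` and `B ⊗ B'` absorb `f` and `g`. What remains is an arrow into `A'^⊥ ⊗
B'^⊥`, which is paired with `n`. -/
theorem splitPair_ev {A A' B B' S V T : C} (f : S ⟶ A) (g : V ⟶ B) (n : T ⟶ dual (dual A' ⊗ dual B')) :
    splitPair A A' B B' ▷ ((S ⊗ V) ⊗ T) ≫ unhat ((f ⊗ₘ g) ⊗ₘ n) =
      (α_ _ _ _).inv ≫ tensorμ _ _ _ _ ▷ T ≫ (absorbLeft A' f ⊗ₘ absorbLeft B' g) ▷ T ≫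
        (dual A' ⊗ dual B') ◁ n ≫ coname (dual A' ⊗ dual B') := by
  have hμ : tensorμ (dual (A ⊗ A')) (dual (B ⊗ B')) S V ≫
      (absorbLeft A' f ⊗ₘ absorbLeft B' g) = (dual (A ⊗ A') ⊗ dual (B ⊗ B')) ◁ (f ⊗ₘ g) ≫
        tensorμ _ _ _ _ ≫ (absorbLeft A' (𝟙 A) ⊗ₘ absorbLeft B' (𝟙 B)) := by
    rw [absorbLeft_eq f, absorbLeft_eq g, ← tensorHom_comp_tensorHom]
    have := tensorμ_natural (𝟙 (dual (A ⊗ A'))) (𝟙 (dual (B ⊗ B'))) f g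
    simp only [id_tensorHom, tensorHom_id, id_whiskerRight] at this
    simp only [← Category.assoc]
    rw [← this]
  rw [unhat, ← whisker_exchange_assoc, splitPair, transpose_ev, ← comp_whiskerRight_assoc, hμ]
  have hn : whiskerRight (C := C) ((dual (A ⊗ A') ⊗ dual (B ⊗ B')) ◁ (f ⊗ₘ g) ≫
        tensorμ _ _ _ _ ≫ (absorbLeft A' (𝟙 A) ⊗ₘ absorbLeft B' (𝟙 B))) T ≫
          (dual A' ⊗ dual B') ◁ n =
        ((dual (A ⊗ A') ⊗ dual (B ⊗ B')) ◁ (f ⊗ₘ g)) ▷ T ≫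
          ((dual (A ⊗ A') ⊗ dual (B ⊗ B')) ⊗ (A ⊗ B)) ◁ n ≫
        (tensorμ _ _ _ _ ≫ (absorbLeft A' (𝟙 A) ⊗ₘ absorbLeft B' (𝟙 B))) ▷ dual (dual A' ⊗ dual B') := by
    rw [whisker_exchange, comp_whiskerRight, Category.assoc]
  rw [reassoc_of% hn]
  simp [MonoidalCategory.tensorHom_def (f ⊗ₘ g) n]

/-- This is `splitPair_ev` in the shape of substitutions, as `Der.split` needs it. The left side
comes from a tensor rule with main formula `(A ⊗ B) ⊗ (B' ⅋ A')`, the right side from tensor rules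
for `A ⊗ A'` and `B ⊗ B'`. The interchange is a variable `μ`, to be matched with
`Structural.interchange`. -/
theorem splitPair_absorb {A A' B B' S V T : C} (f : S ⟶ A) (g : V ⟶ B)
    (n : T ⟶ dual (dual A' ⊗ dual B')) {μ : (dual (A ⊗ A') ⊗ dual (B ⊗ B')) ⊗ S ⊗ V ⟶
      (dual (A ⊗ A') ⊗ S) ⊗ dual (B ⊗ B') ⊗ V} (hμ : μ = tensorμ _ _ _ _) :
    (splitPair A A' B B' ▷ T ≫ absorbRight (A ⊗ B) n) ▷ (S ⊗ V) ≫ unhat (f ⊗ₘ g) =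
      ((((α_ _ _ _).hom ≫ (𝟙 (dual (A ⊗ A') ⊗ dual (B ⊗ B')) ⊗ₘ (β_ T (S ⊗ V)).hom)) ≫
        (α_ _ _ _).inv) ≫ (μ ⊗ₘ 𝟙 T)) ≫
      ((dual (A ⊗ A') ⊗ S) ◁ absorbLeft B' g ≫ absorbLeft A' f ▷ dual B' ≫
        𝟙 (dual A' ⊗ dual B')) ▷ T ≫
        (dual A' ⊗ dual B') ◁ n ≫ coname (dual A' ⊗ dual B') := by
  have h := splitPair_ev (A' := A') (B' := B') f g n
  rw [hμ, comp_whiskerRight, Category.assoc, absorbRight_unhat,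
    associator_naturality_left_assoc, ← whisker_exchange_assoc, h, Category.comp_id,
    ← tensorHom_def', id_tensorHom, tensorHom_id]
  simp only [Category.assoc]

theorem bidual_unhat {P T X : C} (w : X ⟶ P) (n : T ⟶ dual P) :
    (w ≫ bidual P) ▷ T ≫ unhat n = (w ⊗ₘ 𝟙 T) ≫ P ◁ n ≫ coname P := by
  rw [unhat, ← whisker_exchange_assoc, comp_whiskerRight, Category.assoc, bidual_ev, tensorHom_id,
    whisker_exchange_assoc]

theorem parIso_unhat {A B T : C} (n : T ⟶ dual (dual B ⊗ dual A)) :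
    (parIso A B).hom ▷ T ≫ unhat (A := par A B) n = ((β_ (dual A) (dual B)).hom ⊗ₘ 𝟙 T) ≫
      (dual B ⊗ dual A) ◁ n ≫ coname (dual B ⊗ dual A) :=
  bidual_unhat _ n

/-- The pairing of `A ⊗ B` and `B' ⅋ A'` that belongs to pairings of `A`, `A'` and `B`, `B'`. -/
def tensPairing {A A' B B' : C} (p : A ⊗ A' ⟶ bot C) (q : B ⊗ B' ⟶ bot C) :
    (A ⊗ B) ⊗ dual (dual A' ⊗ dual B') ⟶ bot C :=
  (transpose p ⊗ₘ transpose q) ▷ dual (dual A' ⊗ dual B') ≫ coname (dual A' ⊗ dual B')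

theorem name_absorbLeft {A A' : C} (p : A ⊗ A' ⟶ bot C) :
    name p ▷ A ≫ absorbLeft A' (𝟙 A) = (λ_ A).hom ≫ transpose p := by
  apply ev_injective
  rw [comp_whiskerRight, comp_whiskerRight, Category.assoc, Category.assoc, absorbLeft,
    transpose_ev, transpose_ev, id_whiskerRight, MonoidalCategory.whiskerLeft_id,
    Category.id_comp, associator_naturality_left_assoc, name_ev]
  simp

/-- By `name_absorbLeft` the elements of `p` and `q` act as their transposes, and the pairing of `A
⊗ B` with `B' ⅋ A'` is built from these. So closing the two small cuts after `splitPair` closes the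
compound cut. -/
theorem name_splitPair {A A' B B' : C} (p : A ⊗ A' ⟶ bot C) (q : B ⊗ B' ⟶ bot C) :
    (name p ⊗ₘ name q) ≫ splitPair A A' B B' = (λ_ _).hom ≫ name (tensPairing p q) := by
  apply ev_injective
  rw [comp_whiskerRight, comp_whiskerRight, Category.assoc, Category.assoc, splitPair,
    transpose_ev, name_ev, tensPairing, associator_inv_naturality_left_assoc,
    ← comp_whiskerRight_assoc]
  have := tensorμ_natural (name p) (name q) (𝟙 A) (𝟙 B)
  rw [id_tensorHom_id, tensorHom_id] at this
  rw [reassoc_of% this, tensorHom_id, tensorHom_id, tensorHom_comp_tensorHom, name_absorbLeft,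
    name_absorbLeft, ← tensorHom_comp_tensorHom]
  have h : tensorμ (𝟙_ C) (𝟙_ C) A B ≫ ((λ_ A).hom ⊗ₘ (λ_ B).hom) =
      (λ_ (𝟙_ C)).hom ▷ (A ⊗ B) ≫ (λ_ (A ⊗ B)).hom := by
    -- Two successive interchanges cancel by symmetry; `leftUnitor_monoidal` expresses the unitor of
    -- `A ⊗ B` through the second one.
    have hμ : tensorμ (𝟙_ C) (𝟙_ C) A B ≫ tensorμ (𝟙_ C) A (𝟙_ C) B = 𝟙 _ := by
      have h : (β_ (𝟙_ C) A).hom ▷ B ≫ (β_ A (𝟙_ C)).hom ▷ B = 𝟙 _ := by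
        rw [← comp_whiskerRight, SymmetricCategory.symmetry, id_whiskerRight]
      simp only [tensorμ, Category.assoc, Iso.inv_hom_id_assoc, ← whiskerLeft_comp_assoc,
        Iso.hom_inv_id_assoc, reassoc_of% h]
      simp
    rw [leftUnitor_monoidal, reassoc_of% hμ]
  rw [reassoc_of% h]
  simp

theorem comp_coname {A B : C} (h : A ⟶ B) :
    h ▷ dual B ≫ coname B = A ◁ dualMap h ≫ coname A := by
  rw [coname, coname, BraidedCategory.braiding_naturality_left_assoc,
    BraidedCategory.braiding_naturality_right_assoc, dualMap_ev]

theorem dualMap_comp {A B D : C} (f : A ⟶ B) (g : B ⟶ D) :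
    dualMap (f ≫ g) = dualMap g ≫ dualMap f :=
  (dualFunctor C).map_comp g.op f.op

/-- The pairing that belongs to an arrow `A' ⟶ A^⊥`. -/
def pairing {A A' : C} (d : A' ⟶ dual A) : A ⊗ A' ⟶ bot C := A ◁ d ≫ coname A

theorem transpose_pairing {A A' : C} (d : A' ⟶ dual A) :
    transpose (pairing d) = bidual A ≫ dualMap d := by
  apply ev_injective
  rw [transpose_ev, comp_whiskerRight, Category.assoc, dualMap_ev, ← whisker_exchange_assoc,
    bidual_ev, pairing]

/-- The arrow on the right is the comparison `G(A^⊥) ⟶ G(A)^⊥` in the case `tensPar`, with `parMap`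
unfolded. Hence the pairing produced by `splitPair` is the interpretation of the compound cut. -/
theorem tensPairing_pairing {A A' B B' : C} (d : A' ⟶ dual A) (e : B' ⟶ dual B) :
    tensPairing (pairing d) (pairing e) =
      pairing (dualMap (dualMap d ⊗ₘ dualMap e) ≫ dualMap (bidual A ⊗ₘ bidual B)) := by
  rw [tensPairing, transpose_pairing, transpose_pairing, ← dualMap_comp,
    tensorHom_comp_tensorHom, pairing]
  exact comp_coname _

theorem unhat_swap {L R S T : C} (f : S ⟶ L) (g : T ⟶ R) :
    dualMap (β_ L R).hom ▷ (S ⊗ T) ≫ unhat (f ⊗ₘ g) =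
      dual (R ⊗ L) ◁ (β_ S T).hom ≫ unhat (g ⊗ₘ f) := by
  rw [unhat, unhat, ← whisker_exchange_assoc, dualMap_ev, ← whiskerLeft_comp_assoc,
    ← whiskerLeft_comp_assoc, BraidedCategory.braiding_naturality]

theorem name_dualMap {A B : C} (p : B ⟶ bot C) (h : A ⟶ B) : name p ≫ dualMap h = name (h ≫ p) := by
  apply ev_injective
  rw [comp_whiskerRight, Category.assoc, dualMap_ev, ← whisker_exchange_assoc, name_ev, name_ev]
  simp

/-- The counterpart for `parTens`: the cut is reversed, and so are the two smaller ones, which leads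
back to a tensor against a par. -/
theorem swap_tensPairing {A A' B B' : C} (d : A' ⟶ dual A) (e : B' ⟶ dual B) :
    (β_ (dual (dual B ⊗ dual A)) (B' ⊗ A')).hom ≫ tensPairing ((β_ B' B).hom ≫ pairing e)
      ((β_ A' A).hom ≫ pairing d) =
        pairing ((e ⊗ₘ d) ≫ bidual (dual B ⊗ dual A)) := by
  have h {A A' : C} (d : A' ⟶ dual A) : transpose ((β_ A' A).hom ≫ pairing d) = d := by
    apply ev_injective
    rw [transpose_ev, pairing, coname, ← BraidedCategory.braiding_naturality_left_assoc,
      SymmetricCategory.symmetry_assoc]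
  rw [tensPairing, h, h, pairing, MonoidalCategory.whiskerLeft_comp, Category.assoc, coname, coname,
    BraidedCategory.braiding_naturality_left_assoc, BraidedCategory.braiding_naturality_right_assoc,
    SymmetricCategory.symmetry_assoc, BraidedCategory.braiding_naturality_right_assoc, bidual_ev,
    coname, BraidedCategory.braiding_naturality_left_assoc, SymmetricCategory.symmetry_assoc]

/-- Cutting with the pairing of `d` composes `n` with `d`: the triangle identity behind the removal
of a cut between leaves. -/
theorem name_absorbRight {A B T : C} (d : B ⟶ dual A) (n : T ⟶ B) :
    name (pairing d) ▷ T ≫ absorbRight A n = (λ_ T).hom ≫ n ≫ d := by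
  apply ev_injective
  rw [comp_whiskerRight, comp_whiskerRight, Category.assoc, Category.assoc, absorbRight,
    transpose_ev, associator_naturality_left_assoc, ← whisker_exchange_assoc, name_ev, pairing,
    coname, BraidedCategory.braiding_naturality_right_assoc]
  simp

end StarAutonomous

/-! ### Cut elimination steps on forms -/

/-- The middle-four interchange. -/
def Structural.interchange {ι : Type u} (a b c d : Bracketing ι) :
    Structural (.node (.node a b) (.node c d)) (.node (.node a c) (.node b d)) :=
  (Structural.assoc _ _ _).trans (((Structural.refl a).tensor
    ((Structural.assoc b c d).symm.trans (((Structural.braid b c).tensor (.refl d)).trans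
      (.assoc c b d)))).trans (Structural.assoc _ _ _).symm)

theorem Structural.eval_interchange {C : Type u} [Category.{v} C] [MonoidalCategory C]
    [SymmetricCategory C] {ι : Type w} (Y : ι → C) (a b c d : Bracketing ι) :
    ((interchange a b c d).eval Y).hom =
      tensorμ (tensObj Y a) (tensObj Y b) (tensObj Y c) (tensObj Y d) := by
  simp [interchange, Structural.eval, tensorμ, tensObj]

section CutSteps

variable {𝒜 : Type w} {C : Type u} [Category.{v} C] [MonoidalCategory C] [SymmetricCategory C]
  [StarAutonomous C] {G₀ : 𝒜 → C} {link : ℕ → ℕ}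

/-- Substitutions are unique up to equivalence, so a substitution for `F` has to be verified only at
the point where `F` is introduced. -/
theorem Extends.der_subst {F : Formula 𝒜} {φ χ φ' χ' : NetForm G₀} (h : Extends link F φ χ)
    (hχ : Distinct χ.leaves) {v : Bracketing (Formula 𝒜)}
    {j : srcObj (obj G₀) v ⟶ srcObj (obj G₀) (.leaf F)} (hj : Plug j φ φ') (hφ' : Der link φ')
    (hp : Plug j χ χ') : Der link χ' := by
  obtain ⟨χ'', h₁, h₂⟩ := h.subst hχ hj hφ'
  exact h₂.congr (h₁.unique hp (.refl _) hχ.nodup)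

theorem Extends.idx_perm {F : Formula 𝒜} {φ χ : NetForm G₀} (h : Extends link F φ χ) :
    ∃ l, (idx χ.leaves).Perm (idx φ.leaves ++ l) := by
  induction h with
  | refl χ e => exact ⟨[], by simpa using OrdinaryNets.idx_perm (Form.perm_of_equiv e).symm⟩
  | step χ ω v v' k _ hk hF' hp ih =>
    obtain ⟨Γ, p₁, p₂⟩ := hp.perm
    obtain ⟨l, hl⟩ := hk.idx_perm
    obtain ⟨l', hl'⟩ := ih
    have q₁ := OrdinaryNets.idx_perm p₁
    have q₂ := OrdinaryNets.idx_perm p₂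
    refine ⟨l ++ l', ?_⟩
    rw [List.perm_iff_count] at hl hl' q₁ q₂ ⊢
    intro a
    have h₁ := hl a
    have h₂ := hl' a
    have h₃ := q₁ a
    have h₄ := q₂ a
    simp only [idx_append, List.count_append] at h₁ h₂ h₃ h₄ ⊢
    omega

theorem Der.tens_focus {χ : NetForm G₀} (h : Der link χ) (hχ : Distinct χ.leaves)
    {A B : Formula 𝒜} (hF : .tens A B ∈ χ.leaves) :
    ∃ (s t : Bracketing (Formula 𝒜)) (m : dual (obj G₀ A) ⊗ srcObj (obj G₀) s ⟶ bot C)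
      (n : dual (obj G₀ B) ⊗ srcObj (obj G₀) t ⟶ bot C), Der link ⟨.node (.leaf A) s, m⟩ ∧
      Der link ⟨.node (.leaf B) t, n⟩ ∧ Extends link (.tens A B)
        ⟨.node (.leaf (.tens A B)) (.node s t), unhat (hat m ⊗ₘ hat n)⟩ χ := by
  obtain ⟨core, hi, he⟩ := h.focus hχ hF
  cases hi with
  | ax _ _ hmem hax =>
    obtain ⟨l, i, h⟩ := hax.leaf_of_mem hmem
    cases h
  | tens _ _ s t m n hm hn => exact ⟨s, t, m, n, hm, hn, he⟩

theorem Plug.mem {v v' : Bracketing (Formula 𝒜)} {k : srcObj (obj G₀) v ⟶ srcObj (obj G₀) v'}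
    {φ χ : NetForm G₀} (h : Plug k φ χ) {F : Formula 𝒜} (hF : F ∈ v'.leaves) : F ∈ φ.leaves := by
  obtain ⟨Γ, p, -⟩ := h.perm
  exact p.mem_iff.2 (by simp [hF])

/-- The two factors of a tensor can be exchanged. -/
theorem Der.swap {χ χ' : NetForm G₀} (h : Der link χ) (hχ : Distinct χ.leaves) {L R : Formula 𝒜}
    (hp : Plug (Y := fun A => dual (obj G₀ A)) (v := .leaf (.tens R L)) (v' := .leaf (.tens L R))
      (dualMap (β_ (obj G₀ L) (obj G₀ R)).hom) χ χ') : Der link χ' := by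
  obtain ⟨s, t, m, n, hm, hn, he⟩ := h.tens_focus (A := L) (B := R) hχ (hp.mem (by simp))
  refine he.der_subst hχ (.mk _) ?_ hp
  refine (Der.tens R L t s n m hn hm).congr (.symm (Form.equiv_mk (.tensor (.refl _) (.braid s t)) ?_))
  exact (unhat_swap (hat m) (hat n)).trans (congrArg (· ≫ _) (id_tensorHom _ _).symm)

/-- A tensor of a tensor and a par can be decomposed. -/
theorem Der.split {χ χ' : NetForm G₀} (h : Der link χ) (hχ : Distinct χ.leaves)
    {A A' B B' : Formula 𝒜}
    (hp : Plug (v := .node (.leaf (.tens A A')) (.leaf (.tens B B')))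
      (v' := .leaf (.tens (.tens A B) (.par B' A')))
      (splitPair (obj G₀ A) (obj G₀ A') (obj G₀ B) (obj G₀ B')) χ χ') : Der link χ' := by
  obtain ⟨s, t, m, n, hm, hn, he⟩ := h.tens_focus (A := .tens A B) (B := .par B' A') hχ
    (hp.mem (by simp))
  obtain ⟨l, hl⟩ := he.idx_perm
  have hT : TensOf (.tens A B) (.par B' A') (⟨.node (.leaf (.tens A B)) s, m⟩ : NetForm G₀)
    ⟨.node (.leaf (.par B' A')) t, n⟩ _ := ⟨s, t, m, n, .refl _, .refl _, .refl _⟩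
  have hd := he.distinct hχ
  have hdm := hT.distinct_left hd
  have hdn := hT.distinct_right hd
  -- It suffices to treat the form in which the outer tensor is introduced; in its left premise, the
  -- reduction is repeated for `A ⊗ B`.
  refine he.der_subst hχ (.mk _) ?_ hp
  obtain ⟨S, V, f, g, hf, hg, he'⟩ := hm.tens_focus (A := A) (B := B) hdm (by simp [Form.leaves])
  obtain ⟨l', hl'⟩ := he'.idx_perm
  have hall : (A.idx ++ A'.idx ++ B.idx ++ B'.idx ++ idx S.leaves ++ idx V.leaves ++
      idx t.leaves).Nodup := by
    have h₁ : (idx (Form.leaves (⟨.node (.leaf (.tens (.tens A B) (.par B' A'))) (.node s t),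
      unhat (hat m ⊗ₘ hat n)⟩ : NetForm G₀))).Nodup := hd
    refine (List.nodup_append.1 ((List.Perm.nodup_iff (l₂ := _ ++ l') ?_).1 h₁)).1
    rw [List.perm_iff_count] at hl' ⊢
    intro a
    have h₁ := hl' a
    simp only [Form.leaves, Bracketing.leaves, idx_append, List.count_append, idx_cons,
      Formula.idx, List.cons_append, List.nil_append] at h₁ ⊢
    omega
  refine he'.der_subst hdm (.mk _) ?_ ((plug_tensLeft m n).comp_left (.mk _) hd.nodup)
  -- `w` is the premise of the par rule with its arguments in the order `A'`, `B'`; the change of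
  -- order cancels the braiding inside `parIso`.
  let w : (dual (obj G₀ A') ⊗ dual (obj G₀ B')) ⊗ srcObj (obj G₀) t ⟶ bot C :=
    (dual (obj G₀ A') ⊗ dual (obj G₀ B')) ◁ hat n ≫ coname (dual (obj G₀ A') ⊗ dual (obj G₀ B'))
  obtain ⟨ψ, hψ, hψn⟩ := hn.par_inv (A := B') (B := A') hdn (by simp [Form.leaves])
  have hψw : ψ ≋ (⟨.node (.node (.leaf A') (.leaf B')) t, w⟩ : NetForm G₀) := by
    have := (hψn.symm (parIso (obj G₀ B') (obj G₀ A')).hom_inv_id).equiv_at hdn.nodup (.refl _)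
    refine this.trans (Form.equiv_mk (.tensor (.braid _ _) (.refl _)) ?_)
    have h := parIso_unhat (A := obj G₀ B') (B := obj G₀ A') (hat n)
    exact (congrArg (_ ≫ ·) (unhat_hat n).symm).trans h
  have hw : Der link (⟨.node (.node (.leaf A') (.leaf B')) t, w⟩ : NetForm G₀) := hψ.congr hψw
  -- Starting from an identity substitution for the pair `A'`, `B'`, the two tensor rules that
  -- follow are computed as one substitution for this pair.
  have hw₀ : Plug (v := .node (.leaf A') (.leaf B')) (v' := .node (.leaf A') (.leaf B'))
      (𝟙 (dual (obj G₀ A') ⊗ dual (obj G₀ B')))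
      (⟨.node (.node (.leaf A') (.leaf B')) t, w⟩ : NetForm G₀)
      ⟨.node (.node (.leaf A') (.leaf B')) t, w⟩ :=
    ⟨t, w, .refl _, Form.equiv_of_eq (by
      exact (by simp : w = 𝟙 (dual (obj G₀ A') ⊗ dual (obj G₀ B')) ▷ _ ≫ w))⟩
  -- `A'` is replaced by `A ⊗ A'` with the context `S`, then `B'` by `B ⊗ B'` with the context `V`:
  -- two tensor rules take the place of two tensor rules and a par rule.
  obtain ⟨w₁, hw₁, p₁⟩ := Plug.exists_of_perm (v := .node (.leaf (Formula.tens A A')) S) (v' := .leaf A')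
    (φ := (⟨.node (.node (.leaf A') (.leaf B')) t, w⟩ : NetForm G₀))
    (absorbLeft (obj G₀ A') (hat f)) (Γ := B' :: t.leaves) (by simp [Form.leaves])
  obtain ⟨w₂, hw₂, p₂⟩ := Plug.exists_of_perm (v := .node (.leaf (Formula.tens B B')) V) (v' := .leaf B')
    (φ := w₁) (absorbLeft (obj G₀ B') (hat g)) (Γ := .tens A A' :: S.leaves ++ t.leaves)
    (p₁.trans (by simpa using List.perm_middle (l₁ := .tens A A' :: S.leaves)))
  have hn₀ : Distinct (Form.leaves (⟨.node (.node (.leaf A') (.leaf B')) t, w⟩ : NetForm G₀)) := by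
    refine (List.nodup_append.1 ((List.Perm.nodup_iff
      (l₂ := _ ++ (A.idx ++ B.idx ++ idx S.leaves ++ idx V.leaves)) ?_).1 hall)).1
    rw [List.perm_iff_count]
    intro a
    simp only [Form.leaves, Bracketing.leaves, List.count_append, idx_cons,
      List.cons_append, List.nil_append]
    omega
  have hn₁ : Distinct (Form.leaves w₁) := by
    refine Distinct.perm ((List.nodup_append.1 ((List.Perm.nodup_iff
      (l₂ := _ ++ (B.idx ++ idx V.leaves)) ?_).1 hall)).1) p₁.symm
    rw [List.perm_iff_count]
    intro a
    simp only [Bracketing.leaves, idx_append, List.count_append, idx_cons,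
      Formula.idx, List.cons_append, List.nil_append]
    omega
  have hc := ((hw₀.comp_left hw₁ hn₀.nodup).comp_right hw₂ hn₁.nodup).equiv_at hn₀.nodup (.refl _)
  have dw₂ : Der link w₂ :=
    (hw.rule (.tensRight A A' S f hf) hw₁).rule (.tensRight B B' V g hg) hw₂
  refine (dw₂.congr hc).congr (.symm (Form.equiv_mk ((((Structural.assoc _ _ _).trans
    (.tensor (.refl _) (.braid _ _))).trans (.symm (.assoc _ _ _))).trans
      (.tensor (.interchange _ _ _ _) (.refl _))) ?_))
  exact splitPair_absorb (hat f) (hat g) (hat n) (Structural.eval_interchange _ _ _ _ _)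

end CutSteps

theorem whisker_eq_tensorHom {C : Type u} [Category.{v} C] [MonoidalCategory C]
    {A A' B B' W : C} (e : A ⟶ A') (e' : B ⟶ B') (j : A' ⊗ B' ⟶ W) :
    A ◁ e' ≫ e ▷ B' ≫ j = (e ⊗ₘ e') ≫ j := by
  rw [tensorHom_def', Category.assoc]

/-! ### Steps on compound cuts. -/

section Cuts

variable {𝒜 : Type w} {C : Type u} [Category.{v} C] [MonoidalCategory C] [SymmetricCategory C]
  [StarAutonomous C] {G₀ : 𝒜 → C} {link link' : ℕ → ℕ}

variable (G₀) in
/-- The element of `(G(B) ⊗ G(B^⊥))^⊥` that belongs to a cut. -/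
def cutName (c : Cut 𝒜) : srcObj (obj G₀) .empty ⟶ srcObj (obj G₀) (.leaf c.toTens) :=
  name (cutMap G₀ c)

theorem Distinct.of_idx_perm {Γ Δ : List (Formula 𝒜)} (hΓ : Distinct Γ)
    (h : (idx Γ).Perm (idx Δ)) : Distinct Δ := h.nodup_iff.1 hΓ

theorem Plug.of_eq {v v' : Bracketing (Formula 𝒜)} {k k' : srcObj (obj G₀) v ⟶ srcObj (obj G₀) v'}
    {φ χ : NetForm G₀} (h : Plug k φ χ) (e : k = k') : Plug k' φ χ := e ▸ h

/-- Two successive substitutions of elements. -/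
theorem Plug.elements {v' a b : Bracketing (Formula 𝒜)}
    {j : srcObj (obj G₀) (.node a b) ⟶ srcObj (obj G₀) v'}
    {e : 𝟙_ C ⟶ srcObj (obj G₀) a} {e' : 𝟙_ C ⟶ srcObj (obj G₀) b} {d : 𝟙_ C ⟶ srcObj (obj G₀) v'}
    (he : (e ⊗ₘ e') ≫ j = (λ_ _).hom ≫ d) {χ χ' ω : NetForm G₀} {Γ : List (Formula 𝒜)}
    (hj : Plug j χ χ') (hn : χ.leaves.Nodup) (hn' : χ'.leaves.Nodup)
    (hΓ : χ'.leaves.Perm (a.leaves ++ (b.leaves ++ Γ)))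
    (hω : Plug (v := .empty) d χ ω) :
    ∃ ω', Plug (v := .empty) (v' := a) e χ' ω' ∧ Plug (v := .empty) (v' := b) e' ω' ω := by
  obtain ⟨ω', h₁, p₁⟩ := Plug.exists_of_perm (v := .empty) (v' := a)
    (Y := fun A => dual (obj G₀ A)) e hΓ
  obtain ⟨ω'', h₂, p₂⟩ := Plug.exists_of_perm (v := .empty) (v' := b)
    (Y := fun A => dual (obj G₀ A)) e' (φ := ω') (Γ := Γ) p₁
  have hn'' : ω'.leaves.Nodup := p₁.nodup_iff.2 (List.nodup_append.1 (hΓ.nodup_iff.1 hn')).2.1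
  have h₃ := (hj.comp_left h₁ hn').comp_right h₂ hn''
  -- Closing the two arguments leaves two empty bracketings in front of the context; the left unitor
  -- merges them into one.
  have h₄ := Plug.structural_comp (.leftUnit .empty) hω
  have h₅ := h₃.of_eq ((whisker_eq_tensorHom e e' j).trans he)
  exact ⟨ω', h₁, h₂.congr (.refl _) (h₅.unique h₄ (.refl _) hn)⟩

/-- The step that replaces a cut `(A ⊗ B) ⊚ (B^⊥ ⅋ A^⊥)`. -/
theorem Der.cut_tensPar {A A' B B' : Formula 𝒜} (dA : DualPair A A') (dB : DualPair B B')
    {χ ω : NetForm G₀} (h : Der link χ) (hχ : Distinct χ.leaves) {Γ : List (Formula 𝒜)}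
    (hΓ : χ.leaves.Perm (.tens (.tens A B) (.par B' A') :: Γ))
    (hω : Plug (cutName G₀ ⟨.tens A B, .par B' A', .tensPar dA dB⟩) χ ω) :
    ∃ χ' ω', Der link χ' ∧ χ'.leaves.Perm (.tens A A' :: .tens B B' :: Γ) ∧
      Plug (cutName G₀ ⟨A, A', dA⟩) χ' ω' ∧ Plug (cutName G₀ ⟨B, B', dB⟩) ω' ω := by
  obtain ⟨χ', hj, p⟩ := Plug.exists_of_perm (Y := fun A => dual (obj G₀ A))
    (v := .node (.leaf (.tens A A')) (.leaf (.tens B B')))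
    (v' := .leaf (.tens (.tens A B) (.par B' A')))
    (splitPair (obj G₀ A) (obj G₀ A') (obj G₀ B) (obj G₀ B')) hΓ
  have hd : Distinct χ'.leaves := by
    refine hχ.of_idx_perm ((idx_perm hΓ).trans (List.Perm.trans ?_ (idx_perm p).symm))
    rw [List.perm_iff_count]; intro a; simp; omega
  have hc : (name (cutMap G₀ ⟨A, A', dA⟩) ⊗ₘ name (cutMap G₀ ⟨B, B', dB⟩)) ≫
      splitPair (obj G₀ A) (obj G₀ A') (obj G₀ B) (obj G₀ B') =
      (λ_ _).hom ≫ name (cutMap G₀ ⟨.tens A B, .par B' A', .tensPar dA dB⟩) := by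
    refine (name_splitPair _ _).trans ?_
    have := tensPairing_pairing (dualComparison G₀ dA) (dualComparison G₀ dB)
    exact congrArg (fun p => (λ_ _).hom ≫ name p) this
  obtain ⟨ω', h₁, h₂⟩ := hj.elements (a := .leaf (.tens A A')) (b := .leaf (.tens B B')) hc hχ.nodup hd.nodup p hω
  exact ⟨χ', ω', h.split hχ hj, p, h₁, h₂⟩

/-- The composite reorders the two small cuts, reverses each, joins them by `splitPair` and reverses
the result. Elements follow these reversals by `name_dualMap`, which reduces `parTens` to
`name_splitPair`. -/
theorem swap_elements {A A' B B' : C} (d : A' ⟶ dual A) (e : B' ⟶ dual B) :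
    (name (pairing d) ⊗ₘ name (pairing e)) ≫
      ((β_ _ _).hom ≫ (dualMap (β_ B' B).hom ⊗ₘ dualMap (β_ A' A).hom)) ≫
        splitPair B' B A' A ≫ dualMap (β_ (dual (dual B ⊗ dual A)) (B' ⊗ A')).hom =
      (λ_ _).hom ≫ name (pairing ((e ⊗ₘ d) ≫ bidual (dual B ⊗ dual A))) := by
  rw [Category.assoc, BraidedCategory.braiding_naturality_assoc, ← Category.assoc (_ ⊗ₘ _),
    tensorHom_comp_tensorHom, name_dualMap, name_dualMap]
  slice_lhs 2 3 => rw [name_splitPair]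
  rw [Category.assoc, name_dualMap, swap_tensPairing, ← Category.assoc]
  congr 1
  rw [braiding_leftUnitor, unitors_equal]

/-- The step that replaces a cut `(A ⅋ B) ⊚ (B^⊥ ⊗ A^⊥)`. -/
theorem Der.cut_parTens {A A' B B' : Formula 𝒜} (dA : DualPair A A') (dB : DualPair B B')
    {χ ω : NetForm G₀} (h : Der link χ) (hχ : Distinct χ.leaves) {Γ : List (Formula 𝒜)}
    (hΓ : χ.leaves.Perm (.tens (.par A B) (.tens B' A') :: Γ))
    (hω : Plug (cutName G₀ ⟨.par A B, .tens B' A', .parTens dA dB⟩) χ ω) :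
    ∃ χ' ω', Der link χ' ∧ χ'.leaves.Perm (.tens A A' :: .tens B B' :: Γ) ∧
      Plug (cutName G₀ ⟨A, A', dA⟩) χ' ω' ∧ Plug (cutName G₀ ⟨B, B', dB⟩) ω' ω := by
  -- The forms `χ₁`, …, `χ₄` arise by reversing the compound cut, splitting it as a tensor against a
  -- par, and reversing each of the two resulting cuts.
  obtain ⟨χ₁, h₁, p₁⟩ := Plug.exists_of_perm (Y := fun A => dual (obj G₀ A))
    (v := .leaf (.tens (.tens B' A') (.par A B))) (v' := .leaf (.tens (.par A B) (.tens B' A')))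
    (dualMap (β_ (obj G₀ (.par A B)) (obj G₀ (.tens B' A'))).hom) hΓ
  obtain ⟨χ₂, h₂, p₂⟩ := Plug.exists_of_perm (Y := fun A => dual (obj G₀ A))
    (v := .node (.leaf (.tens B' B)) (.leaf (.tens A' A)))
    (v' := .leaf (.tens (.tens B' A') (.par A B)))
    (splitPair (obj G₀ B') (obj G₀ B) (obj G₀ A') (obj G₀ A)) p₁
  obtain ⟨χ₃, h₃, p₃⟩ := Plug.exists_of_perm (Y := fun A => dual (obj G₀ A))
    (v := .leaf (.tens B B')) (v' := .leaf (.tens B' B))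
    (dualMap (β_ (obj G₀ B') (obj G₀ B)).hom) (Γ := .tens A' A :: Γ) p₂
  obtain ⟨χ₄, h₄, p₄⟩ := Plug.exists_of_perm (Y := fun A => dual (obj G₀ A))
    (v := .leaf (.tens A A')) (v' := .leaf (.tens A' A))
    (dualMap (β_ (obj G₀ A') (obj G₀ A)).hom) (Γ := .tens B B' :: Γ) (p₃.trans (List.Perm.swap _ _ _))
  have d₁ : Distinct χ₁.leaves := by
    refine hχ.of_idx_perm ((idx_perm hΓ).trans (List.Perm.trans ?_ (idx_perm p₁).symm))
    rw [List.perm_iff_count]; intro a; simp; omega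
  have d₂ : Distinct χ₂.leaves := by
    refine hχ.of_idx_perm ((idx_perm hΓ).trans (List.Perm.trans ?_ (idx_perm p₂).symm))
    rw [List.perm_iff_count]; intro a; simp; omega
  have d₃ : Distinct χ₃.leaves := by
    refine hχ.of_idx_perm ((idx_perm hΓ).trans (List.Perm.trans ?_ (idx_perm p₃).symm))
    rw [List.perm_iff_count]; intro a; simp; omega
  have d₄ : Distinct χ₄.leaves := by
    refine hχ.of_idx_perm ((idx_perm hΓ).trans (List.Perm.trans ?_ (idx_perm p₄).symm))
    rw [List.perm_iff_count]; intro a; simp; omega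
  have hj := Plug.structural_comp (.braid (.leaf (Formula.tens A A')) (.leaf (Formula.tens B B')))
    (((h₁.comp h₂ d₁.nodup).comp_left h₃ d₂.nodup).comp_right h₄ d₃.nodup)
  have hc : (name (cutMap G₀ ⟨A, A', dA⟩) ⊗ₘ name (cutMap G₀ ⟨B, B', dB⟩)) ≫
      ((β_ _ _).hom ≫ _ ◁ dualMap (β_ (obj G₀ A') (obj G₀ A)).hom ≫
        dualMap (β_ (obj G₀ B') (obj G₀ B)).hom ▷ _ ≫
        splitPair (obj G₀ B') (obj G₀ B) (obj G₀ A') (obj G₀ A) ≫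
          dualMap (β_ (dual (dual (obj G₀ B) ⊗ dual (obj G₀ A)))
            (obj G₀ B' ⊗ obj G₀ A')).hom) =
      (λ_ _).hom ≫ name (cutMap G₀ ⟨.par A B, .tens B' A', .parTens dA dB⟩) := by
    have := swap_elements (dualComparison G₀ dA) (dualComparison G₀ dB)
    rw [tensorHom_def' (dualMap _)] at this
    simp only [Category.assoc] at this
    exact this
  obtain ⟨ω', h₅, h₆⟩ := hj.elements (a := .leaf (.tens A A')) (b := .leaf (.tens B B')) hc hχ.nodup d₄.nodup p₄ hω
  exact ⟨χ₄, ω', (((h.swap hχ h₁).split d₁ h₂).swap d₂ h₃).swap d₃ h₄, p₄, h₅, h₆⟩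

end Cuts

/-! ### Cuts between leaves. -/

section AtomicCuts

variable {𝒜 : Type w} {C : Type u} [Category.{v} C] [MonoidalCategory C] [SymmetricCategory C]
  [StarAutonomous C] {G₀ : 𝒜 → C} {link link' : ℕ → ℕ}

theorem AxLink.link_congr {φ : NetForm G₀} (h : AxLink link φ)
    (hl : ∀ i ∈ idx φ.leaves, link' i = link i) : AxLink link' φ := by
  cases h with
  | atom a i j h => exact .atom a i j ((hl i (by simp [Form.leaves])).trans h)
  | unit i j h => exact .unit i j ((hl i (by simp [Form.leaves])).trans h)

theorem Der.link_congr {φ : NetForm G₀} (h : Der link φ)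
    (hl : ∀ i ∈ idx φ.leaves, link' i = link i) : Der link' φ := by
  induction h with
  | ax φ h => exact .ax _ (h.link_congr hl)
  | par A B s m hm ih => exact .par A B s m (ih (by simpa [Form.leaves] using hl))
  | tens A B s t m n hm hn ihm ihn =>
    simp only [Form.leaves, Bracketing.leaves, List.cons_append, List.nil_append, idx_cons,
      Formula.idx, List.mem_append, idx_append] at hl ihm ihn
    exact .tens A B s t m n (ihm fun i hi => hl i (by tauto)) (ihn fun i hi => hl i (by tauto))
  | conv φ ψ e h ih =>
    exact (ih fun i hi => hl i ((mem_idx_of_perm (Form.perm_of_equiv e)).1 hi)).congr e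

/-- A rule uses links only in its fixed premise, whose indices are by distinctness those of `v` that
are not in `v'`. -/
theorem Rule.link_congr {v v' : Bracketing (Formula 𝒜)}
    {k : srcObj (obj G₀) v ⟶ srcObj (obj G₀) v'} (hk : Rule link v v' k) (hv : Distinct v.leaves)
    (hl : ∀ i ∈ idx v.leaves, i ∉ idx v'.leaves → link' i = link i) : Rule link' v v' k := by
  cases hk with
  | par A B => exact .par A B
  | tensLeft A B t n hn =>
    refine .tensLeft A B t n (hn.link_congr fun i hi => hl i ?_ ?_)
    · simp only [Form.leaves, Bracketing.leaves, List.cons_append, List.nil_append, idx_cons,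
        Formula.idx, List.mem_append] at hi ⊢
      tauto
    · have : (A.idx ++ idx (B :: t.leaves)).Nodup := by simpa [Distinct] using hv
      simpa using fun h => (List.nodup_append.1 this).2.2 i h i hi rfl
  | tensRight A B t n hn =>
    refine .tensRight A B t n (hn.link_congr fun i hi => hl i ?_ ?_)
    · simp only [Form.leaves, Bracketing.leaves, List.cons_append, List.nil_append, idx_cons,
        Formula.idx, List.mem_append] at hi ⊢
      tauto
    · have : (B.idx ++ idx (A :: t.leaves)).Nodup := by
        refine (List.Perm.nodup_iff ?_).1 hv
        rw [List.perm_iff_count]; intro a; simp; omega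
      simpa using fun h => (List.nodup_append.1 this).2.2 i h i hi rfl

/-- The links inside the core may change freely: the extending rules use only indices that they add.
-/
theorem Extends.link_congr {F : Formula 𝒜} {φ χ : NetForm G₀} (h : Extends link F φ χ)
    (hχ : Distinct χ.leaves)
    (hl : ∀ i ∈ idx χ.leaves, i ∉ idx φ.leaves → link' i = link i) : Extends link' F φ χ := by
  induction h with
  | refl χ e => exact .refl _ _ e
  | step χ ω v v' k he hk hF hp ih =>
    obtain ⟨Γ, p₁, p₂⟩ := hp.perm
    have hd := hχ.perm p₂
    have hd' := hk.distinct hp hχ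
    rw [Distinct, idx_append, List.nodup_append] at hd
    have q₁ := fun i => mem_idx_of_perm p₁ (i := i)
    have q₂ := fun i => mem_idx_of_perm p₂ (i := i)
    simp only [idx_append, List.mem_append] at q₁ q₂
    refine .step _ _ _ v v' k (ih hd' fun i hi => hl i ((q₂ i).2 (((q₁ i).1 hi).imp_left hk.idx_subset)))
      (hk.link_congr hd.1 fun i hi hi' => hl i ((q₂ i).2 (.inl hi)) fun h => ?_) hF hp
    obtain ⟨l, hl'⟩ := he.idx_perm
    rcases (q₁ i).1 (hl'.mem_iff.2 (by simp [h])) with h' | h'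
    · exact hi' h'
    · exact hd.2.2 i hi i h' rfl

theorem Extends.congr_left {F : Formula 𝒜} {φ φ' χ : NetForm G₀} (h : Extends link F φ χ)
    (e : φ ≋ φ') : Extends link F φ' χ := by
  induction h with
  | refl χ e' => exact .refl _ _ (e.symm.trans e')
  | step χ ω v v' k he hk hF hp ih => exact .step _ _ _ v v' k ih hk hF hp

variable (G₀) in
/-- The form of the axiom link of a label and its dual. -/
def linkArr : (l : Label 𝒜) → (dual (labelObj G₀ l) ⊗ dual (labelObj G₀ l.dual) ⟶ bot C)
  | .pos a => coname (dual (G₀ a))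
  | .neg a => ev (dual (G₀ a))
  | .one => coname (dual (𝟙_ C))
  | .bot => ev (dual (𝟙_ C))

/-- Up to the comparison of `G(l^⊥)` with `G(l)^⊥`, an axiom link is the co-name of an identity.
This makes it neutral when it is cut. -/
theorem labelDual_linkArr (l : Label 𝒜) :
    labelDual G₀ l ▷ dual (labelObj G₀ l.dual) ≫ linkArr G₀ l = coname (labelObj G₀ l.dual) := by
  cases l with
  | pos a =>
    have : 𝟙 (dual (G₀ a)) ▷ dual (dual (G₀ a)) ≫ coname (dual (G₀ a)) = coname _ := by simp
    exact this
  | neg a => exact bidual_ev (G₀ a)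
  | one =>
    have : 𝟙 (dual (𝟙_ C)) ▷ dual (dual (𝟙_ C)) ≫ coname (dual (𝟙_ C)) = coname _ := by simp
    exact this
  | bot => exact bidual_ev (𝟙_ C)

theorem ev_eq_coname (A : C) : ev A = (β_ (dual A) A).hom ≫ coname A := by
  rw [coname, SymmetricCategory.symmetry_assoc]

/-- `AxLink` records the value of `link` at only one end, hence the disjunction. -/
theorem AxLink.of_mem {φ : NetForm G₀} (h : AxLink link φ) {l : Label 𝒜} {i : ℕ}
    (hi : .leaf l i ∈ φ.leaves) : ∃ i', (link i = i' ∨ link i' = i) ∧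
      φ ≋ ⟨.node (.leaf (.leaf l i)) (.leaf (.leaf l.dual i')), linkArr G₀ l⟩ := by
  cases h with
  | atom a i₀ j h =>
    simp only [Form.leaves, Bracketing.leaves, List.cons_append, List.nil_append, List.mem_cons,
      List.not_mem_nil, or_false] at hi
    rcases hi with h' | h' <;> cases h'
    · exact ⟨j, .inl h, .refl _⟩
    · exact ⟨i₀, .inr h, .symm (Form.equiv_mk (.braid _ _) (ev_eq_coname _))⟩
  | unit i₀ j h =>
    simp only [Form.leaves, Bracketing.leaves, List.cons_append, List.nil_append, List.mem_cons,
      List.not_mem_nil, or_false] at hi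
    rcases hi with h' | h' <;> cases h'
    · exact ⟨j, .inl h, .refl _⟩
    · exact ⟨i₀, .inr h, .symm (Form.equiv_mk (.braid _ _) (ev_eq_coname _))⟩

theorem Der.linkArr {i j : ℕ} (h : link i = j) (h' : link j = i) (l : Label 𝒜) :
    Der link (⟨.node (.leaf (.leaf l i)) (.leaf (.leaf l.dual j)), linkArr G₀ l⟩ : NetForm G₀) := by
  cases l with
  | pos a => exact .ax _ (.atom a i j h)
  | neg a =>
    exact (Der.ax _ (.atom a j i h')).congr
      (.symm (Form.equiv_mk (.braid _ _) (ev_eq_coname _)))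
  | one => exact .ax _ (.unit i j h)
  | bot =>
    exact (Der.ax _ (.unit j i h')).congr
      (.symm (Form.equiv_mk (.braid _ _) (ev_eq_coname _)))

theorem Der.leaf_focus {χ : NetForm G₀} (h : Der link χ) (hχ : Distinct χ.leaves)
    (hl : ∀ i ∈ idx χ.leaves, link (link i) = i)
    {l : Label 𝒜} {i : ℕ} (hF : .leaf l i ∈ χ.leaves) :
    Extends link (.leaf l i) (⟨.node (.leaf (.leaf l i)) (.leaf (.leaf l.dual (link i))),
        OrdinaryNets.linkArr G₀ l⟩ : NetForm G₀) χ := by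
  obtain ⟨core, hi, he⟩ := h.focus hχ hF
  obtain ⟨r, hr⟩ := he.idx_perm
  cases hi with
  | ax _ _ hmem hax =>
    obtain ⟨i', h', e⟩ := hax.of_mem hmem
    have : link i = i' := by
      rcases h' with h' | h'
      · exact h'
      · rw [← h']
        refine hl i' (hr.mem_iff.2 ?_)
        rw [List.mem_append, mem_idx_of_perm (Form.perm_of_equiv e)]
        simp [Form.leaves]
    subst this
    exact he.congr_left e

/-- By `name_absorbRight` and `labelDual_linkArr`, cutting `n` against an axiom link returns the
form of `n`, now attached to the other end of the link. -/
theorem name_linkArr (l : Label 𝒜) {T : C} (n : T ⟶ labelObj G₀ l.dual) :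
    (name (pairing (labelDual G₀ l)) ▷ T ≫ absorbRight (labelObj G₀ l) n) ▷
        dual (labelObj G₀ l.dual) ≫ linkArr G₀ l =
      (((λ_ T).hom ⊗ₘ 𝟙 (dual (labelObj G₀ l.dual))) ≫ (β_ _ _).hom) ≫ unhat n := by
  rw [name_absorbRight, comp_whiskerRight, comp_whiskerRight, Category.assoc, Category.assoc,
    labelDual_linkArr, unhat_eq, Category.assoc, SymmetricCategory.symmetry_assoc, tensorHom_id]

/-- The step that removes a cut between two leaves. -/
theorem Der.cut_leaf {l : Label 𝒜} {i j : ℕ} {χ ω : NetForm G₀} (h : Der link χ)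
    (hχ : Distinct χ.leaves) (hl : ∀ k ∈ idx χ.leaves, link (link k) = k)
    (hω : Plug (cutName G₀ ⟨.leaf l i, .leaf l.dual j, .leaf l i j⟩) χ ω)
    (hij : link' (link i) = link j) (hji : link' (link j) = link i)
    (hl' : ∀ k ∈ idx χ.leaves, k ≠ i → k ≠ j → k ≠ link i → k ≠ link j → link' k = link k) :
    Der link' ω := by
  obtain ⟨s, t, m, n, hm, hn, he⟩ := h.tens_focus (A := .leaf l i) (B := .leaf l.dual j) hχ
    (hω.mem (by simp [Cut.toTens]))
  obtain ⟨r, hr⟩ := he.idx_perm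
  have hd := he.distinct hχ
  have hT : TensOf (.leaf l i) (.leaf l.dual j) (⟨.node (.leaf (.leaf l i)) s, m⟩ : NetForm G₀)
    ⟨.node (.leaf (.leaf l.dual j)) t, n⟩ _ := ⟨s, t, m, n, .refl _, .refl _, .refl _⟩
  have hdm := hT.distinct_left hd
  have hdn := hT.distinct_right hd
  have hmem : ∀ k, k ∈ i :: idx s.leaves ∨ k ∈ j :: idx t.leaves → k ∈ idx χ.leaves := fun k hk => by
    refine hr.mem_iff.2 (List.mem_append_left _ ?_)
    simp only [Form.leaves, Bracketing.leaves, List.cons_append, List.nil_append, idx_cons,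
      Formula.idx, List.mem_append, idx_append, List.mem_cons] at hk ⊢
    tauto
  have hlm : ∀ k ∈ i :: idx s.leaves, link k ∈ i :: idx s.leaves :=
    hm.link_mem fun k hk => hl k (hmem k (.inl hk))
  have hln : ∀ k ∈ j :: idx t.leaves, link k ∈ j :: idx t.leaves :=
    hn.link_mem fun k hk => hl k (hmem k (.inr hk))
  have hi := hlm i (by simp)
  have hj := hln j (by simp)
  have hdisj : ∀ k ∈ i :: idx s.leaves, k ∉ j :: idx t.leaves := by
    have : (i :: idx s.leaves ++ (j :: idx t.leaves)).Nodup := by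
      refine (List.Perm.nodup_iff ?_).1 hd
      rw [List.perm_iff_count]; intro a; simp [Form.leaves, List.count_cons]; omega
    exact fun k hk hk' => (List.nodup_append.1 this).2.2 k hk k hk' rfl
  have hjs : j ∉ i :: idx s.leaves := fun h => hdisj j h (by simp)
  have hit : i ∉ j :: idx t.leaves := fun h => hdisj i (by simp) h
  have hjs' : link j ∉ i :: idx s.leaves := fun h => hdisj _ h hj
  have hit' : link i ∉ j :: idx t.leaves := fun h => hdisj _ hi h
  -- The four indices `i`, `j`, `link i`, `link j` lie in the core, so the later rules remain valid
  -- for `link'`.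
  have he' : Extends link' _ _ χ := he.link_congr hχ fun k hk hk' => by
    simp only [Form.leaves, Bracketing.leaves, List.cons_append, List.nil_append, idx_cons,
      Formula.idx, List.mem_append, idx_append, List.mem_cons, not_or] at hk' hi hj
    exact hl' k hk (by grind) (by grind) (by grind) (by grind)
  refine he'.der_subst hχ (.mk _) ?_ hω
  -- In the left premise the leaf `i` comes from its axiom link; the remaining rules add neither `i`
  -- nor `link i`, so they too survive the change of links.
  have fm := (hm.leaf_focus hdm (fun k hk => hl k (hmem k (.inl hk))) (l := l) (i := i)
    (by simp [Form.leaves])).link_congr (link' := link') hdm fun k hk hk' => by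
      replace hk : k ∈ i :: idx s.leaves := hk
      simp only [Form.leaves, Bracketing.leaves, List.cons_append, List.nil_append, idx_cons,
        Formula.idx, List.mem_cons, idx_nil, not_or] at hk'
      exact hl' k (hmem k (.inl hk)) hk'.1 (by rintro rfl; exact hjs hk) hk'.2.1
        (by rintro rfl; exact hjs' hk)
  refine fm.der_subst hdm (.mk _) ?_ ((plug_tensLeft m n).comp_left (.mk _) hd.nodup)
  -- By `name_linkArr` the cut leaves the right premise unchanged, except that its leaf `j` is now
  -- called `link i`.
  suffices hn' : Der link' (⟨.node (.leaf (.leaf l.dual (link i))) t, n⟩ : NetForm G₀) by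
    refine hn'.congr (.symm (Form.equiv_mk ((Structural.tensor (.leftUnit t) (.refl _)).trans
      (.braid _ _)) ?_))
    exact (name_linkArr l (hat n)).trans (congrArg (_ ≫ ·) (unhat_hat n))
  have fn := (hn.leaf_focus hdn (fun k hk => hl k (hmem k (.inr hk))) (l := l.dual) (i := j)
    (by simp [Form.leaves])).link_congr (link' := link') hdn fun k hk hk' => by
      replace hk : k ∈ j :: idx t.leaves := hk
      simp only [Form.leaves, Bracketing.leaves, List.cons_append, List.nil_append, idx_cons,
        Formula.idx, List.mem_cons, idx_nil, not_or] at hk'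
      exact hl' k (hmem k (.inr hk)) (by rintro rfl; exact hit hk) hk'.1
        (by rintro rfl; exact hit' hk) hk'.2.1
  have hid (T : C) (p : dual (labelObj G₀ l.dual) ⊗ T ⟶ bot C) : p = 𝟙 _ ▷ T ≫ p := by simp
  -- The renaming substitutes an identity. At the axiom link it replaces the link between `j` and
  -- `link j` by one between `link i` and `link j`, which belongs to `link'`.
  refine fn.der_subst (v := .leaf (.leaf l.dual (link i))) (j := 𝟙 (dual (labelObj G₀ l.dual)))
    hdn (.mk _) ((Der.linkArr hij hji l.dual).congr (Form.equiv_of_eq (hid _ _)))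
    ⟨t, n, .refl _, Form.equiv_of_eq (hid _ _)⟩

end AtomicCuts

/-! ### Closing cuts, values of nets, and their invariance. -/

section Values

variable {𝒜 : Type w} {C : Type u} [Category.{v} C] [MonoidalCategory C] [SymmetricCategory C]
  [StarAutonomous C] {G₀ : 𝒜 → C}

/-- `CutPlug cs φ χ`: the form `χ` is obtained from `φ` by closing the cuts `cs`. -/
inductive CutPlug : List (Cut 𝒜) → NetForm G₀ → NetForm G₀ → Prop
  | nil (φ χ : NetForm G₀) : φ ≋ χ → CutPlug [] φ χ
  | cons (c : Cut 𝒜) (cs : List (Cut 𝒜)) (φ ω χ : NetForm G₀) :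
      Plug (cutName G₀ c) φ ω → CutPlug cs ω χ → CutPlug (c :: cs) φ χ

namespace CutPlug

variable {cs cs' : List (Cut 𝒜)} {φ φ' χ χ' : NetForm G₀}

theorem congr (h : CutPlug cs φ χ) (e : χ ≋ χ') : CutPlug cs φ χ' := by
  induction h with
  | nil φ χ e' => exact .nil _ _ (e'.trans e)
  | cons c cs φ ω χ h _ ih => exact .cons c cs _ ω _ h (ih e)

theorem congr_left (h : CutPlug cs φ χ) (e : φ ≋ φ') : CutPlug cs φ' χ := by
  cases h with
  | nil _ _ e' => exact .nil _ _ (e.symm.trans e')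
  | cons c cs _ ω _ h h' => exact .cons c cs _ ω _ (h.congr e (.refl _)) h'

theorem perm (h : CutPlug cs φ χ) : φ.leaves.Perm (cs.map Cut.toTens ++ χ.leaves) := by
  induction h with
  | nil φ χ e' => exact Form.perm_of_equiv e'
  | cons c cs φ ω χ h _ ih =>
    obtain ⟨Γ, p₁, p₂⟩ := h.perm
    exact p₁.trans (List.Perm.cons _ (p₂.symm.trans ih))

theorem exists_of_perm (cs : List (Cut 𝒜)) {Γ : List (Formula 𝒜)}
    (hφ : φ.leaves.Perm (cs.map Cut.toTens ++ Γ)) : ∃ χ, CutPlug cs φ χ ∧ χ.leaves.Perm Γ := by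
  induction cs generalizing φ with
  | nil => exact ⟨φ, .nil _ _ (.refl _), hφ⟩
  | cons c cs ih =>
    obtain ⟨ω, h₁, p₁⟩ := Plug.exists_of_perm (cutName G₀ c) (φ := φ)
      (Γ := cs.map Cut.toTens ++ Γ) hφ
    obtain ⟨χ, h₂, p₂⟩ := ih p₁
    exact ⟨χ, .cons c cs _ ω _ h₁ h₂, p₂⟩

theorem nodup_of_plug {c : Cut 𝒜} (h : Plug (cutName G₀ c) φ χ) (hn : φ.leaves.Nodup) :
    χ.leaves.Nodup := by
  obtain ⟨Γ, p₁, p₂⟩ := h.perm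
  exact p₂.nodup_iff.2 (List.nodup_cons.1 (p₁.nodup_iff.1 hn)).2

theorem unique (h : CutPlug cs φ χ) (h' : CutPlug cs φ' χ') (e : φ ≋ φ') (hn : φ.leaves.Nodup) :
    χ ≋ χ' := by
  induction h generalizing φ' with
  | nil φ χ e₁ =>
    cases h' with
    | nil _ _ e₂ => exact e₁.symm.trans (e.trans e₂)
  | cons c cs φ ω χ h _ ih =>
    cases h' with
    | cons _ _ _ ω' _ h₁ h₂ => exact ih h₂ (h.unique h₁ e hn) (nodup_of_plug h hn)

/-- The order of the cuts does not matter. -/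
theorem of_perm (hp : cs.Perm cs') (h : CutPlug cs φ χ) (hn : φ.leaves.Nodup) :
    CutPlug cs' φ χ := by
  induction hp generalizing φ with
  | nil => exact h
  | cons c _ ih =>
    cases h with
    | cons _ _ _ ω _ h₁ h₂ => exact .cons _ _ _ ω _ h₁ (ih h₂ (nodup_of_plug h₁ hn))
  | swap c d cs =>
    cases h with
    | cons _ _ _ ω _ h₁ h₂ =>
      cases h₂ with
      | cons _ _ _ ω' _ h₂ h₃ =>
        obtain ⟨Γ, p₁, p₂⟩ := h₁.perm
        obtain ⟨Δ, q₁, q₂⟩ := h₂.perm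
        have p : φ.leaves.Perm ((Bracketing.leaf d.toTens).leaves ++
            ((Bracketing.leaf c.toTens).leaves ++ Δ)) :=
          p₁.trans ((p₂.symm.trans q₁).append_left _)
        obtain ⟨ω₁, h₄, r₄⟩ := Plug.exists_of_perm (cutName G₀ c) (φ := φ) (Γ := d.toTens :: Δ)
          (p.trans (List.Perm.swap _ _ _))
        obtain ⟨ω₂, h₅, h₆⟩ := h₁.comm h₄ hn p
        exact .cons _ _ _ ω₁ _ h₄ (.cons _ _ _ ω₂ _ h₆
          (h₃.congr_left (h₂.unique h₅ (.refl _) (nodup_of_plug h₁ hn))))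
  | trans _ _ ih₁ ih₂ => exact ih₂ (ih₁ h hn) hn

theorem append_iff {φ χ : NetForm G₀} : CutPlug (cs ++ cs') φ χ ↔
    ∃ ω, CutPlug cs φ ω ∧ CutPlug cs' ω χ := by
  induction cs generalizing φ with
  | nil =>
    refine ⟨fun h => ⟨φ, .nil _ _ (.refl _), h⟩, ?_⟩
    rintro ⟨ω, h₁, h₂⟩
    cases h₁ with
    | nil _ _ e => exact h₂.congr_left e.symm
  | cons c cs ih =>
    constructor
    · intro h
      cases h with
      | cons _ _ _ ω _ h₁ h₂ =>
        obtain ⟨ω', h₃, h₄⟩ := ih.1 h₂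
        exact ⟨ω', .cons _ _ _ ω _ h₁ h₃, h₄⟩
    · rintro ⟨ω, h₁, h₂⟩
      cases h₁ with
      | cons _ _ _ ω' _ h₃ h₄ => exact .cons _ _ _ ω' _ h₃ (ih.2 ⟨ω, h₄, h₂⟩)

end CutPlug

/-- `Val π χ`: the form `χ` belongs to the interpretation of the net `π`. -/
def Val (π : PreNet 𝒜) (χ : NetForm G₀) : Prop :=
  ∃ φ : NetForm G₀, Der π.link φ ∧ φ.leaves.Perm π.sequent ∧ CutPlug π.cuts φ χ

theorem PreNet.distinct (π : PreNet 𝒜) : Distinct π.sequent := by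
  rw [Distinct, idx_eq]
  exact π.nodup

theorem mem_idx_iff {Γ : List (Formula 𝒜)} {i : ℕ} : i ∈ idx Γ ↔ ∃ l, (l, i) ∈ seqLeaves Γ := by
  simp [idx_eq]

theorem PreNet.link_link_of_mem (π : PreNet 𝒜) {i : ℕ} (hi : i ∈ idx π.sequent) :
    π.link (π.link i) = i := by
  obtain ⟨l, h⟩ := mem_idx_iff.1 hi
  exact π.link_link l i h

theorem Val.congr {π : PreNet 𝒜} {χ χ' : NetForm G₀} (h : Val π χ) (e : χ ≋ χ') : Val π χ' := by
  obtain ⟨φ, h₁, h₂, h₃⟩ := h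
  exact ⟨φ, h₁, h₂, h₃.congr e⟩

/-- The value of a net is unique. -/
theorem Val.unique {π : PreNet 𝒜} {χ χ' : NetForm G₀} (h : Val π χ) (h' : Val π χ') : χ ≋ χ' := by
  obtain ⟨φ, h₁, h₂, h₃⟩ := h
  obtain ⟨φ', h₁', h₂', h₃'⟩ := h'
  have hd := π.distinct.perm h₂.symm
  exact h₃.unique h₃' (h₁.unique h₁' hd (h₂.trans h₂'.symm)
    fun i hi => π.link_link_of_mem ((mem_idx_of_perm h₂).1 hi)) hd.nodup

theorem Val.perm {π : PreNet 𝒜} {χ : NetForm G₀} (h : Val π χ) : χ.leaves.Perm π.concl := by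
  obtain ⟨φ, h₁, h₂, h₃⟩ := h
  have := h₃.perm.symm.trans (h₂.trans List.perm_append_comm)
  exact (List.perm_append_left_iff _).1 this

theorem PreNet.sequent_perm {π : PreNet 𝒜} {Φ l Ψ : List (Cut 𝒜)} (h : π.cuts = Φ ++ (l ++ Ψ)) :
    π.sequent.Perm (l.map Cut.toTens ++ (π.concl ++ (Φ ++ Ψ).map Cut.toTens)) := by
  rw [PreNet.sequent, h]
  simp only [List.map_append]
  exact ((List.perm_append_comm_assoc _ _ _).append_left _).trans
    (List.perm_append_comm_assoc _ _ _)

/-- A local transformation of cuts that preserves values. -/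
theorem Val.of_local {π π' : PreNet 𝒜} {Φ l l' Ψ : List (Cut 𝒜)} {χ : NetForm G₀} (h : Val π χ)
    (hc : π.cuts = Φ ++ (l ++ Ψ)) (hc' : π'.cuts = Φ ++ (l' ++ Ψ)) (hco : π'.concl = π.concl)
    (H : ∀ (φ ω : NetForm G₀) (Γ : List (Formula 𝒜)), Der π.link φ → Distinct φ.leaves →
      φ.leaves.Perm π.sequent →
      φ.leaves.Perm (l.map Cut.toTens ++ Γ) → π'.sequent.Perm (l'.map Cut.toTens ++ Γ) →
      CutPlug l φ ω → ∃ φ', Der π'.link φ' ∧ φ'.leaves.Perm (l'.map Cut.toTens ++ Γ) ∧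
        CutPlug l' φ' ω) : Val π' χ := by
  obtain ⟨φ, h₁, h₂, h₃⟩ := h
  have hd := π.distinct.perm h₂.symm
  rw [hc] at h₃
  -- Cuts may be closed in any order, so the cuts to be replaced are closed first; the intermediate
  -- form `ω` is then common to both nets.
  have h₄ := h₃.of_perm (List.perm_append_comm_assoc _ _ _) hd.nodup
  obtain ⟨ω, h₅, h₆⟩ := CutPlug.append_iff.1 h₄
  have hs' := PreNet.sequent_perm hc'
  rw [hco] at hs'
  obtain ⟨φ', h₇, h₈, h₉⟩ := H φ ω _ h₁ hd h₂ (h₂.trans (PreNet.sequent_perm hc)) hs' h₅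
  have h₁₀ := h₈.trans hs'.symm
  refine ⟨φ', h₇, h₁₀, ?_⟩
  rw [hc']
  exact (CutPlug.append_iff.2 ⟨ω, h₉, h₆⟩).of_perm (List.perm_append_comm_assoc _ _ _)
    (π'.distinct.perm h₁₀.symm).nodup

/-- Cut elimination does not change the value. -/
theorem Val.step {π π' : PreNet 𝒜} {χ : NetForm G₀} (h : Val π χ) (hs : PreNet.Step π π') :
    Val π' χ := by
  cases hs with
  | @tensPar A A' B B' dA dB Φ Ψ hc hc' hco hl =>
    refine h.of_local (l := [⟨.tens A B, .par B' A', .tensPar dA dB⟩])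
      (l' := [⟨A, A', dA⟩, ⟨B, B', dB⟩]) hc hc' hco fun φ ω Γ hφ hd hs hp hp' hω => ?_
    cases hω with
    | cons _ _ _ ω' _ h₁ h₂ =>
      obtain ⟨φ', ω'', h₃, h₄, h₅, h₆⟩ := hφ.cut_tensPar dA dB hd hp h₁
      refine ⟨φ', h₃.link_congr fun i hi => ?_, h₄, .cons _ _ _ ω'' _ h₅ (.cons _ _ _ ω' _ h₆ h₂)⟩
      obtain ⟨l, hi⟩ := mem_idx_iff.1 ((mem_idx_of_perm (h₄.trans hp'.symm)).1 hi)
      exact hl l i hi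
  | @parTens A A' B B' dA dB Φ Ψ hc hc' hco hl =>
    refine h.of_local (l := [⟨.par A B, .tens B' A', .parTens dA dB⟩])
      (l' := [⟨A, A', dA⟩, ⟨B, B', dB⟩]) hc hc' hco fun φ ω Γ hφ hd hs hp hp' hω => ?_
    cases hω with
    | cons _ _ _ ω' _ h₁ h₂ =>
      obtain ⟨φ', ω'', h₃, h₄, h₅, h₆⟩ := hφ.cut_parTens dA dB hd hp h₁
      refine ⟨φ', h₃.link_congr fun i hi => ?_, h₄, .cons _ _ _ ω'' _ h₅ (.cons _ _ _ ω' _ h₆ h₂)⟩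
      obtain ⟨l, hi⟩ := mem_idx_iff.1 ((mem_idx_of_perm (h₄.trans hp'.symm)).1 hi)
      exact hl l i hi
  | atomic l i j Φ Ψ hc hne hc' hco h₄ h₅ hl =>
    refine h.of_local (l := [⟨.leaf l i, .leaf l.dual j, .leaf l i j⟩])
      (l' := []) hc hc' hco fun φ ω Γ hφ hd hs hp hp' hω => ?_
    cases hω with
    | cons _ _ _ ω' _ h₁ h₂ =>
      refine ⟨ω', hφ.cut_leaf hd (fun k hk => π.link_link_of_mem ((mem_idx_of_perm hs).1 hk))
        h₁ h₄ h₅ fun k hk hki hkj hki' hkj' => ?_, h₁.perm_of hp, h₂⟩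
      have := (mem_idx_of_perm hp).1 hk
      simp only [Cut.toTens, List.map_cons, List.map_nil, List.cons_append, List.nil_append,
        idx_cons, Formula.idx, List.mem_cons, hki, hkj, false_or] at this
      obtain ⟨m, hm⟩ := mem_idx_iff.1 ((mem_idx_of_perm hp').2 this)
      exact hl m k hm hki' hkj'

end Values

/-! ### Representatives and forms -/

theorem eq_inv_whiskerRight {C : Type u} [Category.{v} C] [MonoidalCategory C]
    [SymmetricCategory C] {S T P W : C} (I : T ≅ P) {g : P ⊗ S ⟶ W} {m : T ⊗ S ⟶ W}
    (h : (β_ S T).hom ≫ I.hom ▷ S ≫ g = (β_ S T).hom ≫ m) : g = I.inv ▷ S ≫ m := by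
  rw [← cancel_epi (β_ S T).hom |>.1 h, ← comp_whiskerRight_assoc, Iso.inv_hom_id,
    id_whiskerRight, Category.id_comp]

namespace StarAutonomous

variable {C : Type u} [Category.{v} C] [MonoidalCategory C] [SymmetricCategory C]
  [StarAutonomous C]

theorem bidual_naturality {A B : C} (h : A ⟶ B) :
    h ≫ bidual B = bidual A ≫ dualMap (dualMap h) := by
  apply ev_injective
  rw [comp_whiskerRight, Category.assoc, bidual_ev, comp_whiskerRight, Category.assoc, dualMap_ev,
    ← whisker_exchange_assoc, bidual_ev, comp_coname]

theorem bidual_unit : bidual (𝟙_ C) = name (𝟙 (bot C)) := by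
  rw [bidual, name, coname, ev_unit, braiding_rightUnitor, Category.comp_id]

theorem name_dualMap_of_unit {Q : C} (h : 𝟙_ C ⟶ Q) : name (dualMap h) = h ≫ bidual Q := by
  rw [bidual_naturality, bidual_unit, name_dualMap, Category.comp_id]

/-- The De Morgan isomorphism turns the par of two co-names, followed by `parBot`, into the tensor
of their elements: the node case of `cutsName_deMorgan`. -/
theorem name_par {P Q : C} (p : P ⟶ bot C) (q : Q ⟶ bot C) :
    (λ_ (𝟙_ C)).inv ≫ (name p ⊗ₘ name q) ≫ (β_ _ _).hom ≫ bidual (dual Q ⊗ dual P) =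
      name (parMap p q ≫ parBot) := by
  have h : dualMap (dualMap q ⊗ₘ dualMap p) ≫
      dualMap ((λ_ (𝟙_ C)).inv ≫ (bidual (𝟙_ C) ⊗ₘ bidual (𝟙_ C))) =
      dualMap ((λ_ (𝟙_ C)).inv ≫ (name q ⊗ₘ name p)) := by
    rw [← dualMap_comp, Category.assoc, tensorHom_comp_tensorHom, bidual_unit, name_dualMap,
      name_dualMap, Category.comp_id, Category.comp_id]
  refine Eq.trans ?_ (congrArg name h).symm
  rw [name_dualMap_of_unit, BraidedCategory.braiding_naturality_assoc, Category.assoc]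
  have : (λ_ (𝟙_ C)).inv ≫ (β_ (𝟙_ C) (𝟙_ C)).hom = (λ_ (𝟙_ C)).inv := by
    rw [Iso.inv_comp_eq, braiding_tensorUnit_left]
    exact congrArg ((λ_ (𝟙_ C)).hom ≫ ·) unitors_inv_equal.symm
  rw [reassoc_of% this]

theorem decurry_leaf {ι : Type w} (X : ι → C) {s : Bracketing ι} {i : ι} (f : srcObj X s ⟶ X i) :
    decurry X (t := .leaf i) f = (β_ _ _).hom ≫ unhat f := by
  refine (tensor_coname_eq (𝟙 (dual (X i))) f).trans ?_
  rw [id_whiskerRight, Category.id_comp]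

theorem decurry_par {ι : Type w} (X : ι → C) {s : Bracketing ι} {i j : ι}
    (f : srcObj X s ⟶ par (X i) (X j)) :
    decurry X (t := .node (.leaf i) (.leaf j)) f =
      (β_ _ _).hom ≫ (parIso (X i) (X j)).hom ▷ _ ≫ unhat f := by
  have h : deMorgan X (.node (.leaf i) (.leaf j)) = (parIso (X i) (X j)).hom := by
    refine Eq.trans ?_ (Category.id_comp _)
    exact congrArg (· ≫ (parIso (X i) (X j)).hom) (id_tensorHom_id _ _)
  exact (congrArg (fun D => (f ⊗ₘ D) ≫ coname (par (X i) (X j))) h).trans (tensor_coname_eq _ _)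

end StarAutonomous

open StarAutonomous

section Bridge

variable {𝒜 : Type w} {C : Type u} [Category.{v} C] [MonoidalCategory C] [SymmetricCategory C]
  [StarAutonomous C] {G₀ : 𝒜 → C} {link : ℕ → ℕ}

theorem transposes_iff {s t s' t' : Bracketing (Formula 𝒜)}
    {f : srcObj (obj G₀) s ⟶ parObj (obj G₀) t} {f' : srcObj (obj G₀) s' ⟶ parObj (obj G₀) t'} :
    Transposes (obj G₀) f f' ↔
      (⟨.node s' t', decurry (obj G₀) f'⟩ : NetForm G₀) ≋ ⟨.node s t, decurry (obj G₀) f⟩ := .rfl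

theorem decurry_id (A : C) : (𝟙 A ⊗ₘ 𝟙 (dual A)) ≫ coname A = coname A := by simp

theorem decurry_leaf_equiv {A : Formula 𝒜} {s : Bracketing (Formula 𝒜)}
    (f : srcObj (obj G₀) s ⟶ obj G₀ A) :
    (⟨.node s (.leaf A), decurry (obj G₀) (t := .leaf A) f⟩ : NetForm G₀) ≋
      ⟨.node (.leaf A) s, unhat f⟩ :=
  Form.equiv_mk (.braid _ _) (decurry_leaf (obj G₀) f)

/-- The par rule leaves a representative unchanged as an arrow. Only its target is bracketed
differently, which for forms means a De Morgan isomorphism. -/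
theorem decurry_par_equiv {A B : Formula 𝒜} {s : Bracketing (Formula 𝒜)}
    {f : srcObj (obj G₀) s ⟶ par (obj G₀ A) (obj G₀ B)} :
    Plug (Y := fun A => dual (obj G₀ A)) (v := .node (.leaf A) (.leaf B)) (v' := .leaf (.par A B))
      (parIso (obj G₀ A) (obj G₀ B)).hom
      (⟨.node s (.leaf (.par A B)), decurry (obj G₀) (t := .leaf (.par A B)) f⟩ : NetForm G₀)
      ⟨.node s (.node (.leaf A) (.leaf B)),
        decurry (obj G₀) (t := .node (.leaf A) (.leaf B)) f⟩ := by
  refine ⟨s, unhat f, decurry_leaf_equiv _, Form.equiv_mk (.braid _ _) ?_⟩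
  exact decurry_par (obj G₀) f

theorem CutFreeRep.perm_and_der {Γ : List (Formula 𝒜)} {s t : Bracketing (Formula 𝒜)}
    {f : srcObj (obj G₀) s ⟶ parObj (obj G₀) t} (h : CutFreeRep G₀ link Γ s t f) :
    (s.leaves ++ t.leaves).Perm Γ ∧
      Der link (⟨.node s t, decurry (obj G₀) f⟩ : NetForm G₀) := by
  induction h with
  | atom a i j h =>
    exact ⟨.refl _, (Der.ax _ (.atom a i j h)).congr
      (Form.equiv_of_eq (decurry_id (dual (G₀ a))).symm)⟩
  | unit i j h =>
    exact ⟨.refl _, (Der.ax _ (.unit i j h)).congr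
      (Form.equiv_of_eq (decurry_id (dual (𝟙_ C))).symm)⟩
  | par A B Γ s f h ih =>
    refine ⟨?_, ih.2.rule (.par A B) (decurry_par_equiv.symm (Iso.inv_hom_id _))⟩
    have := (List.perm_append_comm.trans ih.1).cons_inv.cons_inv
    exact List.perm_append_comm.trans (this.cons _)
  | tens A B Γ Δ s t f g hf hg ihf ihg =>
    have h₁ := (List.perm_append_comm.trans ihf.1).cons_inv
    have h₂ := (List.perm_append_comm.trans ihg.1).cons_inv
    refine ⟨List.perm_append_comm.trans ((h₁.append h₂).cons _), ?_⟩
    have := Der.tens A B s t (unhat f) (unhat g) (ihf.2.congr (decurry_leaf_equiv f))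
      (ihg.2.congr (decurry_leaf_equiv g))
    rw [hat_unhat, hat_unhat] at this
    exact this.congr (decurry_leaf_equiv (A := .tens A B) (s := .node s t) (f ⊗ₘ g)).symm
  | exchange f hp h ih => exact ⟨ih.1.trans hp, ih.2⟩
  | transpose f f' ht h ih =>
    have := transposes_iff.1 ht
    exact ⟨(Form.perm_of_equiv this).trans ih.1, ih.2.congr this.symm⟩

theorem CutFreeRep.of_equiv {Γ Γ' : List (Formula 𝒜)} {s t s' t' : Bracketing (Formula 𝒜)}
    {f : srcObj (obj G₀) s ⟶ parObj (obj G₀) t} {f' : srcObj (obj G₀) s' ⟶ parObj (obj G₀) t'}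
    (h : CutFreeRep G₀ link Γ s t f)
    (e : (⟨.node s t, decurry (obj G₀) f⟩ : NetForm G₀) ≋ ⟨.node s' t', decurry (obj G₀) f'⟩)
    (hp : (s'.leaves ++ t'.leaves).Perm Γ') : CutFreeRep G₀ link Γ' s' t' f' := by
  refine .exchange _ ?_ (.transpose f f' (transposes_iff.2 e.symm) h)
  exact h.perm_and_der.1.symm.trans ((Form.perm_of_equiv e).trans hp)

/-- The converse of `CutFreeRep.perm_and_der`. It quantifies over all presentations `e` of `φ`,
since intermediate forms need not be de-curried arrows on the given bracketing; this also makes the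
case `conv` immediate. -/
theorem Der.cutFreeRep {φ : NetForm G₀} (h : Der link φ) {Γ : List (Formula 𝒜)}
    {s t : Bracketing (Formula 𝒜)} {f : srcObj (obj G₀) s ⟶ parObj (obj G₀) t}
    (e : φ ≋ ⟨.node s t, decurry (obj G₀) f⟩) (hp : (s.leaves ++ t.leaves).Perm Γ) :
    CutFreeRep G₀ link Γ s t f := by
  induction h generalizing Γ s t with
  | ax φ h =>
    cases h with
    | atom a i j h =>
      refine (CutFreeRep.atom a i j h).of_equiv (.trans (Form.equiv_of_eq ?_) e) hp
      exact decurry_id (dual (G₀ a))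
    | unit i j h =>
      refine (CutFreeRep.unit i j h).of_equiv (.trans (Form.equiv_of_eq ?_) e) hp
      exact decurry_id (dual (𝟙_ C))
  | par A B r m hm ih =>
    obtain ⟨g, hg⟩ := (decurryEquiv (obj G₀) r (.node (.leaf A) (.leaf B))).surjective
      ((β_ _ _).hom ≫ m)
    have e' : (⟨.node (.node (.leaf A) (.leaf B)) r, m⟩ : NetForm G₀) ≋
        ⟨.node r (.node (.leaf A) (.leaf B)), decurry (obj G₀) g⟩ :=
      .symm (Form.equiv_mk (.braid _ _) hg)
    have h₁ := ih (Γ := A :: B :: r.leaves) e' List.perm_append_comm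
    refine (CutFreeRep.par A B _ r g h₁).of_equiv (.trans (decurry_leaf_equiv (A := .par A B) g)
      (.trans (Form.equiv_of_eq ?_) e)) hp
    exact eq_inv_whiskerRight _ ((decurry_par (obj G₀) g).symm.trans hg)
  | tens A B a b m n hm hn ihm ihn =>
    have h₁ := ihm (s := a) (t := .leaf A) (f := hat m) (Γ := A :: a.leaves)
      (.trans (Form.equiv_of_eq (unhat_hat m).symm) (decurry_leaf_equiv (hat m)).symm)
      List.perm_append_comm
    have h₂ := ihn (s := b) (t := .leaf B) (f := hat n) (Γ := B :: b.leaves)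
      (.trans (Form.equiv_of_eq (unhat_hat n).symm) (decurry_leaf_equiv (hat n)).symm)
      List.perm_append_comm
    exact (CutFreeRep.tens A B _ _ a b _ _ h₁ h₂).of_equiv
      (.trans (decurry_leaf_equiv (A := .tens A B) (s := .node a b) (hat m ⊗ₘ hat n)) e) hp
  | conv φ ψ e' h ih => exact ih (e'.trans e) hp

end Bridge

/-! ### The interpretation of a net as its value. -/

section Interpretations

variable {𝒜 : Type w} {C : Type u} [Category.{v} C] [MonoidalCategory C] [SymmetricCategory C]
  [StarAutonomous C] {G₀ : 𝒜 → C}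

variable (G₀) in
/-- The element that closes all cuts of a bracketing. -/
def cutsName : (q : Bracketing (Cut 𝒜)) → (𝟙_ C ⟶ srcObj (obj G₀) (q.map Cut.toTens))
  | .empty => 𝟙 (𝟙_ C)
  | .leaf c => cutName G₀ c
  | .node p q => (λ_ (𝟙_ C)).inv ≫ (cutsName p ⊗ₘ cutsName q)

theorem Bracketing.leaves_map {ι : Type u} {κ : Type v} (g : ι → κ) (q : Bracketing ι) :
    (q.map g).leaves = q.leaves.map g := by
  induction q with
  | empty => rfl
  | leaf i => rfl
  | node p q ihp ihq => simp [Bracketing.map, ihp, ihq]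

theorem cutsName_deMorgan (q : Bracketing (Cut 𝒜)) :
    cutsName G₀ q ≫ deMorgan (obj G₀) (q.map Cut.toTens) = name (zeta G₀ q) := by
  induction q with
  | empty => exact (Category.id_comp _).trans bidual_unit
  | leaf c => exact Category.comp_id _
  | node p q ihp ihq =>
    have h {P Q P' Q' : C} (e : 𝟙_ C ⟶ P) (e' : 𝟙_ C ⟶ Q) (d : P ⟶ dual P') (d' : Q ⟶ dual Q')
        (p : P' ⟶ bot C) (q : Q' ⟶ bot C) (h : e ≫ d = name p) (h' : e' ≫ d' = name q) :
        ((λ_ (𝟙_ C)).inv ≫ (e ⊗ₘ e')) ≫ (d ⊗ₘ d') ≫ (β_ _ _).hom ≫ bidual (dual Q' ⊗ dual P') =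
          name (parMap p q ≫ parBot) := by
      refine Eq.trans ?_ (name_par p q)
      rw [Category.assoc, tensorHom_comp_tensorHom_assoc, h, h']
    exact h _ _ _ _ _ _ ihp ihq

/-- Substituting the tensor of all cut elements at once amounts to closing the cuts one after the
other. -/
theorem Plug.cutPlug {q : Bracketing (Cut 𝒜)} {φ χ : NetForm G₀}
    (h : Plug (v := .empty) (cutsName G₀ q) φ χ) (hn : φ.leaves.Nodup) :
    CutPlug q.leaves φ χ := by
  induction q generalizing φ χ with
  | empty =>
    obtain ⟨s, p, h₁, h₂⟩ := h
    refine .nil _ _ (h₁.trans (.trans (Form.equiv_of_eq ?_) h₂.symm))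
    have h' {S : C} (p : 𝟙_ C ⊗ S ⟶ bot C) : p = 𝟙 (𝟙_ C) ▷ S ≫ p := by simp
    exact h' p
  | leaf c => exact .cons c [] φ χ χ h (.nil _ _ (.refl _))
  | node p q ihp ihq =>
    obtain ⟨Γ, hΓ, -⟩ := h.perm
    have hj : Plug (v := .node (p.map Cut.toTens) (q.map Cut.toTens))
        (v' := .node (p.map Cut.toTens) (q.map Cut.toTens)) (𝟙 _) φ φ := by
      obtain ⟨m, hm⟩ := φ.exists_equiv (t := .node (.node (p.map Cut.toTens) (q.map Cut.toTens))
        (.ofList Γ)) (by simpa [Bracketing.map] using hΓ)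
      refine ⟨_, m, hm, hm.trans (Form.equiv_of_eq ?_)⟩
      have h' {V S : C} (p : V ⊗ S ⟶ bot C) : p = 𝟙 V ▷ S ≫ p := by simp
      exact h' m
    have h' {V S : C} (p : 𝟙_ C ⟶ V) (q : 𝟙_ C ⟶ S) :
        (p ⊗ₘ q) ≫ 𝟙 _ = (λ_ _).hom ≫ (λ_ (𝟙_ C)).inv ≫ (p ⊗ₘ q) := by simp
    obtain ⟨ω, h₁, h₂⟩ := hj.elements (h' (cutsName G₀ p) (cutsName G₀ q)) hn hn
      (Γ := Γ) (by simpa [Bracketing.map] using hΓ) h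
    have hn' : ω.leaves.Nodup := by
      obtain ⟨Δ, p₁, p₂⟩ := h₁.perm
      exact p₂.nodup_iff.2 (List.nodup_append.1 (p₁.nodup_iff.1 hn)).2.1
    exact CutPlug.append_iff.2 ⟨ω, ihp h₁ hn, ihq h₂ hn'⟩

/-- Composition with `zeta` becomes substitution of the cut elements, by `name_unhat` and
`cutsName_deMorgan`. -/
theorem plug_cutsName {r : Bracketing (Formula 𝒜)} {q : Bracketing (Cut 𝒜)}
    (f : srcObj (obj G₀) r ⟶ parObj (obj G₀) (q.map Cut.toTens)) :
    Plug (v := .empty) (cutsName G₀ q)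
      (⟨.node r (q.map Cut.toTens), decurry (obj G₀) f⟩ : NetForm G₀)
      ⟨.node r .empty, decurry (obj G₀) (t := .empty) (f ≫ zeta G₀ q)⟩ := by
  have h {R P Q : C} (e : 𝟙_ C ⟶ Q) (d : Q ⟶ dual P) (z : P ⟶ bot C) (hz : e ≫ d = name z)
      (f : R ⟶ P) : ((f ≫ z) ⊗ₘ bidual (𝟙_ C)) ≫ coname (bot C) =
        (β_ _ _).hom ≫ e ▷ R ≫ d ▷ R ≫ unhat f := by
    rw [tensor_coname_eq, bidual_unit, name_unhat, ← comp_whiskerRight_assoc, hz, name_unhat,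
      Category.comp_id]
  refine ⟨r, _, Form.equiv_mk (.braid _ _) (tensor_coname_eq _ f),
    Form.equiv_mk (.braid _ _) ?_⟩
  exact h _ _ _ (cutsName_deMorgan q) f

/-- The order of the cuts and the choice of bracketings do not affect the closed form, so any
witness of the value can be rearranged into the shape that `GFlat` asks for. -/
theorem gFlat_iff {π : PreNet 𝒜} {s t : Bracketing (Formula 𝒜)}
    {f : srcObj (obj G₀) s ⟶ parObj (obj G₀) t} :
    GFlat G₀ π s t f ↔ Val π (⟨.node s t, decurry (obj G₀) f⟩ : NetForm G₀) := by
  constructor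
  · rintro ⟨r, q, f₀, hr, hq, h, ht⟩
    obtain ⟨hp, hd⟩ := h.perm_and_der
    have hn := (π.distinct.perm hp.symm).nodup
    exact ⟨_, hd, hp, (((plug_cutsName f₀).cutPlug hn).of_perm hq hn).congr
      (transposes_iff.1 ht).symm⟩
  · rintro ⟨φ, hd, hp, hc⟩
    let q : Bracketing (Cut 𝒜) := .ofList π.cuts
    let r : Bracketing (Formula 𝒜) := .ofList π.concl
    have hq : q.leaves = π.cuts := Bracketing.leaves_ofList _
    have hr : r.leaves = π.concl := Bracketing.leaves_ofList _
    have hrq : (r.leaves ++ (q.map Cut.toTens).leaves) = π.sequent := by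
      rw [Bracketing.leaves_map, hq, hr, PreNet.sequent]
    obtain ⟨m, hm⟩ := φ.exists_equiv (t := .node r (q.map Cut.toTens)) (by
      rw [Bracketing.leaves, hrq]; exact hp)
    obtain ⟨f₀, hf₀⟩ := (decurryEquiv (obj G₀) r (q.map Cut.toTens)).surjective m
    have e : φ ≋ ⟨.node r (q.map Cut.toTens), decurry (obj G₀) f₀⟩ :=
      hm.trans (Form.equiv_of_eq hf₀.symm)
    have hn := (π.distinct.perm hp.symm).nodup
    have hc' := (plug_cutsName f₀).cutPlug ((Form.perm_of_equiv e).nodup_iff.1 hn)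
    rw [hq] at hc'
    exact ⟨r, q, f₀, .of_eq hr, .of_eq hq, hd.cutFreeRep e (.of_eq hrq),
      transposes_iff.2 (hc.unique hc' e hn)⟩

end Interpretations

/-! ### Switching hypergraphs -/

section Hypergraphs

variable {V : Type u} {E : Type v}

/-- Every nontrivial set of vertices is separated from its complement by all choices for some
hyperedge, which joins the vertex `b h` to one of the vertices `l h` and `r h`. -/
def Linked (K : Finset V) (H : Finset E) (b l r : E → V) : Prop :=
  ∀ S : V → Prop, (∃ k ∈ K, S k) → (∃ k ∈ K, ¬ S k) →
    ∃ h ∈ H, (S (b h) ∧ ¬ S (l h) ∧ ¬ S (r h)) ∨ (¬ S (b h) ∧ S (l h) ∧ S (r h))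

/-- Grow a set of vertices from one vertex. While it is not everything, some hyperedge separates it
from the rest; this hyperedge was not used before, and one of its ends is a new vertex. -/
theorem Linked.card_le [DecidableEq V] [DecidableEq E] {K : Finset V} {H : Finset E}
    {b l r : E → V} (hL : Linked K H b l r) (hb : ∀ h ∈ H, b h ∈ K) (hl : ∀ h ∈ H, l h ∈ K) :
    K.card ≤ H.card + 1 := by
  rcases K.eq_empty_or_nonempty with rfl | ⟨k₀, hk₀⟩
  · simp
  have key : ∀ n, n + 1 ≤ K.card → ∃ S ⊆ K, ∃ T ⊆ H, S.card = n + 1 ∧ T.card = n ∧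
      ∀ h ∈ T, b h ∈ S ∧ l h ∈ S := by
    intro n
    induction n with
    | zero => exact fun _ => ⟨{k₀}, by simpa, ∅, by simp, by simp, by simp, by simp⟩
    | succ n ih =>
      intro hn
      obtain ⟨S, hS, T, hT, cS, cT, hST⟩ := ih (by omega)
      obtain ⟨k, hk, hkS⟩ : ∃ k ∈ K, k ∉ S := by
        by_contra! h
        have := Finset.card_le_card (show K ⊆ S from h)
        omega
      obtain ⟨k', hk'⟩ : S.Nonempty := Finset.card_pos.1 (by omega)
      obtain ⟨h, hh, hc⟩ := hL (· ∈ S) ⟨k', hS hk', hk'⟩ ⟨k, hk, hkS⟩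
      have hhT : h ∉ T := fun h' => by have := hST h h'; tauto
      rcases hc with ⟨h₁, h₂, -⟩ | ⟨h₁, h₂, -⟩
      · refine ⟨insert (l h) S, Finset.insert_subset (hl h hh) hS, insert h T,
          Finset.insert_subset hh hT, ?_, ?_, ?_⟩
        · rw [Finset.card_insert_of_notMem h₂, cS]
        · rw [Finset.card_insert_of_notMem hhT, cT]
        · intro h' hh'
          rcases Finset.mem_insert.1 hh' with rfl | hh'
          · simp [h₁]
          · simp [hST h' hh']
      · refine ⟨insert (b h) S, Finset.insert_subset (hb h hh) hS, insert h T,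
          Finset.insert_subset hh hT, ?_, ?_, ?_⟩
        · rw [Finset.card_insert_of_notMem h₁, cS]
        · rw [Finset.card_insert_of_notMem hhT, cT]
        · intro h' hh'
          rcases Finset.mem_insert.1 hh' with rfl | hh'
          · simp [h₂]
          · simp [hST h' hh']
  have hpos := Finset.card_pos.2 ⟨k₀, hk₀⟩
  obtain ⟨S, hS, T, hT, cS, cT, -⟩ := key (K.card - 1) (by omega)
  have := Finset.card_le_card hT
  omega

/-- Extend `S` from `K₁` by its value at `k₁`. A hyperedge outside `H₁` then has its base and its
left target on the side of `k₁`, so the separating hyperedge belongs to `H₁`. -/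
theorem Linked.restrict {K K₁ : Finset V} {H H₁ : Finset E}
    {b l r : E → V} (hL : Linked K H b l r) (hK : K₁ ⊆ K) {k₁ : V}
    (hb : ∀ h ∈ H₁, b h ∈ K₁) (hl : ∀ h ∈ H₁, l h ∈ K₁) (hr : ∀ h ∈ H₁, r h ∈ K₁)
    (hH : ∀ h ∈ H, h ∈ H₁ ∨ (b h ∈ K₁ → b h = k₁) ∧ (l h ∈ K₁ → l h = k₁)) :
    Linked K₁ H₁ b l r := by
  classical
  rintro S ⟨k, hk, hSk⟩ ⟨k', hk', hSk'⟩
  let S' : V → Prop := fun v => if v ∈ K₁ then S v else S k₁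
  have hS' : ∀ v ∈ K₁, (S' v ↔ S v) := fun v hv => by simp [S', hv]
  obtain ⟨h, hh, hc⟩ := hL S' ⟨k, hK hk, (hS' k hk).2 hSk⟩ ⟨k', hK hk', fun h => hSk' ((hS' k' hk').1 h)⟩
  rcases hH h hh with h₁ | ⟨h₁, h₂⟩
  · refine ⟨h, h₁, ?_⟩
    rwa [hS' _ (hb h h₁), hS' _ (hl h h₁), hS' _ (hr h h₁)] at hc
  · have e₁ : S' (b h) ↔ S k₁ := by
      by_cases hm : b h ∈ K₁
      · rw [hS' _ hm, h₁ hm]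
      · simp [S', hm]
    have e₂ : S' (l h) ↔ S k₁ := by
      by_cases hm : l h ∈ K₁
      · rw [hS' _ hm, h₂ hm]
      · simp [S', hm]
    tauto

/-- A linked hypergraph with few hyperedges has a vertex that splits it: `ρ` assigns to any other
vertex the hyperedge at `c` that leads to its component. -/
theorem Linked.exists_splitting [DecidableEq V] [DecidableEq E] [Nonempty E] (n : ℕ) {K : Finset V}
    {H : Finset E} {b l r : E → V} (hn : K.card = n) (hL : Linked K H b l r)
    (hb : ∀ h ∈ H, b h ∈ K) (hl : ∀ h ∈ H, l h ∈ K) (hr : ∀ h ∈ H, r h ∈ K)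
    (hc : H.card < K.card) :
    ∃ c ∈ K, ∃ ρ : V → E, (∀ k ∈ K, k ≠ c → ρ k ∈ H ∧ b (ρ k) = c) ∧
      ∀ h ∈ H, l h ≠ c ∧ r h ≠ c ∧ (b h = c → ρ (l h) = h ∧ ρ (r h) = h) ∧
        (b h ≠ c → ρ (l h) = ρ (b h) ∧ ρ (r h) = ρ (b h)) := by
  induction n generalizing K H b l r with
  | zero => omega
  | succ n ih =>
    by_cases hK1 : K.card = 1
    · obtain ⟨c, rfl⟩ := Finset.card_eq_one.1 hK1
      have hH : H = ∅ := by
        rw [← Finset.card_eq_zero]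
        simpa using hc
      subst hH
      exact ⟨c, by simp, fun _ => Classical.arbitrary E, by simp, by simp⟩
    -- Without such a hyperedge, separating a single vertex from the others would make every vertex
    -- the base of a hyperedge, against `H.card < K.card`.
    obtain ⟨e, he, hle, hbe⟩ : ∃ e ∈ H, l e = r e ∧ l e ≠ b e := by
      by_contra! hno
      have : ∀ k ∈ K, ∃ h ∈ H, b h = k := by
        intro k hk
        obtain ⟨k', hk', hne⟩ : ∃ k' ∈ K, k' ≠ k := by
          by_contra! h
          exact hK1 (Finset.card_eq_one.2 ⟨k, by ext x; simp; exact ⟨h x, by rintro rfl; exact hk⟩⟩)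
        obtain ⟨h, hh, hc⟩ := hL (· = k) ⟨k, hk, rfl⟩ ⟨k', hk', hne⟩
        rcases hc with ⟨h₁, -⟩ | ⟨h₁, h₂, h₃⟩
        · exact ⟨h, hh, h₁⟩
        · exact (h₁ ((hno h hh (h₂.trans h₃.symm)).symm.trans h₂)).elim
      have hsub : K ⊆ H.image b := fun k hk => by
        obtain ⟨h, hh, rfl⟩ := this k hk
        exact Finset.mem_image_of_mem b hh
      have := (Finset.card_le_card hsub).trans Finset.card_image_le
      omega
    set c₁ := l e with hc₁
    set b₁ := b e with hb₁
    -- Contract `e` by identifying its only target `c₁` with its base `b₁`; vertices and hyperedges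
    -- both decrease by one.
    let p : V → V := fun v => if v = c₁ then b₁ else v
    have hpc : p c₁ = b₁ := by simp [p]
    have hp : ∀ v, v ≠ c₁ → p v = v := fun v hv => by simp [p, hv]
    have hpK : ∀ v ∈ K, p v ∈ K.erase c₁ := fun v hv => by
      by_cases h : v = c₁
      · rw [h, hpc]; exact Finset.mem_erase.2 ⟨hbe.symm, hb e he⟩
      · rw [hp v h]; exact Finset.mem_erase.2 ⟨h, hv⟩
    have hc₁K : c₁ ∈ K := hl e he
    have hL' : Linked (K.erase c₁) (H.erase e) (p ∘ b) (p ∘ l) (p ∘ r) := by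
      rintro S ⟨k, hk, hSk⟩ ⟨k', hk', hSk'⟩
      obtain ⟨h, hh, hcr⟩ := hL (fun v => S (p v))
        ⟨k, (Finset.mem_erase.1 hk).2, by rwa [hp k (Finset.mem_erase.1 hk).1]⟩
        ⟨k', (Finset.mem_erase.1 hk').2, by rwa [hp k' (Finset.mem_erase.1 hk').1]⟩
      refine ⟨h, Finset.mem_erase.2 ⟨?_, hh⟩, hcr⟩
      rintro rfl
      have h₁ : p (l h) = b₁ := hpc
      have h₂ : p (b h) = b₁ := hp _ hbe.symm
      simp only [h₁, h₂] at hcr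
      tauto
    obtain ⟨c, hcK, ρ, h₁, h₂⟩ := ih (K := K.erase c₁) (H := H.erase e) (b := p ∘ b) (l := p ∘ l)
      (r := p ∘ r) (by rw [Finset.card_erase_of_mem hc₁K]; omega) hL'
      (fun h hh => hpK _ (hb h (Finset.mem_erase.1 hh).2))
      (fun h hh => hpK _ (hl h (Finset.mem_erase.1 hh).2))
      (fun h hh => hpK _ (hr h (Finset.mem_erase.1 hh).2))
      (by rw [Finset.card_erase_of_mem hc₁K, Finset.card_erase_of_mem he]; 
          have := Finset.card_pos.2 ⟨e, he⟩; omega)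
    obtain ⟨hcc₁, hcK⟩ := Finset.mem_erase.1 hcK
    simp only [Finset.mem_erase, Function.comp] at h₁ h₂
    by_cases hcb : c = b₁
    · subst hcb
      have hp' : ∀ v, p v = b₁ ↔ v = b₁ ∨ v = c₁ := fun v => by
        by_cases h : v = c₁
        · simp [h, hpc]
        · simp [hp v h, h]
      -- The contracted vertex splits. Components reached through a hyperedge at `c₁` are now
      -- reached from `b₁` through `e`.
      refine ⟨b₁, hcK, fun k => if k = c₁ then e else if b (ρ k) = b₁ then ρ k else e, ?_, ?_⟩
      · intro k hk hkb
        by_cases hkc : k = c₁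
        · simp [hkc, he, ← hb₁]
        · obtain ⟨h₃, h₄⟩ := h₁ k ⟨hkc, hk⟩ hkb
          by_cases hbk : b (ρ k) = b₁
          · simp [hkc, hbk, h₃.2]
          · simp [hkc, hbk, he, ← hb₁]
      · intro h hh
        by_cases hhe : h = e
        · subst hhe
          refine ⟨hbe, hle ▸ hbe, fun _ => ?_, fun h' => (h' rfl).elim⟩
          rw [← hle, ← hc₁]
          simp
        · obtain ⟨h₃, h₄, h₅, h₆⟩ := h₂ h ⟨hhe, hh⟩
          rw [Ne, hp', not_or] at h₃ h₄
          rw [hp _ h₃.2, hp _ h₄.2] at h₅ h₆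
          refine ⟨h₃.1, h₄.1, fun hbh => ?_, fun hbh => ?_⟩
          · obtain ⟨h₇, h₈⟩ := h₅ ((hp' _).2 (.inl hbh))
            simp [h₃.2, h₄.2, h₇, h₈, hbh]
          · by_cases hbc : b h = c₁
            · obtain ⟨h₇, h₈⟩ := h₅ ((hp' _).2 (.inr hbc))
              simp [h₃.2, h₄.2, h₇, h₈, hbc, hbe]
            · obtain ⟨h₇, h₈⟩ := h₆ (by rw [Ne, hp']; tauto)
              rw [hp _ hbc] at h₇ h₈
              simp [h₃.2, h₄.2, h₇, h₈, hbc]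
    · have hp' : ∀ v, p v = c ↔ v = c := fun v => by
        by_cases h : v = c₁
        · rw [h, hpc]
          exact ⟨fun h => (hcb h.symm).elim, fun h => (hcc₁ h.symm).elim⟩
        · rw [hp v h]
      refine ⟨c, hcK, fun k => ρ (p k), ?_, ?_⟩
      · intro k hk hkc
        obtain ⟨h₃, h₄⟩ := h₁ (p k) (Finset.mem_erase.1 (hpK k hk)) (by rwa [Ne, hp'])
        exact ⟨h₃.2, (hp' _).1 h₄⟩
      · intro h hh
        by_cases hhe : h = e
        · subst hhe
          refine ⟨hcc₁.symm, hle ▸ hcc₁.symm, fun h' => (hcb h'.symm).elim, fun h' => ?_⟩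
          simp only [← hle, ← hb₁, ← hc₁, hpc, hp b₁ hbe.symm, and_self]
        · obtain ⟨h₃, h₄, h₅, h₆⟩ := h₂ h ⟨hhe, hh⟩
          rw [Ne, hp'] at h₃ h₄
          refine ⟨h₃, h₄, fun hbh => h₅ ((hp' _).2 hbh), fun hbh => h₆ (by rwa [Ne, hp'])⟩

end Hypergraphs

/-! ### Sequentialization -/

section Sequentialization

variable {𝒜 : Type w}

/-- The vertex that represents a formula: the two ends of an axiom link are identified. -/
def vertex (link : ℕ → ℕ) : Formula 𝒜 → Formula 𝒜
  | .leaf _ i => .leaf .one (min i (link i))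
  | .tens A B => .tens A B
  | .par A B => .par A B

/-- The hyperedges of a formula: two for every tensor, one for every par. -/
def Formula.hyper : Formula 𝒜 → List (Formula 𝒜 × Bool)
  | .leaf _ _ => []
  | .tens A B => (.tens A B, true) :: (.tens A B, false) :: (A.hyper ++ B.hyper)
  | .par A B => (.par A B, true) :: (A.hyper ++ B.hyper)

/-- The first possible target of a hyperedge. -/
def hyperLeft (link : ℕ → ℕ) : Formula 𝒜 × Bool → Formula 𝒜
  | (.leaf l i, _) => .leaf l i
  | (.tens A _, true) => vertex link A
  | (.tens _ B, false) => vertex link B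
  | (.par A _, _) => vertex link A

/-- The second possible target of a hyperedge. -/
def hyperRight (link : ℕ → ℕ) : Formula 𝒜 × Bool → Formula 𝒜
  | (.leaf l i, _) => .leaf l i
  | (.tens A _, true) => vertex link A
  | (.tens _ B, false) => vertex link B
  | (.par _ B, _) => vertex link B

/-- The nodes of a sequent. -/
def seqNodes (Γ : List (Formula 𝒜)) : List (Formula 𝒜) := Γ.flatMap Formula.nodes

/-- The hyperedges of a sequent. -/
def seqHyper (Γ : List (Formula 𝒜)) : List (Formula 𝒜 × Bool) := Γ.flatMap Formula.hyper

theorem mem_seqNodes {Γ : List (Formula 𝒜)} {F : Formula 𝒜} :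
    F ∈ seqNodes Γ ↔ ∃ A ∈ Γ, F ∈ A.nodes := by simp [seqNodes]

theorem mem_seqHyper {Γ : List (Formula 𝒜)} {h : Formula 𝒜 × Bool} :
    h ∈ seqHyper Γ ↔ ∃ A ∈ Γ, h ∈ A.hyper := by simp [seqHyper]

open Classical in
/-- The vertices of a sequent. -/
noncomputable def vertices (link : ℕ → ℕ) (Γ : List (Formula 𝒜)) : Finset (Formula 𝒜) :=
  (seqNodes Γ).toFinset.image (vertex link)

open Classical in
/-- The set of hyperedges of a sequent. -/
noncomputable def hyperedges (Γ : List (Formula 𝒜)) : Finset (Formula 𝒜 × Bool) :=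
  (seqHyper Γ).toFinset

theorem mem_vertices {link : ℕ → ℕ} {Γ : List (Formula 𝒜)} {k : Formula 𝒜} :
    k ∈ vertices link Γ ↔ ∃ A ∈ Γ, ∃ F ∈ A.nodes, vertex link F = k := by
  simp only [vertices, Finset.mem_image, List.mem_toFinset, mem_seqNodes]
  grind

theorem mem_hyperedges {Γ : List (Formula 𝒜)} {h : Formula 𝒜 × Bool} :
    h ∈ hyperedges Γ ↔ ∃ A ∈ Γ, h ∈ A.hyper := by
  simp only [hyperedges, List.mem_toFinset, mem_seqHyper]

theorem Formula.self_mem_nodes (A : Formula 𝒜) : A ∈ A.nodes := by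
  cases A <;> simp [Formula.nodes]

theorem Formula.nodes_trans {A F G : Formula 𝒜} (hF : F ∈ A.nodes) (hG : G ∈ F.nodes) :
    G ∈ A.nodes := by
  induction A with
  | leaf l i => simp_all [Formula.nodes]
  | tens A B ihA ihB =>
    simp only [Formula.nodes, List.mem_cons, List.mem_append] at hF ⊢
    rcases hF with rfl | hF | hF
    · simpa [Formula.nodes] using hG
    · exact .inr (.inl (ihA hF))
    · exact .inr (.inr (ihB hF))
  | par A B ihA ihB =>
    simp only [Formula.nodes, List.mem_cons, List.mem_append] at hF ⊢
    rcases hF with rfl | hF | hF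
    · simpa [Formula.nodes] using hG
    · exact .inr (.inl (ihA hF))
    · exact .inr (.inr (ihB hF))

theorem Formula.idx_of_mem_nodes {A F : Formula 𝒜} (hF : F ∈ A.nodes) {i : ℕ} (hi : i ∈ F.idx) :
    i ∈ A.idx := by
  induction A with
  | leaf l j =>
    simp only [Formula.nodes, List.mem_singleton] at hF
    exact hF ▸ hi
  | tens A B ihA ihB =>
    simp only [Formula.nodes, List.mem_cons, List.mem_append] at hF
    rcases hF with rfl | hF | hF
    · exact hi
    · simp [ihA hF]
    · simp [ihB hF]
  | par A B ihA ihB =>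
    simp only [Formula.nodes, List.mem_cons, List.mem_append] at hF
    rcases hF with rfl | hF | hF
    · exact hi
    · simp [ihA hF]
    · simp [ihB hF]

/-- The nodes with their hyperedges. -/
theorem Formula.mem_hyper {A : Formula 𝒜} {h : Formula 𝒜 × Bool} :
    h ∈ A.hyper ↔ h.1 ∈ A.nodes ∧
      ((∃ B D, h.1 = .tens B D) ∨ (∃ B D, h.1 = .par B D) ∧ h.2 = true) := by
  obtain ⟨F, x⟩ := h
  induction A with
  | leaf l i =>
    simp only [Formula.hyper, Formula.nodes, List.not_mem_nil, List.mem_singleton, false_iff]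
    rintro ⟨rfl, h⟩
    simp at h
  | tens A B ihA ihB =>
    simp only [Formula.hyper, Formula.nodes, List.mem_cons, List.mem_append, ihA, ihB,
      Prod.mk.injEq]
    by_cases hF : F = .tens A B
    · cases x <;> simp [hF]
    · simp only [hF, false_and, false_or, or_and_right]
  | par A B ihA ihB =>
    simp only [Formula.hyper, Formula.nodes, List.mem_cons, List.mem_append, ihA, ihB,
      Prod.mk.injEq]
    by_cases hF : F = .par A B
    · cases x <;> simp [hF]
    · simp only [hF, false_and, false_or, or_and_right]

theorem hyper_target {link : ℕ → ℕ} {A : Formula 𝒜} {h : Formula 𝒜 × Bool} (hh : h ∈ A.hyper) :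
    vertex link h.1 = h.1 ∧ (∃ F ∈ A.nodes, vertex link F = hyperLeft link h) ∧
      ∃ F ∈ A.nodes, vertex link F = hyperRight link h := by
  obtain ⟨h₁, h₂⟩ := Formula.mem_hyper.1 hh
  obtain ⟨F, x⟩ := h
  rcases h₂ with ⟨B, D, rfl⟩ | ⟨⟨B, D, rfl⟩, rfl⟩
  · have hB : B ∈ A.nodes := Formula.nodes_trans h₁ (by simp [Formula.nodes, Formula.self_mem_nodes])
    have hD : D ∈ A.nodes := Formula.nodes_trans h₁ (by simp [Formula.nodes, Formula.self_mem_nodes])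
    cases x
    · exact ⟨rfl, ⟨D, hD, rfl⟩, ⟨D, hD, rfl⟩⟩
    · exact ⟨rfl, ⟨B, hB, rfl⟩, ⟨B, hB, rfl⟩⟩
  · have hB : B ∈ A.nodes := Formula.nodes_trans h₁ (by simp [Formula.nodes, Formula.self_mem_nodes])
    have hD : D ∈ A.nodes := Formula.nodes_trans h₁ (by simp [Formula.nodes, Formula.self_mem_nodes])
    exact ⟨rfl, ⟨B, hB, rfl⟩, ⟨D, hD, rfl⟩⟩

/-- A node is the root or the target of a hyperedge. -/
theorem Formula.eq_or_target {link : ℕ → ℕ} {A F : Formula 𝒜} (hF : F ∈ A.nodes) :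
    F = A ∨ ∃ h ∈ A.hyper, hyperLeft link h = vertex link F ∨ hyperRight link h = vertex link F := by
  induction A with
  | leaf l i => exact .inl (by simpa [Formula.nodes] using hF)
  | tens A B ihA ihB =>
    simp only [Formula.nodes, List.mem_cons, List.mem_append] at hF
    rcases hF with rfl | hF | hF
    · exact .inl rfl
    · right
      rcases ihA hF with rfl | ⟨h, hh, h'⟩
      · exact ⟨_, List.mem_cons_self, .inl rfl⟩
      · exact ⟨h, by simp [Formula.hyper, hh], h'⟩
    · right
      rcases ihB hF with rfl | ⟨h, hh, h'⟩
      · exact ⟨_, List.mem_cons_of_mem _ List.mem_cons_self, .inl rfl⟩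
      · exact ⟨h, by simp [Formula.hyper, hh], h'⟩
  | par A B ihA ihB =>
    simp only [Formula.nodes, List.mem_cons, List.mem_append] at hF
    rcases hF with rfl | hF | hF
    · exact .inl rfl
    · right
      rcases ihA hF with rfl | ⟨h, hh, h'⟩
      · exact ⟨_, List.mem_cons_self, .inl rfl⟩
      · exact ⟨h, by simp [Formula.hyper, hh], h'⟩
    · right
      rcases ihB hF with rfl | ⟨h, hh, h'⟩
      · exact ⟨_, List.mem_cons_self, .inr rfl⟩
      · exact ⟨h, by simp [Formula.hyper, hh], h'⟩

theorem Formula.leaf_mem_nodes {A : Formula 𝒜} {l : Label 𝒜} {i : ℕ} :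
    .leaf l i ∈ A.nodes ↔ (l, i) ∈ A.leaves := by
  induction A with
  | leaf l' j => simp [Formula.nodes, Formula.leaves]
  | tens A B ihA ihB => simp [Formula.nodes, Formula.leaves, ihA, ihB]
  | par A B ihA ihB => simp [Formula.nodes, Formula.leaves, ihA, ihB]

/-- A function that is compatible with the hyperedges is constant on a formula. -/
theorem Formula.const_of_hyper {link : ℕ → ℕ} {X : Type*} {ρ : Formula 𝒜 → X} {A : Formula 𝒜}
    (hρ : ∀ h ∈ A.hyper, ρ (hyperLeft link h) = ρ h.1 ∧ ρ (hyperRight link h) = ρ h.1) :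
    ∀ F ∈ A.nodes, ρ (vertex link F) = ρ (vertex link A) := by
  induction A with
  | leaf l i =>
    intro F hF
    simp only [Formula.nodes, List.mem_singleton] at hF
    rw [hF]
  | tens A B ihA ihB =>
    have h₁ := (hρ (.tens A B, true) (by simp [Formula.hyper])).1
    have h₂ := (hρ (.tens A B, false) (by simp [Formula.hyper])).1
    have iA := ihA fun h hh => hρ h (by simp [Formula.hyper, hh])
    have iB := ihB fun h hh => hρ h (by simp [Formula.hyper, hh])
    intro F hF
    simp only [Formula.nodes, List.mem_cons, List.mem_append] at hF
    rcases hF with rfl | hF | hF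
    · rfl
    · exact (iA F hF).trans h₁
    · exact (iB F hF).trans h₂
  | par A B ihA ihB =>
    have h₁ := hρ (.par A B, true) (by simp [Formula.hyper])
    have iA := ihA fun h hh => hρ h (by simp [Formula.hyper, hh])
    have iB := ihB fun h hh => hρ h (by simp [Formula.hyper, hh])
    intro F hF
    simp only [Formula.nodes, List.mem_cons, List.mem_append] at hF
    rcases hF with rfl | hF | hF
    · rfl
    · exact (iA F hF).trans h₁.1
    · exact (iB F hF).trans h₁.2

theorem Formula.not_mem_of_distinct {Γ : List (Formula 𝒜)} {F A : Formula 𝒜}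
    (hΓ : Distinct (F :: Γ)) (hA : A ∈ Γ) : F ∉ A.nodes := fun h => by
  obtain ⟨i, hi⟩ := exists_mem_idx F
  rw [Distinct, idx_cons, List.nodup_append] at hΓ
  exact hΓ.2.2 i hi i (mem_idx_of_mem hA (Formula.idx_of_mem_nodes h hi)) rfl

theorem Formula.length_le {A F : Formula 𝒜} (hF : F ∈ A.nodes) : F.idx.length ≤ A.idx.length := by
  induction A with
  | leaf l j =>
    simp only [Formula.nodes, List.mem_singleton] at hF
    rw [hF]
  | tens A B ihA ihB =>
    simp only [Formula.nodes, List.mem_cons, List.mem_append] at hF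
    rcases hF with rfl | hF | hF
    · rfl
    · have := ihA hF; simp; omega
    · have := ihB hF; simp; omega
  | par A B ihA ihB =>
    simp only [Formula.nodes, List.mem_cons, List.mem_append] at hF
    rcases hF with rfl | hF | hF
    · rfl
    · have := ihA hF; simp; omega
    · have := ihB hF; simp; omega

theorem Formula.length_pos (A : Formula 𝒜) : 0 < A.idx.length := by
  obtain ⟨i, hi⟩ := exists_mem_idx A
  exact List.length_pos_of_mem hi

/-- The combinatorial content of correctness. -/
structure Sound (link : ℕ → ℕ) (Γ : List (Formula 𝒜)) : Prop where
  distinct : Distinct Γ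
  link_mem : ∀ l i, (l, i) ∈ seqLeaves Γ → (l.dual, link i) ∈ seqLeaves Γ
  link_link : ∀ i ∈ idx Γ, link (link i) = i
  linked : Linked (vertices link Γ) (hyperedges Γ) Prod.fst (hyperLeft link) (hyperRight link)
  card : (seqHyper Γ).length < (vertices link Γ).card

theorem Sound.perm {link : ℕ → ℕ} {Γ Δ : List (Formula 𝒜)} (h : Sound link Γ) (hp : Γ.Perm Δ) :
    Sound link Δ := by
  have hs : ∀ x, x ∈ seqLeaves Γ ↔ x ∈ seqLeaves Δ := fun x => (hp.flatMap_right _).mem_iff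
  have hv : vertices link Γ = vertices link Δ := by
    ext k; simp only [mem_vertices, hp.mem_iff]
  have hh : hyperedges Γ = hyperedges Δ := by
    ext k; simp only [mem_hyperedges, hp.mem_iff]
  exact ⟨h.distinct.perm hp, fun l i hi => (hs _).1 (h.link_mem l i ((hs _).2 hi)),
    fun i hi => h.link_link i ((mem_idx_of_perm hp).2 hi), hv ▸ hh ▸ h.linked,
    hv ▸ (hp.flatMap_right _).length_eq ▸ h.card⟩

theorem fst_mem_vertices {link : ℕ → ℕ} {Γ : List (Formula 𝒜)} :
    ∀ h ∈ hyperedges Γ, h.1 ∈ vertices link Γ := fun h hh => by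
  obtain ⟨A, hA, hh⟩ := mem_hyperedges.1 hh
  exact mem_vertices.2 ⟨A, hA, h.1, (Formula.mem_hyper.1 hh).1, (hyper_target hh).1⟩

theorem left_mem_vertices {link : ℕ → ℕ} {Γ : List (Formula 𝒜)} :
    ∀ h ∈ hyperedges Γ, hyperLeft link h ∈ vertices link Γ := fun h hh => by
  obtain ⟨A, hA, hh⟩ := mem_hyperedges.1 hh
  exact mem_vertices.2 ⟨A, hA, (hyper_target hh).2.1⟩

theorem right_mem_vertices {link : ℕ → ℕ} {Γ : List (Formula 𝒜)} :
    ∀ h ∈ hyperedges Γ, hyperRight link h ∈ vertices link Γ := fun h hh => by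
  obtain ⟨A, hA, hh⟩ := mem_hyperedges.1 hh
  exact mem_vertices.2 ⟨A, hA, (hyper_target hh).2.2⟩

theorem card_hyperedges_le (Γ : List (Formula 𝒜)) : (hyperedges Γ).card ≤ (seqHyper Γ).length := by
  classical
  rw [hyperedges]
  convert List.toFinset_card_le (seqHyper Γ)

end Sequentialization

/-! ### Provable sequents, and the parts of a sound sequent. -/

section Splitting

variable {𝒜 : Type w} {link : ℕ → ℕ}

/-- The sequents that are derivable with the given axiom links. -/
inductive Provable (link : ℕ → ℕ) : List (Formula 𝒜) → Prop
  | ax (l : Label 𝒜) (i j : ℕ) : link i = j → link j = i →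
      Provable link [.leaf l i, .leaf l.dual j]
  | par (A B : Formula 𝒜) (Γ : List (Formula 𝒜)) :
      Provable link (A :: B :: Γ) → Provable link (.par A B :: Γ)
  | tens (A B : Formula 𝒜) (Γ Δ : List (Formula 𝒜)) :
      Provable link (A :: Γ) → Provable link (B :: Δ) → Provable link (.tens A B :: (Γ ++ Δ))
  | perm (Γ Δ : List (Formula 𝒜)) : Γ.Perm Δ → Provable link Γ → Provable link Δ

theorem Provable.exists_der {C : Type u} [Category.{v} C] [MonoidalCategory C]
    [SymmetricCategory C] [StarAutonomous C] (G₀ : 𝒜 → C) {Γ : List (Formula 𝒜)}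
    (h : Provable link Γ) : ∃ φ : NetForm G₀, Der link φ ∧ φ.leaves.Perm Γ := by
  induction h with
  | ax l i j h h' => exact ⟨_, Der.linkArr h h' l, .refl _⟩
  | par A B Γ _ ih =>
    obtain ⟨φ, hφ, hp⟩ := ih
    obtain ⟨χ, h₁, h₂⟩ := Plug.exists_of_perm (Y := fun A => dual (obj G₀ A))
      (v := .leaf (.par A B)) (v' := .node (.leaf A) (.leaf B))
      (parIso (obj G₀ A) (obj G₀ B)).inv (φ := φ) (Γ := Γ) hp
    exact ⟨χ, hφ.rule (.par A B) h₁, h₂⟩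
  | tens A B Γ Δ _ _ ih ih' =>
    obtain ⟨φ, hφ, hp⟩ := ih
    obtain ⟨ψ, hψ, hp'⟩ := ih'
    obtain ⟨χ, hχ⟩ := TensOf.exists_of_perm hp hp'
    refine ⟨χ, hχ.der hφ hψ, ?_⟩
    obtain ⟨Γ', Δ', h₁, h₂, h₃⟩ := hχ.perm
    exact h₃.trans (List.Perm.cons _ (((hp.symm.trans h₁).cons_inv.symm).append
      (hp'.symm.trans h₂).cons_inv.symm))
  | perm Γ Δ h _ ih =>
    obtain ⟨φ, hφ, hp⟩ := ih
    exact ⟨φ, hφ, hp.trans h⟩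

theorem vertex_mem_of_leaf {Γ : List (Formula 𝒜)} {l : Label 𝒜} {i : ℕ}
    (h : (l, i) ∈ seqLeaves Γ) : vertex link (.leaf l i) ∈ vertices link Γ := by
  obtain ⟨A, hA, h⟩ := List.mem_flatMap.1 h
  exact mem_vertices.2 ⟨A, hA, _, Formula.leaf_mem_nodes.2 h, rfl⟩

theorem mem_vertices_cons {Γ : List (Formula 𝒜)} {A k : Formula 𝒜} :
    k ∈ vertices link (A :: Γ) ↔ (∃ F ∈ A.nodes, vertex link F = k) ∨ k ∈ vertices link Γ := by
  simp only [mem_vertices, List.mem_cons, exists_eq_or_imp]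

theorem mem_vertices_append {Γ Δ : List (Formula 𝒜)} {k : Formula 𝒜} :
    k ∈ vertices link (Γ ++ Δ) ↔ k ∈ vertices link Γ ∨ k ∈ vertices link Δ := by
  simp only [mem_vertices, List.mem_append, or_and_right, exists_or]

theorem mem_hyperedges_cons {Γ : List (Formula 𝒜)} {A : Formula 𝒜} {h : Formula 𝒜 × Bool} :
    h ∈ hyperedges (A :: Γ) ↔ h ∈ A.hyper ∨ h ∈ hyperedges Γ := by
  simp only [mem_hyperedges, List.mem_cons, exists_eq_or_imp]

theorem mem_hyperedges_append {Γ Δ : List (Formula 𝒜)} {h : Formula 𝒜 × Bool} :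
    h ∈ hyperedges (Γ ++ Δ) ↔ h ∈ hyperedges Γ ∨ h ∈ hyperedges Δ := by
  simp only [mem_hyperedges, List.mem_append, or_and_right, exists_or]

theorem vertex_eq_compound {F k : Formula 𝒜} (hk : ∀ l i, k ≠ .leaf l i)
    (h : vertex link F = k) : F = k := by
  cases F with
  | leaf l i => exact absurd h.symm (hk _ _)
  | tens A B => exact h
  | par A B => exact h

/-- One part of a sequent that is split by the root `T` is linked. -/
theorem Linked.of_split {Γ Δ₁ Δ₂ : List (Formula 𝒜)} {T k₁ : Formula 𝒜}
    (h : Linked (vertices link Γ) (hyperedges Γ) Prod.fst (hyperLeft link) (hyperRight link))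
    (hd : ∀ k ∈ vertices link Δ₁, k ∉ vertices link Δ₂)
    (hT : T ∉ vertices link Δ₁) (hv : vertices link Δ₁ ⊆ vertices link Γ)
    (hH : ∀ h ∈ hyperedges Γ, h.1 = T ∧ (hyperLeft link h ∈ vertices link Δ₁ →
      hyperLeft link h = k₁) ∨ h ∈ hyperedges Δ₁ ∨ h ∈ hyperedges Δ₂) :
    Linked (vertices link Δ₁) (hyperedges Δ₁) Prod.fst (hyperLeft link) (hyperRight link) := by
  refine h.restrict hv (k₁ := k₁) fst_mem_vertices left_mem_vertices right_mem_vertices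
    fun h hh => ?_
  rcases hH h hh with ⟨h₁, h₂⟩ | h₁ | h₁
  · exact .inr ⟨fun h₃ => absurd (h₁ ▸ h₃) hT, h₂⟩
  · exact .inl h₁
  · exact .inr ⟨fun h₃ => absurd (fst_mem_vertices h h₁) (hd _ h₃),
      fun h₃ => absurd (left_mem_vertices h h₁) (hd _ h₃)⟩

/-- One part of a sequent that is split by the root `T` is sound. -/
theorem Sound.of_split {Γ Δ₁ Δ₂ : List (Formula 𝒜)} {T : Formula 𝒜} (h : Sound link Γ)
    (hL : Linked (vertices link Δ₁) (hyperedges Δ₁) Prod.fst (hyperLeft link) (hyperRight link))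
    (hd : ∀ k ∈ vertices link Δ₁, k ∉ vertices link Δ₂)
    (hs : (seqLeaves Γ).Perm (seqLeaves Δ₁ ++ seqLeaves Δ₂))
    (hv : ∀ k ∈ vertices link Γ, k = T ∨ k ∈ vertices link Δ₁ ∨ k ∈ vertices link Δ₂)
    (hc : (seqHyper Δ₁).length + (vertices link Δ₂).card + 1 ≤ (seqHyper Γ).length) :
    Sound link Δ₁ where
  distinct := by
    refine Distinct.of_idx (l := idx Δ₂) h.distinct ?_
    simp only [idx_eq, ← List.map_append]
    exact hs.map _
  link_mem l i hi := by
    have hi' := hs.mem_iff.2 (List.mem_append_left _ hi)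
    have := h.link_mem l i hi'
    rcases List.mem_append.1 (hs.mem_iff.1 this) with h₁ | h₁
    · exact h₁
    -- Both ends of an axiom link are the same vertex, so no link leads from one part to the other.
    · refine absurd ?_ (hd _ (vertex_mem_of_leaf hi))
      have := vertex_mem_of_leaf (link := link) h₁
      rwa [vertex, h.link_link i (mem_idx_iff.2 ⟨l, hi'⟩), min_comm] at this
  link_link i hi := by
    obtain ⟨l, hi⟩ := mem_idx_iff.1 hi
    exact h.link_link i (mem_idx_iff.2 ⟨l, hs.mem_iff.2 (List.mem_append_left _ hi)⟩)
  linked := hL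
  card := by
    classical
    have h₁ : vertices link Γ ⊆ insert T (vertices link Δ₁ ∪ vertices link Δ₂) := fun k hk => by
      simpa using hv k hk
    have h₂ := Finset.card_le_card h₁
    have h₃ := Finset.card_insert_le T (vertices link Δ₁ ∪ vertices link Δ₂)
    have h₄ := Finset.card_union_le (vertices link Δ₁) (vertices link Δ₂)
    have h₅ := h.card
    omega

/-- A root par accounts for one vertex and one hyperedge. This is `of_split` with nothing on the
second side. -/
theorem Sound.of_par {A B : Formula 𝒜} {Γ : List (Formula 𝒜)} (h : Sound link (.par A B :: Γ)) :
    Sound link (A :: B :: Γ) := by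
  have hT : (.par A B : Formula 𝒜) ∉ vertices link (A :: B :: Γ) := fun hm => by
    obtain ⟨G, hG, F, hF, e⟩ := mem_vertices.1 hm
    obtain rfl := vertex_eq_compound (by simp) e
    simp only [List.mem_cons] at hG
    have hA := A.length_pos
    have hB := B.length_pos
    rcases hG with rfl | rfl | hG
    · have := Formula.length_le hF; simp only [Formula.idx, List.length_append] at this; omega
    · have := Formula.length_le hF; simp only [Formula.idx, List.length_append] at this; omega
    · exact Formula.not_mem_of_distinct h.distinct hG hF
  have hv : ∀ k, k ∈ vertices link (.par A B :: Γ) ↔ k = .par A B ∨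
      k ∈ vertices link (A :: B :: Γ) := fun k => by
    simp only [mem_vertices_cons, Formula.nodes, List.mem_cons, List.mem_append, or_and_right,
      exists_or, exists_eq_left, or_assoc]
    rw [vertex, eq_comm]
  refine h.of_split (Δ₂ := []) (T := .par A B) (h.linked.of_split (Δ₂ := []) (T := .par A B)
    (k₁ := vertex link A) ?_ hT
    (fun k hk => (hv k).2 (.inr hk)) fun h hh => ?_) ?_ ?_ (fun k hk => ?_) ?_
  · simp [mem_vertices]
  · simp only [mem_hyperedges, List.mem_cons, exists_eq_or_imp, Formula.hyper, List.mem_append] at hh ⊢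
    rcases hh with (rfl | hh) | hh
    · exact .inl ⟨rfl, fun _ => rfl⟩
    · right; left; tauto
    · right; left; tauto
  · simp [mem_vertices]
  · simp [seqLeaves, Formula.leaves]
  · have := (hv k).1 hk; tauto
  · simp [seqHyper, Formula.hyper, vertices, seqNodes]

/-- The tensor accounts for one vertex and two hyperedges. By `Linked.card_le` each part has at most
one vertex more than hyperedges, so the strict inequality for the whole forces it for both parts. -/
theorem Sound.of_tens {A B : Formula 𝒜} {Γ Δ : List (Formula 𝒜)}
    (h : Sound link (.tens A B :: (Γ ++ Δ)))
    (hd : ∀ k ∈ vertices link (A :: Γ), k ∉ vertices link (B :: Δ)) :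
    Sound link (A :: Γ) ∧ Sound link (B :: Δ) := by
  have hT : ∀ G ∈ A :: B :: (Γ ++ Δ), ∀ F ∈ G.nodes, vertex link F ≠ .tens A B := by
    intro G hG F hF e
    obtain rfl := vertex_eq_compound (by simp) e
    simp only [List.mem_cons] at hG
    have hA := A.length_pos
    have hB := B.length_pos
    rcases hG with rfl | rfl | hG
    · have := Formula.length_le hF; simp only [Formula.idx, List.length_append] at this; omega
    · have := Formula.length_le hF; simp only [Formula.idx, List.length_append] at this; omega
    · exact Formula.not_mem_of_distinct h.distinct hG hF
  have hv : ∀ k, k ∈ vertices link (.tens A B :: (Γ ++ Δ)) ↔ k = .tens A B ∨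
      k ∈ vertices link (A :: Γ) ∨ k ∈ vertices link (B :: Δ) := fun k => by
    simp only [mem_vertices_cons, mem_vertices_append, Formula.nodes, List.mem_cons,
      List.mem_append, or_and_right, exists_or, exists_eq_left, or_assoc]
    rw [vertex, eq_comm, or_left_comm (a := ∃ F ∈ B.nodes, _)]
  have hHT : ∀ h ∈ hyperedges (.tens A B :: (Γ ++ Δ)), h = (.tens A B, true) ∨
      h = (.tens A B, false) ∨ h ∈ hyperedges (A :: Γ) ∨ h ∈ hyperedges (B :: Δ) := by
    intro h hh
    simp only [mem_hyperedges_cons, mem_hyperedges_append, List.mem_cons, Formula.hyper,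
      List.mem_append] at hh ⊢
    tauto
  have hA : vertex link A ∈ vertices link (A :: Γ) :=
    mem_vertices.2 ⟨A, by simp, A, A.self_mem_nodes, rfl⟩
  have hB : vertex link B ∈ vertices link (B :: Δ) :=
    mem_vertices.2 ⟨B, by simp, B, B.self_mem_nodes, rfl⟩
  have hTA : (.tens A B : Formula 𝒜) ∉ vertices link (A :: Γ) := fun hm => by
    obtain ⟨G, hG, F, hF, e⟩ := mem_vertices.1 hm
    exact hT G (by simp only [List.mem_cons, List.mem_append] at hG ⊢; tauto) F hF e
  have hTB : (.tens A B : Formula 𝒜) ∉ vertices link (B :: Δ) := fun hm => by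
    obtain ⟨G, hG, F, hF, e⟩ := mem_vertices.1 hm
    exact hT G (by simp only [List.mem_cons, List.mem_append] at hG ⊢; tauto) F hF e
  have hd' : ∀ k ∈ vertices link (B :: Δ), k ∉ vertices link (A :: Γ) := fun k h₁ h₂ => hd k h₂ h₁
  have lA := h.linked.of_split (k₁ := vertex link A) hd hTA (fun k hk => (hv k).2 (by tauto))
    fun h hh => by
      rcases hHT h hh with rfl | rfl | h₁ | h₁
      · exact .inl ⟨rfl, fun _ => rfl⟩
      · exact .inl ⟨rfl, fun h => absurd hB (hd _ h)⟩
      · exact .inr (.inl h₁)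
      · exact .inr (.inr h₁)
  have lB := h.linked.of_split (k₁ := vertex link B) hd' hTB (fun k hk => (hv k).2 (by tauto))
    fun h hh => by
      rcases hHT h hh with rfl | rfl | h₁ | h₁
      · exact .inl ⟨rfl, fun h => absurd hA (hd' _ h)⟩
      · exact .inl ⟨rfl, fun _ => rfl⟩
      · exact .inr (.inr h₁)
      · exact .inr (.inl h₁)
  classical
  have cA := (lA.card_le fst_mem_vertices left_mem_vertices).trans
    (Nat.succ_le_succ (card_hyperedges_le _))
  have cB := (lB.card_le fst_mem_vertices left_mem_vertices).trans
    (Nat.succ_le_succ (card_hyperedges_le _))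
  have hlen : (seqHyper (.tens A B :: (Γ ++ Δ))).length =
      (seqHyper (A :: Γ)).length + (seqHyper (B :: Δ)).length + 2 := by
    simp [seqHyper, Formula.hyper]; omega
  refine ⟨h.of_split lA hd ?_ (fun k hk => (hv k).1 hk) (by omega),
    h.of_split lB hd' ?_ (fun k hk => by have := (hv k).1 hk; tauto) (by omega)⟩
  · rw [List.perm_iff_count]; intro a; simp [seqLeaves, Formula.leaves]; omega
  · rw [List.perm_iff_count]; intro a; simp [seqLeaves, Formula.leaves]; omega

end Splitting

/-! ### Derivations from splitting vertices. -/

section Sequentialization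

variable {𝒜 : Type w} {link : ℕ → ℕ}

theorem Distinct.label_unique {Γ : List (Formula 𝒜)} (h : Distinct Γ) {l l' : Label 𝒜} {i : ℕ}
    (hl : (l, i) ∈ seqLeaves Γ) (hl' : (l', i) ∈ seqLeaves Γ) : l = l' := by
  rw [Distinct, idx_eq] at h
  exact congrArg Prod.fst (List.inj_on_of_nodup_map h hl hl' rfl)

theorem Label.ne_dual (l : Label 𝒜) : l ≠ l.dual := by
  cases l <;> simp [Label.dual]

theorem vertex_leaf_eq {l : Label 𝒜} {i : ℕ} {F : Formula 𝒜}
    (h : vertex link F = vertex link (.leaf l i)) :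
    ∃ l' j, F = .leaf l' j ∧ min j (link j) = min i (link i) := by
  cases F with
  | leaf l' j => exact ⟨l', j, rfl, by simpa [vertex] using h⟩
  | tens A B => simp [vertex] at h
  | par A B => simp [vertex] at h

/-- A sound sequent with a single vertex is an axiom. -/
theorem Sound.provable_of_leaf {Γ : List (Formula 𝒜)} (h : Sound link Γ) {l : Label 𝒜} {i : ℕ}
    (hi : (l, i) ∈ seqLeaves Γ) (hK : ∀ k ∈ vertices link Γ, k = vertex link (.leaf l i)) :
    Provable link Γ := by
  have hll := h.link_link i (mem_idx_iff.2 ⟨l, hi⟩)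
  have key : ∀ F ∈ Γ, F = .leaf l i ∨ F = .leaf l.dual (link i) := fun F hF => by
    obtain ⟨l', j, rfl, hj⟩ := vertex_leaf_eq (hK _ (mem_vertices.2 ⟨F, hF, F, F.self_mem_nodes, rfl⟩))
    have hj' : (l', j) ∈ seqLeaves Γ := List.mem_flatMap.2 ⟨_, hF, by simp [Formula.leaves]⟩
    have hlj := h.link_link j (mem_idx_iff.2 ⟨l', hj'⟩)
    have : j = i ∨ j = link i := by
      rcases min_choice j (link j) with e | e <;> rcases min_choice i (link i) with e' | e' <;>
        rw [e, e'] at hj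
      · exact .inl hj
      · exact .inr hj
      · exact .inr (by rw [← hj, hlj])
      · exact .inl (by rw [← hlj, hj, hll])
    rcases this with rfl | rfl
    · exact .inl (by rw [h.distinct.label_unique hj' hi])
    · exact .inr (by rw [h.distinct.label_unique hj' (h.link_mem l i hi)])
  have hne : (Formula.leaf l i) ≠ .leaf l.dual (link i) := by
    simp [l.ne_dual]
  have mem : ∀ l' j, (l', j) ∈ seqLeaves Γ → Formula.leaf l' j ∈ Γ := fun l' j hj => by
    obtain ⟨A, hA, hj⟩ := List.mem_flatMap.1 hj
    rcases key A hA with rfl | rfl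
    · simp only [Formula.leaves, List.mem_singleton, Prod.mk.injEq] at hj
      obtain ⟨rfl, rfl⟩ := hj
      exact hA
    · simp only [Formula.leaves, List.mem_singleton, Prod.mk.injEq] at hj
      obtain ⟨rfl, rfl⟩ := hj
      exact hA
  refine .perm _ _ ?_ (.ax l i (link i) rfl hll)
  rw [List.perm_ext_iff_of_nodup (by simpa using hne) h.distinct.nodup]
  intro F
  simp only [List.mem_cons, List.not_mem_nil, or_false]
  constructor
  · rintro (rfl | rfl)
    · exact mem _ _ hi
    · exact mem _ _ (h.link_mem _ _ hi)
  · exact key F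

/-- Sequentialization. -/
theorem Sound.provable {Γ : List (Formula 𝒜)} (h : Sound link Γ) : Provable link Γ := by
  classical
  obtain ⟨n, hn⟩ : ∃ n, (seqHyper Γ).length = n := ⟨_, rfl⟩
  induction n using Nat.strong_induction_on generalizing Γ with
  | _ n ih =>
  have : Nonempty (Formula 𝒜 × Bool) := ⟨(.leaf .one 0, true)⟩
  obtain ⟨c, hc, ρ, hρ, hρ'⟩ := h.linked.exists_splitting _ rfl fst_mem_vertices left_mem_vertices
    right_mem_vertices ((card_hyperedges_le Γ).trans_lt h.card)
  obtain ⟨A, hA, F, hF, rfl⟩ := mem_vertices.1 hc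
  -- The splitting vertex is not the target of any hyperedge, so a node that represents it as itself
  -- is a root.
  have root : vertex link F = F → F ∈ Γ := fun _ => by
    rcases Formula.eq_or_target (link := link) hF with rfl | ⟨g, hg, hg'⟩
    · exact hA
    · have := hρ' g (mem_hyperedges.2 ⟨A, hA, hg⟩)
      rcases hg' with e | e
      · exact absurd e this.1
      · exact absurd e this.2.1
  cases F with
  | leaf l i =>
    refine h.provable_of_leaf (List.mem_flatMap.2 ⟨A, hA, Formula.leaf_mem_nodes.1 hF⟩)
      fun k hk => by_contra fun hne => ?_
    -- Any other vertex would be assigned a hyperedge with base `c`, but leaves are not bases.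
    obtain ⟨h₁, h₂⟩ := hρ k hk hne
    obtain ⟨B, -, h₁⟩ := mem_hyperedges.1 h₁
    rcases (Formula.mem_hyper.1 h₁).2 with ⟨_, _, e⟩ | ⟨⟨_, _, e⟩, -⟩
    · simp [h₂, vertex] at e
    · simp [h₂, vertex] at e
  | par A B =>
    obtain ⟨Δ, hΔ⟩ : ∃ Δ, Γ.Perm (.par A B :: Δ) := ⟨_, List.perm_cons_erase (root rfl)⟩
    have h' := (h.perm hΔ).of_par
    have hl : (seqHyper Γ).length = (seqHyper (.par A B :: Δ)).length :=
      (hΔ.flatMap_right _).length_eq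
    exact .perm _ _ hΔ.symm (.par _ _ _ (ih _ (by
      rw [← hn, hl]; simp [seqHyper, Formula.hyper]) h' rfl))
  | tens A B =>
    obtain ⟨Δ, hΔ⟩ : ∃ Δ, Γ.Perm (.tens A B :: Δ) := ⟨_, List.perm_cons_erase (root rfl)⟩
    have hs := h.perm hΔ
    have hl : (seqHyper Γ).length = (seqHyper (.tens A B :: Δ)).length :=
      (hΔ.flatMap_right _).length_eq
    have hHm : ∀ g, g ∈ hyperedges Γ ↔ g ∈ hyperedges (.tens A B :: Δ) := fun g => by
      simp only [mem_hyperedges, hΔ.mem_iff]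
    -- The component map `ρ` is constant on every tree that does not contain the splitting tensor.
    have pass : ∀ G : Formula 𝒜, (.tens A B : Formula 𝒜) ∉ G.nodes → (∀ g ∈ G.hyper, g ∈ hyperedges Γ) →
        ∀ E ∈ G.nodes, ρ (vertex link E) = ρ (vertex link G) := fun G hG hG' =>
      Formula.const_of_hyper fun g hg => (hρ' g (hG' g hg)).2.2.2 fun e =>
        hG ((show g.1 = .tens A B from e) ▸ (Formula.mem_hyper.1 hg).1)
    have pA := A.length_pos
    have pB := B.length_pos
    have hρA : ∀ E ∈ A.nodes, ρ (vertex link E) = (.tens A B, true) := fun E hE =>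
      (pass A (fun hm => by
        have := Formula.length_le hm
        simp only [Formula.idx, List.length_append] at this; omega)
        (fun g hg => (hHm g).2 (by simp [mem_hyperedges_cons, Formula.hyper, hg])) E hE).trans
        ((hρ' (.tens A B, true) ((hHm _).2 (by simp [mem_hyperedges_cons, Formula.hyper]))).2.2.1
          rfl).1
    have hρB : ∀ E ∈ B.nodes, ρ (vertex link E) = (.tens A B, false) := fun E hE =>
      (pass B (fun hm => by
        have := Formula.length_le hm
        simp only [Formula.idx, List.length_append] at this; omega)
        (fun g hg => (hHm g).2 (by simp [mem_hyperedges_cons, Formula.hyper, hg])) E hE).trans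
        ((hρ' (.tens A B, false) ((hHm _).2 (by simp [mem_hyperedges_cons, Formula.hyper]))).2.2.1
          rfl).1
    have hρΔ : ∀ G ∈ Δ, ∀ E ∈ G.nodes, ρ (vertex link E) = ρ (vertex link G) := fun G hG =>
      pass G (Formula.not_mem_of_distinct hs.distinct hG)
        fun g hg => (hHm g).2 (mem_hyperedges.2 ⟨G, by simp [hG], hg⟩)
    -- The two hyperedges of the tensor lead to the sides of `A` and of `B`; the Boolean component
    -- of `ρ` distributes the context accordingly.
    let q : Formula 𝒜 → Bool := fun G => (ρ (vertex link G)).2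
    have hp : Δ.Perm (Δ.filter q ++ Δ.filter fun G => !q G) :=
      (List.filter_append_perm q Δ).symm
    have hs' := hs.perm (hp.cons _)
    obtain ⟨sA, sB⟩ := hs'.of_tens fun k h₁ h₂ => by
      have e₁ : (ρ k).2 = true := by
        rcases mem_vertices_cons.1 h₁ with ⟨E, hE, rfl⟩ | h₁
        · rw [hρA E hE]
        · obtain ⟨G, hG, E, hE, rfl⟩ := mem_vertices.1 h₁
          obtain ⟨hG, hq⟩ := List.mem_filter.1 hG
          rw [hρΔ G hG E hE]
          exact hq
      have e₂ : (ρ k).2 = false := by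
        rcases mem_vertices_cons.1 h₂ with ⟨E, hE, rfl⟩ | h₂
        · rw [hρB E hE]
        · obtain ⟨G, hG, E, hE, rfl⟩ := mem_vertices.1 h₂
          obtain ⟨hG, hq⟩ := List.mem_filter.1 hG
          rw [hρΔ G hG E hE]
          simpa [q] using hq
      simp [e₁] at e₂
    have hl' : (seqHyper Γ).length = (seqHyper (A :: Δ.filter q)).length +
        (seqHyper (B :: Δ.filter fun G => !q G)).length + 2 := by
      rw [hl, ((hp.cons (.tens A B)).flatMap_right Formula.hyper).length_eq (l₁ := seqHyper _)]
      simp [seqHyper, Formula.hyper]; omega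
    exact .perm _ _ (hΔ.trans (hp.cons _)).symm
      (.tens _ _ _ _ (ih _ (by omega) sA rfl) (ih _ (by omega) sB rfl))

end Sequentialization

/-! ### Correct nets are sound -/

section Correctness

variable {𝒜 : Type w}

theorem Formula.not_mem_both {A B F : Formula 𝒜} (h : (A.idx ++ B.idx).Nodup) (hA : F ∈ A.nodes)
    (hB : F ∈ B.nodes) : False := by
  obtain ⟨i, hi⟩ := exists_mem_idx F
  exact (List.nodup_append.1 h).2.2 i (idx_of_mem_nodes hA hi) i (idx_of_mem_nodes hB hi) rfl

theorem Formula.nodup_hyper {A : Formula 𝒜} (h : A.idx.Nodup) : A.hyper.Nodup := by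
  induction A with
  | leaf l i => exact List.nodup_nil
  | tens A B ihA ihB =>
    have pA := A.length_pos
    have pB := B.length_pos
    have key : ∀ x, (Formula.tens A B, x) ∉ A.hyper ++ B.hyper := fun x hx => by
      rcases List.mem_append.1 hx with hx | hx <;>
      · have := length_le (mem_hyper.1 hx).1
        simp only [Formula.idx, List.length_append] at this
        omega
    have h' := List.nodup_append.1 h
    rw [Formula.hyper, List.nodup_cons, List.nodup_cons, List.nodup_append, List.mem_cons]
    refine ⟨by simpa using key true, key false, ihA h'.1, ihB h'.2.1, fun x hx y hy e => ?_⟩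
    subst e
    exact not_mem_both h (mem_hyper.1 hx).1 (mem_hyper.1 hy).1
  | par A B ihA ihB =>
    have pA := A.length_pos
    have pB := B.length_pos
    have key : ∀ x, (Formula.par A B, x) ∉ A.hyper ++ B.hyper := fun x hx => by
      rcases List.mem_append.1 hx with hx | hx <;>
      · have := length_le (mem_hyper.1 hx).1
        simp only [Formula.idx, List.length_append] at this
        omega
    have h' := List.nodup_append.1 h
    rw [Formula.hyper, List.nodup_cons, List.nodup_append]
    refine ⟨key true, ihA h'.1, ihB h'.2.1, fun x hx y hy e => ?_⟩
    subst e
    exact not_mem_both h (mem_hyper.1 hx).1 (mem_hyper.1 hy).1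

theorem Distinct.nodup_seqHyper {Γ : List (Formula 𝒜)} (h : Distinct Γ) : (seqHyper Γ).Nodup := by
  induction Γ with
  | nil => exact List.nodup_nil
  | cons A Γ ih =>
    have h' := h
    rw [Distinct, idx_cons, List.nodup_append] at h'
    rw [seqHyper, List.flatMap_cons, List.nodup_append]
    refine ⟨Formula.nodup_hyper h'.1, ih h'.2.1, fun x hx y hy e => ?_⟩
    subst e
    obtain ⟨B, hB, hy⟩ := mem_seqHyper.1 hy
    obtain ⟨i, hi⟩ := exists_mem_idx x.1
    exact h'.2.2 i (Formula.idx_of_mem_nodes (Formula.mem_hyper.1 hx).1 hi) i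
      (mem_idx_of_mem hB (Formula.idx_of_mem_nodes (Formula.mem_hyper.1 hy).1 hi)) rfl

theorem Distinct.nodup_of_mem {Γ : List (Formula 𝒜)} (h : Distinct Γ) {A F : Formula 𝒜}
    (hA : A ∈ Γ) (hF : F ∈ A.nodes) : F.idx.Nodup := by
  have hA' : A.idx.Nodup := (List.nodup_flatMap.1 h).1 A hA
  clear h hA
  induction A with
  | leaf l j =>
    simp only [Formula.nodes, List.mem_singleton] at hF
    exact hF ▸ hA'
  | tens A B ihA ihB =>
    simp only [Formula.nodes, List.mem_cons, List.mem_append] at hF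
    rcases hF with rfl | hF | hF
    · exact hA'
    · exact ihA hF (List.nodup_append.1 hA').1
    · exact ihB hF (List.nodup_append.1 hA').2.1
  | par A B ihA ihB =>
    simp only [Formula.nodes, List.mem_cons, List.mem_append] at hF
    rcases hF with rfl | hF | hF
    · exact hA'
    · exact ihA hF (List.nodup_append.1 hA').1
    · exact ihB hF (List.nodup_append.1 hA').2.1

theorem PreNet.vertex_link (π : PreNet 𝒜) {l l' : Label 𝒜} {i : ℕ}
    (hi : ∃ A ∈ π.sequent, Formula.leaf l i ∈ A.nodes) :
    vertex π.link (.leaf l' (π.link i)) = vertex π.link (.leaf l i) := by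
  obtain ⟨A, hA, hi⟩ := hi
  rw [vertex, vertex, π.link_link l i (List.mem_flatMap.2 ⟨A, hA, Formula.leaf_mem_nodes.1 hi⟩),
    min_comm]

/-- If no hyperedge separated `S` from its complement, every par could be switched to an argument on
its own side. No edge of that switching would cross between the sides, contrary to its
connectedness. -/
theorem PreNet.Correct.linked {π : PreNet 𝒜} (h : π.Correct) :
    Linked (vertices π.link π.sequent) (hyperedges π.sequent) Prod.fst (hyperLeft π.link)
      (hyperRight π.link) := by
  classical
  rintro S ⟨k, hk, hS⟩ ⟨k', hk', hS'⟩
  by_contra hno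
  push Not at hno
  let switch : Formula 𝒜 → Bool := fun F => decide (S (hyperLeft π.link (F, true)) ↔ S F)
  have edge : ∀ F F' : π.Node, PreNet.Edge π.link switch F.1 F'.1 →
      (S (vertex π.link F.1) ↔ S (vertex π.link F'.1)) := by
    rintro ⟨F, hF⟩ ⟨F', hF'⟩ he
    have hm : ∀ x, (F, x) ∈ hyperedges π.sequent ↔
        ((∃ B D, F = .tens B D) ∨ (∃ B D, F = .par B D) ∧ x = true) := fun x => by
      obtain ⟨A, hA, hF⟩ := hF
      constructor
      · intro h
        obtain ⟨A, hA, h⟩ := mem_hyperedges.1 h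
        exact (Formula.mem_hyper.1 h).2
      · intro h
        exact mem_hyperedges.2 ⟨A, hA, Formula.mem_hyper.2 ⟨hF, h⟩⟩
    dsimp only at he
    cases he with
    | tensLeft A B =>
      have := hno _ ((hm true).2 (.inl ⟨_, _, rfl⟩))
      simp only [hyperLeft, hyperRight] at this
      simp only [vertex] at this ⊢
      tauto
    | tensRight A B =>
      have := hno _ ((hm false).2 (.inl ⟨_, _, rfl⟩))
      simp only [hyperLeft, hyperRight] at this
      simp only [vertex] at this ⊢
      tauto
    | parLeft A B hs =>
      exact (of_decide_eq_true hs).symm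
    | parRight A B hs =>
      have h₁ := of_decide_eq_false hs
      have := hno _ ((hm true).2 (.inr ⟨⟨_, _, rfl⟩, rfl⟩))
      simp only [hyperLeft, hyperRight] at this h₁
      simp only [vertex] at this h₁ ⊢
      tauto
    | linked l l' i => rw [π.vertex_link hF]
  obtain ⟨A, hA, F, hF, rfl⟩ := mem_vertices.1 hk
  obtain ⟨A', hA', F', hF', rfl⟩ := mem_vertices.1 hk'
  obtain ⟨p⟩ := (h switch).1.preconnected (⟨F, A, hA, hF⟩ : π.Node) ⟨F', A', hA', hF'⟩
  have walk : ∀ {u v : π.Node}, (π.switching switch).Walk u v →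
      (S (vertex π.link u.1) ↔ S (vertex π.link v.1)) := by
    intro u v p
    induction p with
    | nil => rfl
    | cons hadj _ ih =>
      refine Iff.trans ?_ ih
      rcases ((SimpleGraph.fromRel_adj _ _ _).1 hadj).2 with h | h
      · exact edge _ _ h
      · exact (edge _ _ h).symm
  exact hS' ((walk p).1 hS)

/-- The other end of the edge that a hyperedge contributes when all switches are on the left. -/
def hyperChild : Formula 𝒜 × Bool → Formula 𝒜
  | (.leaf l i, _) => .leaf l i
  | (.tens A _, true) => A
  | (.tens _ B, false) => B
  | (.par A _, _) => A

/-- The other end of an axiom link. -/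
def linkEnd (link : ℕ → ℕ) : Formula 𝒜 → Formula 𝒜
  | .leaf l i => .leaf l.dual (link i)
  | .tens A B => .tens A B
  | .par A B => .par A B

theorem length_hyperChild {A : Formula 𝒜} {h : Formula 𝒜 × Bool} (hh : h ∈ A.hyper) :
    (hyperChild h).idx.length < h.1.idx.length := by
  obtain ⟨F, x⟩ := h
  rcases (Formula.mem_hyper.1 hh).2 with ⟨B, D, rfl⟩ | ⟨⟨B, D, rfl⟩, rfl⟩
  · have := B.length_pos
    have := D.length_pos
    cases x <;> simp only [hyperChild, Formula.idx, List.length_append] <;> omega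
  · have := D.length_pos
    simp only [hyperChild, Formula.idx, List.length_append]; omega

theorem hyperChild_mem {A : Formula 𝒜} {h : Formula 𝒜 × Bool} (hh : h ∈ A.hyper) :
    hyperChild h ∈ A.nodes := by
  obtain ⟨F, x⟩ := h
  obtain ⟨h₁, h₂⟩ := Formula.mem_hyper.1 hh
  refine Formula.nodes_trans h₁ ?_
  rcases h₂ with ⟨B, D, rfl⟩ | ⟨⟨B, D, rfl⟩, rfl⟩
  · cases x <;> simp [hyperChild, Formula.nodes, Formula.self_mem_nodes]
  · simp [hyperChild, Formula.nodes, Formula.self_mem_nodes]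

theorem edge_hyperChild {link : ℕ → ℕ} {A : Formula 𝒜} {h : Formula 𝒜 × Bool} (hh : h ∈ A.hyper) :
    PreNet.Edge link (fun _ => true) h.1 (hyperChild h) := by
  obtain ⟨F, x⟩ := h
  rcases (Formula.mem_hyper.1 hh).2 with ⟨B, D, rfl⟩ | ⟨⟨B, D, rfl⟩, rfl⟩
  · cases x
    · exact .tensRight B D
    · exact .tensLeft B D
  · exact .parLeft B D rfl

/-- A child has fewer leaves than its parent, so the unordered edge shows which end is the base. The
two children of a tensor differ because their leaves do. -/
theorem hyperChild_inj {Γ : List (Formula 𝒜)} (hΓ : Distinct Γ) {h h' : Formula 𝒜 × Bool}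
    (hh : h ∈ hyperedges Γ) (hh' : h' ∈ hyperedges Γ)
    (e : s(h.1, hyperChild h) = s(h'.1, hyperChild h')) : h = h' := by
  obtain ⟨A, hA, hh⟩ := mem_hyperedges.1 hh
  obtain ⟨A', hA', hh'⟩ := mem_hyperedges.1 hh'
  have l := length_hyperChild hh
  have l' := length_hyperChild hh'
  rcases Sym2.eq_iff.1 e with ⟨e₁, e₂⟩ | ⟨e₁, e₂⟩
  · obtain ⟨F, x⟩ := h
    obtain ⟨F', x'⟩ := h'
    obtain rfl : F = F' := e₁
    obtain ⟨h₁, h₂⟩ := Formula.mem_hyper.1 hh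
    obtain ⟨-, h₃⟩ := Formula.mem_hyper.1 hh'
    have hn := hΓ.nodup_of_mem hA h₁
    rcases h₂ with ⟨B, D, rfl⟩ | ⟨⟨B, D, rfl⟩, rfl⟩
    · cases x <;> cases x' <;> first | rfl | skip
      · exact (Formula.not_mem_both hn B.self_mem_nodes ((show D = B from e₂) ▸ D.self_mem_nodes)).elim
      · exact (Formula.not_mem_both hn B.self_mem_nodes ((show B = D from e₂) ▸ D.self_mem_nodes)).elim
    · rcases h₃ with ⟨_, _, h₃⟩ | ⟨-, rfl⟩
      · simp at h₃
      · rfl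
  · rw [e₁, e₂] at l
    omega

/-- Switch every par to the left. In the resulting tree the hyperedges and the axiom links, the
latter counted by their larger ends `U`, give different edges, so together they are fewer than the
nodes. The nodes outside `U` inject into the vertices, which leaves fewer hyperedges than vertices.
-/
theorem PreNet.Correct.card {π : PreNet 𝒜} (h : π.Correct) :
    (seqHyper π.sequent).length < (vertices π.link π.sequent).card := by
  classical
  let N : Finset (Formula 𝒜) := (seqNodes π.sequent).toFinset
  have hN : ∀ F, F ∈ N ↔ ∃ A ∈ π.sequent, F ∈ A.nodes := fun F => by
    simp only [N, List.mem_toFinset, mem_seqNodes]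
  let _ : Fintype π.Node := Fintype.subtype N hN
  have hcard : Fintype.card π.Node = N.card := Fintype.subtype_card N hN
  let T := π.switching fun _ => true
  have tree := (h fun _ => true).card_edgeFinset
  let E : Finset (Sym2 (Formula 𝒜)) := T.edgeFinset.image (Sym2.map Subtype.val)
  have hE : E.card ≤ T.edgeFinset.card := Finset.card_image_le
  have mem_E : ∀ F F' : Formula 𝒜, (∃ A ∈ π.sequent, F ∈ A.nodes) →
      (∃ A ∈ π.sequent, F' ∈ A.nodes) → F ≠ F' → PreNet.Edge π.link (fun _ => true) F F' →
      s(F, F') ∈ E := fun F F' hF hF' hne he => by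
    let u : π.Node := ⟨F, hF⟩
    let v : π.Node := ⟨F', hF'⟩
    have huv : T.Adj u v :=
      (SimpleGraph.fromRel_adj _ _ _).2 ⟨fun e => hne (congrArg Subtype.val e), .inl he⟩
    exact Finset.mem_image.2 ⟨s(u, v), SimpleGraph.mem_edgeFinset.2 huv, rfl⟩
  let U : Finset (Formula 𝒜) := N.filter fun F => ∃ l i, F = .leaf l i ∧ π.link i < i
  let f : Formula 𝒜 × Bool → Sym2 (Formula 𝒜) := fun h => s(h.1, hyperChild h)
  let g : Formula 𝒜 → Sym2 (Formula 𝒜) := fun F => s(F, linkEnd π.link F)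
  have hf : ((hyperedges π.sequent).image f).card = (seqHyper π.sequent).length := by
    rw [Finset.card_image_of_injOn fun h hh h' hh' e => hyperChild_inj π.distinct hh hh' e,
      ← List.toFinset_card_of_nodup π.distinct.nodup_seqHyper, hyperedges]
  have hg : (U.image g).card = U.card := by
    refine Finset.card_image_of_injOn fun F hF F' hF' e => ?_
    obtain ⟨-, l, i, rfl, hi⟩ := Finset.mem_filter.1 hF
    obtain ⟨-, l', i', rfl, hi'⟩ := Finset.mem_filter.1 hF'
    rcases Sym2.eq_iff.1 e with ⟨e₁, -⟩ | ⟨e₁, e₂⟩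
    · exact e₁
    · simp only [linkEnd, Formula.leaf.injEq] at e₁ e₂
      omega
  have hdisj : Disjoint ((hyperedges π.sequent).image f) (U.image g) := by
    rw [Finset.disjoint_left]
    intro e h₁ h₂
    obtain ⟨h, hh, rfl⟩ := Finset.mem_image.1 h₁
    obtain ⟨F, hF, e⟩ := Finset.mem_image.1 h₂
    obtain ⟨-, l, i, rfl, hi⟩ := Finset.mem_filter.1 hF
    obtain ⟨A, hA, hh⟩ := mem_hyperedges.1 hh
    have : h.1 = .leaf l i ∨ h.1 = .leaf l.dual (π.link i) := by
      rcases Sym2.eq_iff.1 e with ⟨e₁, -⟩ | ⟨-, e₁⟩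
      · exact .inl e₁.symm
      · exact .inr e₁.symm
    rcases (Formula.mem_hyper.1 hh).2 with ⟨B, D, e'⟩ | ⟨⟨B, D, e'⟩, -⟩ <;> simp [e'] at this
  have hsub : (hyperedges π.sequent).image f ∪ U.image g ⊆ E := by
    intro e he
    rcases Finset.mem_union.1 he with he | he
    · obtain ⟨h, hh, rfl⟩ := Finset.mem_image.1 he
      obtain ⟨A, hA, hh⟩ := mem_hyperedges.1 hh
      refine mem_E _ _ ⟨A, hA, (Formula.mem_hyper.1 hh).1⟩ ⟨A, hA, hyperChild_mem hh⟩ (fun e => ?_)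
        (edge_hyperChild hh)
      have := length_hyperChild hh
      rw [← e] at this
      exact lt_irrefl _ this
    · obtain ⟨F, hF, rfl⟩ := Finset.mem_image.1 he
      obtain ⟨hF, l, i, rfl, hi⟩ := Finset.mem_filter.1 hF
      have hF := (hN _).1 hF
      refine mem_E _ _ hF ?_ (by simp [linkEnd, l.ne_dual]) (.linked _ _ _)
      obtain ⟨A, hA, hF⟩ := hF
      have := π.link_mem l i (List.mem_flatMap.2 ⟨A, hA, Formula.leaf_mem_nodes.1 hF⟩)
      obtain ⟨B, hB, h'⟩ := List.mem_flatMap.1 this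
      exact ⟨B, hB, Formula.leaf_mem_nodes.2 h'⟩
  have hU : (N.filter fun F => ¬ ∃ l i, F = .leaf l i ∧ π.link i < i).card ≤
      (vertices π.link π.sequent).card := by
    refine Finset.card_le_card_of_injOn (vertex π.link) (fun F hF => ?_) fun F hF F' hF' e => ?_
    · obtain ⟨A, hA, hF⟩ := (hN F).1 (Finset.mem_filter.1 hF).1
      exact mem_vertices.2 ⟨A, hA, F, hF, rfl⟩
    · obtain ⟨hF, hu⟩ := Finset.mem_filter.1 hF
      obtain ⟨hF', hu'⟩ := Finset.mem_filter.1 hF'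
      cases F with
      | leaf l i =>
        obtain ⟨l', j, rfl, hj⟩ := vertex_leaf_eq e.symm
        have h₁ : ¬ π.link i < i := fun h => hu ⟨l, i, rfl, h⟩
        have h₂ : ¬ π.link j < j := fun h => hu' ⟨l', j, rfl, h⟩
        obtain rfl : j = i := by omega
        obtain ⟨A, hA, hF⟩ := (hN _).1 hF
        obtain ⟨A', hA', hF'⟩ := (hN _).1 hF'
        rw [π.distinct.label_unique (List.mem_flatMap.2 ⟨A, hA, Formula.leaf_mem_nodes.1 hF⟩)
          (List.mem_flatMap.2 ⟨A', hA', Formula.leaf_mem_nodes.1 hF'⟩)]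
      | tens A B => exact (vertex_eq_compound (by simp [vertex]) e.symm).symm
      | par A B => exact (vertex_eq_compound (by simp [vertex]) e.symm).symm
  have h₁ := Finset.card_le_card hsub
  rw [Finset.card_union_of_disjoint hdisj, hf, hg] at h₁
  have h₂ := Finset.card_filter_add_card_filter_not (s := N)
    (fun F => ∃ l i, F = Formula.leaf l i ∧ π.link i < i)
  have h₃ : T.edgeFinset.card + 1 = N.card := by
    rw [← hcard, ← tree]
  change U.card + _ = _ at h₂
  omega

theorem PreNet.Correct.sound {π : PreNet 𝒜} (h : π.Correct) : Sound π.link π.sequent :=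
  ⟨π.distinct, π.link_mem, fun _ hi => π.link_link_of_mem hi, h.linked, h.card⟩

end Correctness

/-! ### The equivariant family of a value. -/

section Family

variable {𝒜 : Type w} {C : Type u} [Category.{v} C] [MonoidalCategory C] [SymmetricCategory C]
  [StarAutonomous C] {G₀ : 𝒜 → C}

theorem PreNet.Correct.exists_val (G₀ : 𝒜 → C) {π : PreNet 𝒜} (h : π.Correct) :
    ∃ χ : NetForm G₀, Val π χ := by
  obtain ⟨φ, hφ, hp⟩ := h.sound.provable.exists_der G₀
  obtain ⟨χ, hχ, -⟩ := CutPlug.exists_of_perm π.cuts (hp.trans List.perm_append_comm)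
  exact ⟨χ, φ, hφ, hp, hχ⟩

theorem Form.exists_arrow (χ : NetForm G₀) {Γ : List (Formula 𝒜)} (hχ : χ.leaves.Perm Γ)
    {s t : Bracketing (Formula 𝒜)} (h : Complementary Γ s t) :
    ∃ f : srcObj (obj G₀) s ⟶ parObj (obj G₀) t,
      χ ≋ (⟨.node s t, decurry (obj G₀) f⟩ : NetForm G₀) := by
  obtain ⟨m, hm⟩ := χ.exists_equiv (t := .node s t) (hχ.trans h.symm)
  obtain ⟨f, hf⟩ := (decurryEquiv (obj G₀) s t).surjective m
  exact ⟨f, hm.trans (Form.equiv_of_eq hf.symm)⟩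

/-- The equivariant family of a form. -/
noncomputable def Form.family (χ : NetForm G₀) {Γ : List (Formula 𝒜)} (hχ : χ.leaves.Perm Γ) :
    EquivariantFamily (obj G₀) Γ where
  arrow _ _ h := (χ.exists_arrow hχ h).choose
  equivariant _ _ _ _ h h' := transposes_iff.2
    ((χ.exists_arrow hχ h').choose_spec.symm.trans (χ.exists_arrow hχ h).choose_spec)

/-- All values of `π` are equivalent, and on a fixed bracketing without repetitions equivalent forms
are equal. Complete de-curryfication is injective, so the representative on each pair of bracketings
is unique. -/
theorem Val.determines {π : PreNet 𝒜} {χ : NetForm G₀} (h : Val π χ) {Γ : List (Formula 𝒜)}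
    (hχ : χ.leaves.Perm Γ) : Determines G₀ π (χ.family hχ) := by
  intro s t hst f
  have hs := (χ.exists_arrow hχ hst).choose_spec
  rw [gFlat_iff]
  constructor
  · intro hf
    have hn : (⟨.node s t, decurry (obj G₀) f⟩ : NetForm G₀).leaves.Nodup := by
      refine hf.perm.nodup_iff.2 ?_
      exact (List.nodup_append.1 π.distinct.nodup).1
    exact decurry_injective _ (Form.eq_of_equiv hn (hf.unique (h.congr hs)))
  · rintro rfl
    exact h.congr hs

end Family

end OrdinaryNets

/-- An ordinary proof net with cuts and every net obtained from it by cut elimination (in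
particular its cut-free normal form) determine the same equivariant family of arrows. -/
theorem mainTheorem8 {𝒜 : Type w} {C : Type u} [CategoryTheory.Category.{v} C]
    [CategoryTheory.MonoidalCategory C] [CategoryTheory.SymmetricCategory C]
    [OrdinaryNets.StarAutonomous C] (G₀ : 𝒜 → C)
    (π π' : OrdinaryNets.PreNet 𝒜) (hπ : π.Correct)
    (hred : Relation.ReflTransGen OrdinaryNets.PreNet.Step π π') :
    ∃ F : OrdinaryNets.EquivariantFamily (OrdinaryNets.obj G₀) π.concl,
      OrdinaryNets.Determines G₀ π F ∧ OrdinaryNets.Determines G₀ π' F := by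
  obtain ⟨χ, hχ⟩ := hπ.exists_val G₀
  -- Correctness has served only to give `π` a value; the steps transport this same form to `π'`.
  have h' : OrdinaryNets.Val π' χ := by
    induction hred with
    | refl => exact hχ
    | tail _ hs ih => exact ih.step hs
  exact ⟨χ.family hχ.perm, hχ.determines _, h'.determines _⟩
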